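/- **Setting.** Let $\mathcal K\subseteq[0,1]^d$ be a closed convex set with $\mathbf 0\in\mathcal K$ and positive diameter that is down-closed ($\mathbf y\in\mathcal K$ and $\mathbf 0\le\mathbf x\le\mathbf y$ imply $\mathbf x\in\mathcal K$). Let $\mathcal L_0=\operatorname{span}\mathcal K$ and $k=\dim\mathcal L_0$. For zeroth-order feedback let also $\mathbf c\in\mathcal K$ and $r>0$ be such that $\mathbf c+\mathbf w\in\mathcal K$ for all $\mathbf w\in\mathcal L_0$ with $\|\mathbf w\|\le r$. An oblivious adversary fixes differentiable functions $f_t:[0,1]^d\to\mathbb R_{\ge0}$, $1\le t\le T$, that are DR-submodular ($\mathbf x\le\mathbf y$ implies $\nabla f_t(\mathbf x)\ge\nabla f_t(\mathbf y)$), not necessarily monotone, with $\|\nabla f_t\|\le M_1$ on $\mathcal K$, together with stochastic oracles with independent noise. A first-order (zeroth-order) oracle for $f_t$, queried at $\mathbf x\in\mathcal K$, returns an unbiased estimate of $\nabla f_t(\mathbf x)$ (of $f_t(\mathbf x)$) of norm (absolute value) at most $B>0$. If $\hat{\mathbf x}_t$ is the action played in round $t$, $\mathbf u_t^*\in\arg\max_{\mathbf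 u\in\mathcal K}f_t(\mathbf u)$ is any choice of maximizers, and $P_T=\sum_{t=2}^T\|\mathbf u^*_t-\mathbf u^*_{t-1}\|$, the expected dynamic $1/e$-regret is $\mathcal{DR}_{1/e}(T)=\frac1e\sum_{t=1}^Tf_t(\mathbf u_t^*)-\sum_{t=1}^T\mathbb E[f_t(\hat{\mathbf x}_t)]$. **Base learner.** *Improved Ader* on a domain $\mathcal X$ of diameter $D$, with horizon $n$ and gradient bound $G$, has $N=\lceil\frac12\log_2(1+\frac{4n}7)\rceil+1$ experts with step sizes $\eta_i=\frac{2^{i-1}D}{G}\sqrt{\frac7{2n}}$, arbitrary initial points $\mathbf x_1^i\in\mathcal X$ and initial weights $w_1^i=\frac{1+1/N}{i(i+1)}$. In round $t$ its action is $\mathbf x_t=\sum_iw_t^i\mathbf x_t^i$; after the feedback $\mathbf g_t$ it sets $\mathbf x_{t+1}^i=\mathbf P_{\mathcal X}(\mathbf x_t^i+\eta_i\mathbf g_t)$ (Euclidean projection) and $w_{t+1}^i\propto w_t^i\exp(\lambda\langle\mathbf g_t,\mathbf x_t^i-\mathbf x_t\rangle)$, normalized to sum to $1$, with $\lambda=\sqrt{2/(nG^2D^2)}$.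 **Query algorithm.** For a domain $\mathcal X=\mathbf o+s\mathcal K$, $s>0$, and $\mathbf x=\mathbf o+s\mathbf p\in\mathcal X$, $\mathbf p\in\mathcal K$, let $h_z(\mathbf x)=\mathbf o+s(\mathbf 1-e^{-z\mathbf p})$ (coordinatewise exponential) and $h=h_1$. BQND at $\mathbf x$ draws $z\in[0,1]$ with density $\frac{e^{z-1}}{1-e^{-1}}$, obtains a gradient estimate $\mathbf v$ at $h_z(\mathbf x)$ and returns $\mathbf v\odot e^{-z\mathbf p}$. **Algorithms.** All draws of the algorithms are independent of each other and of the oracle noise. * *Semi-bandit (SFTT).* The rounds are divided into consecutive blocks of length $L=\lceil T^{1/3}\rceil$, the last one being cut off at $T$. Improved Ader on $\mathcal X=\mathcal K$ with horizon $\lceil T/L\rceil$ and $G=B$ does one step per block. If $\mathbf x$ is its action in a block, one uniformly random position of the (full) block is chosen, in which $h_z(\mathbf x)$ is played and the first-order oracle answers there; the resulting output of BQND is the feedback of the block. All other rounds of the block play $h(\mathbf x)$. * *Zeroth-order full information (FOTZO).* With $\delta=T^{-1/4}$ and $\mathcal X=\hat{\mathcal K}_\delta=(1-\frac\delta r)\mathcal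 K+\frac\delta r\mathbf c$, Improved Ader with horizon $T$ and $G=\frac k\delta B$ does one step per round. If $\mathbf x_t$ is its action, $h(\mathbf x_t)$ is played, and the feedback is the output of BQND at $\mathbf x_t$, in which the gradient estimate at $\mathbf y=h_z(\mathbf x_t)$ is $\frac k\delta o\,\mathbf v$, where $\mathbf v$ is uniform on the unit sphere of $\mathcal L_0$ and $o$ is the oracle's answer at $\mathbf y+\delta\mathbf v$. * *Bandit (STB).* With $\delta=T^{-1/6}$, the semi-bandit algorithm (same $L$) is run on $\mathcal X=\hat{\mathcal K}_\delta$ with $G=\frac k\delta B$. In each round, if its action is $\mathbf y_t$, the action $\mathbf y_t+\delta\mathbf v_t$ with $\mathbf v_t$ uniform on the unit sphere of $\mathcal L_0$ is played, and $\frac k\delta o_t\mathbf v_t$ is passed to it as the gradient at $\mathbf y_t$, where $o_t$ is the observed value. **Claim.** There are a constant $C$ and an exponent $p$ that depend only on $d,M_1,B$ and (for the last two bounds) $r$, such that for all such $\mathcal K,\mathbf c$, functions, oracles and initial points, and all $T\ge1$ (with $\delta<r$ in the last two cases), the expected dynamic regret $\mathcal{DR}_{1/e}(T)$ is at most $C(1+\log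 T)^p$ times * $T^{2/3}\sqrt{1+P_T}$ for the semi-bandit algorithm, * $T^{3/4}\sqrt{1+P_T}$ for the zeroth-order full-information algorithm, * $T^{5/6}\sqrt{1+P_T}$ for the bandit algorithm. -/

import Mathlib

open MeasureTheory

universe u

noncomputable section

namespace DRSub

/-- Vectors of `ℝ^d` with the Euclidean norm. -/
abbrev Vec (d : ℕ) : Type := EuclideanSpace ℝ (Fin d)

/-- The unit cube `[0,1]^d`. -/
def unitCube (d : ℕ) : Set (Vec d) := {x | ∀ i, 0 ≤ x i ∧ x i ≤ 1}

/-- Constraint sets: closed convex down-closed subsets of the unit cube that contain the origin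
and have positive diameter. -/
structure IsConstraintSet {d : ℕ} (K : Set (Vec d)) : Prop where
  isClosed : IsClosed K
  convex : Convex ℝ K
  subset_cube : K ⊆ unitCube d
  zero_mem : (0 : Vec d) ∈ K
  down_closed : ∀ y ∈ K, ∀ x : Vec d, (∀ i, 0 ≤ x i ∧ x i ≤ y i) → x ∈ K
  nontrivial : K.Nontrivial

/-- The gradient of `f : [0,1]^d → ℝ` (one-sided derivatives on the boundary of the cube;
the values of `f` outside the cube play no role). -/
def grad {d : ℕ} (f : Vec d → ℝ) (x : Vec d) : Vec d := gradientWithin f (unitCube d) x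

/-- Objective functions: non-negative differentiable DR-submodular functions on the cube
(no monotonicity), with gradients bounded by `M` on `K`. -/
structure IsObjective {d : ℕ} (K : Set (Vec d)) (M : ℝ) (f : Vec d → ℝ) : Prop where
  nonneg : ∀ x ∈ unitCube d, 0 ≤ f x
  differentiableOn : DifferentiableOn ℝ f (unitCube d)
  dr_submodular : ∀ x ∈ unitCube d, ∀ y ∈ unitCube d, (∀ i, x i ≤ y i) →
    ∀ i, grad f y i ≤ grad f x i
  norm_grad_le : ∀ x ∈ K, ‖grad f x‖ ≤ M

/-! ### Stochastic oracles

An oracle answers a query at `x` with `O x ξ`, where the noise `ξ` has law `ν`. -/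

/-- A first-order oracle for `f`: unbiased for the gradient and bounded by `B`. -/
structure IsGradientOracle {d : ℕ} {Ξ : Type u} [MeasurableSpace Ξ] (K : Set (Vec d)) (B : ℝ)
    (f : Vec d → ℝ) (ν : Measure Ξ) (O : Vec d → Ξ → Vec d) : Prop where
  measurable : Measurable (Function.uncurry O)
  unbiased : ∀ x ∈ K, ∫ ξ, O x ξ ∂ν = grad f x
  bounded : ∀ x ∈ K, ∀ᵐ ξ ∂ν, ‖O x ξ‖ ≤ B

/-- A zeroth-order oracle for `f`: unbiased for the value and bounded by `B`. -/
structure IsValueOracle {d : ℕ} {Ξ : Type u} [MeasurableSpace Ξ] (K : Set (Vec d)) (B : ℝ)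
    (f : Vec d → ℝ) (ν : Measure Ξ) (O : Vec d → Ξ → ℝ) : Prop where
  measurable : Measurable (Function.uncurry O)
  unbiased : ∀ x ∈ K, ∫ ξ, O x ξ ∂ν = f x
  bounded : ∀ x ∈ K, ∀ᵐ ξ ∂ν, |O x ξ| ≤ B

/-! ### The base learner: Improved Ader -/

/-- Euclidean projection onto `S` (unique when `S` is nonempty, closed and convex). -/
def proj {d : ℕ} (S : Set (Vec d)) (x : Vec d) : Vec d :=
  Classical.epsilon fun y => y ∈ S ∧ ∀ w ∈ S, dist x y ≤ dist x w

/-- Number of experts for horizon `n`: `⌈(1/2) log₂ (1 + 4n/7)⌉ + 1`. -/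
def iaNum (n : ℕ) : ℕ := ⌈(1 / 2 : ℝ) * Real.logb 2 (1 + 4 * (n : ℝ) / 7)⌉₊ + 1

/-- Step size of expert `i = 0, 1, …` for horizon `n`, diameter `D`, gradient bound `G`. -/
def iaEta (n : ℕ) (D G : ℝ) (i : ℕ) : ℝ := 2 ^ i * D / G * Real.sqrt (7 / (2 * (n : ℝ)))

/-- Step size of the weights, `√(2 / (n G² D²))`. -/
def iaLam (n : ℕ) (D G : ℝ) : ℝ := Real.sqrt (2 / ((n : ℝ) * G ^ 2 * D ^ 2))

/-- State of the learner: the points and the weights of the `N` experts. -/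
structure IAState (d N : ℕ) where
  pt : Fin N → Vec d
  wt : Fin N → ℝ

/-- The action: the weighted average of the experts' points. -/
def IAState.action {d N : ℕ} (S : IAState d N) : Vec d := ∑ i, S.wt i • S.pt i

/-- Initial state, with experts at the points `x₁ i` and weights `(1 + 1/N) / (i (i + 1))` for
`i = 1, …, N` (here counted from `0`). -/
def iaInit {d : ℕ} (N : ℕ) (x₁ : ℕ → Vec d) : IAState d N where
  pt i := x₁ i
  wt i := (1 + 1 / (N : ℝ)) / (((i : ℝ) + 1) * ((i : ℝ) + 2))

/-- Unnormalised new weight of an expert after the reward vector `g`. -/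
def IAState.gain {d N : ℕ} (S : IAState d N) (lam : ℝ) (g : Vec d) (i : Fin N) : ℝ :=
  S.wt i * Real.exp (lam * inner ℝ g (S.pt i - S.action))

/-- One round: projected gradient ascent for each expert, exponential weights over experts. -/
def IAState.update {d N : ℕ} (S : IAState d N) (X : Set (Vec d)) (eta : ℕ → ℝ) (lam : ℝ)
    (g : Vec d) : IAState d N where
  pt i := proj X (S.pt i + eta i • g)
  wt i := S.gain lam g i / ∑ j, S.gain lam g j

/-- Improved Ader on the domain `X` with horizon `n` and gradient bound `G`. The feedback in round
`t` (counted from `0`) is `fb t x`, where `x` is the action of the learner in that round. -/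
def iaState {d : ℕ} (X : Set (Vec d)) (n : ℕ) (G : ℝ) (x₁ : ℕ → Vec d)
    (fb : ℕ → Vec d → Vec d) : ℕ → IAState d (iaNum n)
  | 0 => iaInit (iaNum n) x₁
  | t + 1 =>
    let S := iaState X n G x₁ fb t
    S.update X (iaEta n (Metric.diam X) G) (iaLam n (Metric.diam X) G) (fb t S.action)

/-- The action of Improved Ader in round `t`. -/
def iaAction {d : ℕ} (X : Set (Vec d)) (n : ℕ) (G : ℝ) (x₁ : ℕ → Vec d)
    (fb : ℕ → Vec d → Vec d) (t : ℕ) : Vec d := (iaState X n G x₁ fb t).action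

/-! ### Reparametrisation and query algorithm

These live on a domain `o + s • K`, the image of a down-closed set `K` under `p ↦ o + s • p`;
the set `K` itself is the case `o = 0`, `s = 1`. -/

/-- The domain `o + s • K`. -/
def dom {d : ℕ} (o : Vec d) (s : ℝ) (K : Set (Vec d)) : Set (Vec d) := (fun p => o + s • p) '' K

/-- The point of `K` that corresponds to a point `x` of `o + s • K`. -/
def coord {d : ℕ} (o : Vec d) (s : ℝ) (x : Vec d) : Vec d := s⁻¹ • (x - o)

/-- `h_z`, which is `p ↦ 1 - exp (-z p)` (coordinatewise) in the coordinates of `K`;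
`h = h_1` is the reparametrisation. -/
def hmap {d : ℕ} (o : Vec d) (s z : ℝ) (x : Vec d) : Vec d :=
  o + s • WithLp.toLp 2 fun i => 1 - Real.exp (-z * coord o s x i)

/-- The output of the query algorithm with draw `z` at the point `x`: the answer of the
gradient estimator `resp` at `h_z x`, multiplied coordinatewise by `exp (-z x)`. -/
def bqnd {d : ℕ} (o : Vec d) (s z : ℝ) (resp : Vec d → Vec d) (x : Vec d) : Vec d :=
  WithLp.toLp 2 fun i => resp (hmap o s z x) i * Real.exp (-z * coord o s x i)

/-! ### Randomness -/

/-- The law on `[0,1]` with density `exp (z - 1) / (1 - exp (-1))`. -/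
def zLaw : Measure ℝ :=
  (volume.restrict (Set.Icc 0 1)).withDensity
    fun z => ENNReal.ofReal (Real.exp (z - 1) / (1 - Real.exp (-1)))

/-- The linear space parallel to the affine hull of a set `K` that contains `0`. -/
def linSpace {d : ℕ} (K : Set (Vec d)) : Submodule ℝ (Vec d) := Submodule.span ℝ K

/-- The uniform law on the unit sphere of a linear subspace. -/
def sphereLaw {d : ℕ} (V : Submodule ℝ (Vec d)) : Measure (Vec d) :=
  (ProbabilityTheory.cond (Measure.addHaar : Measure V).toSphere Set.univ).map
    fun v : Metric.sphere (0 : V) 1 => ((v : V) : Vec d)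

/-- Outcomes: for each block `q` the draw `z` of the query algorithm and the position in the block
at which the query is made; for each round `t` a unit vector and the noise of the oracle. -/
abbrev Outcome (d : ℕ) (Ξ : Type u) : Type u := (ℕ → ℝ × ℕ) × (ℕ → Vec d × Ξ)

/-- All draws are independent; positions are uniform on `{0, …, L - 1}`, unit vectors are uniform
on the unit sphere of `V`, and the noise of round `t` has law `ν t`. An algorithm that
does not use one of the draws ignores it. -/
def outcomeLaw {d : ℕ} {Ξ : Type u} [MeasurableSpace Ξ] (V : Submodule ℝ (Vec d)) (L : ℕ)
    (ν : ℕ → Measure Ξ) : Measure (Outcome d Ξ) :=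
  (Measure.infinitePi fun _ : ℕ => zLaw.prod (ProbabilityTheory.uniformOn (Set.Iio L))).prod
    (Measure.infinitePi fun t : ℕ => (sphereLaw V).prod (ν t))

/-! ### The algorithms

Rounds are numbered `0, …, T - 1`. -/

/-- The full-information algorithm: in round `t` play `h (x_t)`, where `x_t` is the action of
Improved Ader, which is fed with the output of the query algorithm (draw `z t`).
The gradient estimator of round `t` is `resp t`. -/
def fullInfoPlay {d : ℕ} (o : Vec d) (s : ℝ) (K : Set (Vec d)) (T : ℕ) (G : ℝ) (x₁ : ℕ → Vec d)
    (z : ℕ → ℝ) (resp : ℕ → Vec d → Vec d) (t : ℕ) : Vec d :=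
  hmap o s 1 (iaAction (dom o s K) T G x₁ (fun m => bqnd o s (z m) (resp m)) t)

/-- Action in block `q` of Improved Ader inside SFTT with blocks of `L` rounds, where the only query
of block `q` is made in round `q * L + j q`. The base learner has the number `⌈T / L⌉` of
blocks as its horizon; the last block is cut off at the horizon `T`. -/
def sfttBase {d : ℕ} (o : Vec d) (s : ℝ) (K : Set (Vec d)) (T L : ℕ) (G : ℝ) (x₁ : ℕ → Vec d)
    (z : ℕ → ℝ) (j : ℕ → ℕ) (resp : ℕ → Vec d → Vec d) (q : ℕ) : Vec d :=
  iaAction (dom o s K) ⌈(T : ℝ) / (L : ℝ)⌉₊ G x₁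
    (fun m => bqnd o s (z m) (resp (m * L + j m))) q

/-- SFTT: the action in round `t` is the query point if `t` is the query round of its block,
and `h (x)` otherwise, with `x` the action of the base learner in this block. -/
def sfttPlay {d : ℕ} (o : Vec d) (s : ℝ) (K : Set (Vec d)) (T L : ℕ) (G : ℝ) (x₁ : ℕ → Vec d)
    (z : ℕ → ℝ) (j : ℕ → ℕ) (resp : ℕ → Vec d → Vec d) (t : ℕ) : Vec d :=
  if t = t / L * L + j (t / L) then
    hmap o s (z (t / L)) (sfttBase o s K T L G x₁ z j resp (t / L))
  else hmap o s 1 (sfttBase o s K T L G x₁ z j resp (t / L))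

/-- The one-point gradient estimator: the value oracle is queried at `y + δ v`, and the answer is
multiplied by `(k / δ) v`. -/
def onePoint {d : ℕ} (k : ℕ) (δ : ℝ) (v y : Vec d) (O : Vec d → ℝ) : Vec d :=
  ((k : ℝ) / δ * O (y + δ • v)) • v

/-- Block length `T^{1/3}`, rounded up. -/
def blockLength (T : ℕ) : ℕ := ⌈(T : ℝ) ^ (1 / 3 : ℝ)⌉₊

/-- Semi-bandit feedback: SFTT on the domain `K` with gradient bound `B`. -/
def semiBanditPlay {d : ℕ} {Ξ : Type u} (K : Set (Vec d)) (B : ℝ) (T : ℕ) (x₁ : ℕ → Vec d)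
    (O : ℕ → Vec d → Ξ → Vec d) (ω : Outcome d Ξ) (t : ℕ) : Vec d :=
  sfttPlay 0 1 K T (blockLength T) B x₁ (fun q => (ω.1 q).1) (fun q => (ω.1 q).2)
    (fun m y => O m y (ω.2 m).2) t

/-- The shrunk domain `(1 - δ/r) K + (δ/r) c`. -/
def shrunk {d : ℕ} (K : Set (Vec d)) (c : Vec d) (r δ : ℝ) : Set (Vec d) :=
  dom ((δ / r) • c) (1 - δ / r) K

/-- Zeroth-order full-information feedback: FOTZO with smoothing parameter `δ`, applied to the
full-information algorithm on the shrunk domain with gradient bound `k B / δ`. -/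
def zerothOrderPlay {d : ℕ} {Ξ : Type u} (K : Set (Vec d)) (c : Vec d) (r B δ : ℝ) (T : ℕ)
    (x₁ : ℕ → Vec d) (O : ℕ → Vec d → Ξ → ℝ) (ω : Outcome d Ξ) (t : ℕ) : Vec d :=
  let k := Module.finrank ℝ (linSpace K)
  fullInfoPlay ((δ / r) • c) (1 - δ / r) K T ((k : ℝ) / δ * B) x₁ (fun m => (ω.1 m).1)
    (fun m y => onePoint k δ (ω.2 m).1 y fun w => O m w (ω.2 m).2) t

/-- Bandit feedback: STB with smoothing parameter `δ`, applied to the semi-bandit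
algorithm on the shrunk domain with gradient bound `k B / δ`. -/
def banditPlay {d : ℕ} {Ξ : Type u} (K : Set (Vec d)) (c : Vec d) (r B δ : ℝ) (T : ℕ)
    (x₁ : ℕ → Vec d) (O : ℕ → Vec d → Ξ → ℝ) (ω : Outcome d Ξ) (t : ℕ) : Vec d :=
  let k := Module.finrank ℝ (linSpace K)
  sfttPlay ((δ / r) • c) (1 - δ / r) K T (blockLength T) ((k : ℝ) / δ * B) x₁
    (fun q => (ω.1 q).1) (fun q => (ω.1 q).2)
    (fun m y => onePoint k δ (ω.2 m).1 y fun w => O m w (ω.2 m).2) t + δ • (ω.2 t).1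

/-! ### Regret -/

/-- `u_0, …, u_{T-1}` is a sequence of maximisers of `f_0, …, f_{T-1}` over `K`. -/
def IsOptimalSequence {d : ℕ} (K : Set (Vec d)) (T : ℕ) (f : ℕ → Vec d → ℝ)
    (u : ℕ → Vec d) : Prop := ∀ t < T, u t ∈ K ∧ IsMaxOn (f t) K (u t)

/-- The path length of `u_0, …, u_{T-1}`. -/
def pathLength {d : ℕ} (T : ℕ) (u : ℕ → Vec d) : ℝ :=
  ∑ t ∈ Finset.range (T - 1), ‖u (t + 1) - u t‖

/-- Expected dynamic `1/e`-regret of the random actions `x` against `u`. -/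
def dynRegret {d : ℕ} {Ω : Type u} [MeasurableSpace Ω] (P : Measure Ω) (T : ℕ)
    (f : ℕ → Vec d → ℝ) (u : ℕ → Vec d) (x : Ω → ℕ → Vec d) : ℝ :=
  (1 / Real.exp 1) * ∑ t ∈ Finset.range T, f t (u t)
    - ∑ t ∈ Finset.range T, ∫ ω, f t (x ω t) ∂P

/-- `c` is the centre of a ball of radius `r` relative to the affine hull of `K`
that is contained in `K`. -/
def IsInnerBall {d : ℕ} (K : Set (Vec d)) (c : Vec d) (r : ℝ) : Prop :=
  c ∈ K ∧ ∀ w ∈ linSpace K, ‖w‖ ≤ r → c + w ∈ K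

end DRSub

end

open DRSub

/-!
The regret bound rests on a linearisation inequality for DR-submodular functions that need not be
monotone. Along `h_z(p) = 1 - exp (-z p)` the weight `exp (z - 1)` lets integration by parts turn
`∫ exp (z - 1) ⟨∇f(h_z(p)), (q - p) ⊙ exp (-z p)⟩ dz` into an upper bound for `f(q)/e - f(h(p))`:
concavity in non-negative directions bounds `⟨∇f, q ⊙ exp (-z p)⟩` from below by an increment of
`f`, and non-negativity of `f` shows that the value at the upper end is at least `exp (-z) f(q)`
(`IsObjective.gap_le_integral_inner`). The output of the query algorithm at `p` is an unbiased
estimate of this linear reward, up to the factor `1 - 1/e ≤ 1`. So the regret of playing `h(p_t)` is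
at most the dynamic regret of the base learner for bounded linear rewards, which is
`O(log n) G √(n D (D + P))` for horizon `n`, bound `G`, diameter `D` and path length `P`: one of the
step sizes is optimal up to a constant factor, and exponential weights compete with that expert
(`sum_inner_sub_iaAction_le`).

With values instead of gradients, Gauss' theorem on the ball, for the Lipschitz function `f` relative
to the span of `K`, says that the one-point estimator is unbiased for the gradient averaged over a
ball of radius `δ` (`integral_sphereLaw_onePoint`). The linearisation inequality holds on each shifted
domain, hence on average, with an error `2 M δ` (`IsValueOracle.gap_le`); shrinking the domain costs
`M √d δ / r` per round, and the estimator is bounded by `G = k B / δ`.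

Both feedback models are cases of one block algorithm on a domain `o + s K`, described by
`IsBlockSetup`; full information is the case of blocks of one round. That the expectation may
be taken step by step is proved by resampling: replacing one of the independent draws by a fresh copy
preserves the law (`measurePreserving_update`), and the action of a block does not depend on the
draws of that block. Since the oracles are only bounded almost surely at each fixed point, and
unrestricted elsewhere, the estimators are first truncated, which changes no action almost
surely (`IsBlockSetup.ae_blockAction_eq`). In a block of length `L` the query round is uniform, so one
query estimates the average gap of the block; comparing with the maximiser of the first round of
each block, the regret is `O(log T) L √n (G + M) √(1 + P)` with `n = ⌈T / L⌉`
(`IsBlockSetup.sum_gap_le_mul`), and the query rounds cost `M √d / L` per round. The choices of `L`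
and `δ` give the three rates.
-/

namespace DRSub

variable {d : ℕ} {K : Set (Vec d)} {M : ℝ} {f : Vec d → ℝ}

theorem convex_unitCube (d : ℕ) : Convex ℝ (unitCube d) := by
  intro x hx y hy a b ha hb hab i
  simp only [PiLp.add_apply, PiLp.smul_apply, smul_eq_mul]
  have h1 := hx i
  have h2 := hy i
  constructor
  · nlinarith [mul_nonneg ha h1.1, mul_nonneg hb h2.1]
  · nlinarith [mul_le_mul_of_nonneg_left h1.2 ha, mul_le_mul_of_nonneg_left h2.2 hb]

theorem isClosed_unitCube (d : ℕ) : IsClosed (unitCube d) := by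
  have : unitCube d = ⋂ i, {x : Vec d | 0 ≤ x i ∧ x i ≤ 1} := by
    ext x; simp [unitCube]
  rw [this]
  refine isClosed_iInter fun i => ?_
  have hc : Continuous fun x : Vec d => x i := by fun_prop
  exact (isClosed_le continuous_const hc).inter (isClosed_le hc continuous_const)

theorem norm_sub_le_of_mem_unitCube {x y : Vec d} (hx : x ∈ unitCube d) (hy : y ∈ unitCube d) :
    ‖x - y‖ ≤ Real.sqrt d := by
  rw [EuclideanSpace.norm_eq]
  apply Real.sqrt_le_sqrt
  calc ∑ i, ‖(x - y) i‖ ^ 2 ≤ ∑ _i : Fin d, (1 : ℝ) := by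
        refine Finset.sum_le_sum fun i _ => ?_
        have h1 := hx i
        have h2 := hy i
        have : ‖(x - y) i‖ ≤ 1 := by
          rw [PiLp.sub_apply, Real.norm_eq_abs, abs_le]
          constructor <;> linarith
        nlinarith [norm_nonneg ((x - y) i)]
    _ = d := by simp

namespace IsObjective

variable (hf : IsObjective K M f)
include hf

theorem hasGradientWithinAt {x : Vec d} (hx : x ∈ unitCube d) :
    HasGradientWithinAt f (grad f x) (unitCube d) x :=
  (hf.differentiableOn x hx).hasGradientWithinAt

/-- The chain rule along a curve in the cube. -/
theorem hasDerivWithinAt_comp {γ : ℝ → Vec d} {γ' : Vec d} {S : Set ℝ} {t : ℝ}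
    (hγ : HasDerivWithinAt γ γ' S t) (hS : Set.MapsTo γ S (unitCube d)) (ht : t ∈ S) :
    HasDerivWithinAt (fun τ => f (γ τ)) (inner ℝ (grad f (γ t)) γ') S t := by
  have h1 := (hf.hasGradientWithinAt (hS ht)).hasFDerivWithinAt
  have h2 := h1.comp_hasDerivWithinAt t hγ hS
  simp only [InnerProductSpace.toDual_apply_apply] at h2
  exact h2

/-- The mean value theorem on a segment of the cube. -/
theorem exists_sub_eq_inner {x a : Vec d} (hx : x ∈ unitCube d) (hxa : x + a ∈ unitCube d) :
    ∃ c ∈ Set.Ioo (0 : ℝ) 1, x + c • a ∈ unitCube d ∧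
      f (x + a) - f x = inner ℝ (grad f (x + c • a)) a := by
  have hmaps : Set.MapsTo (fun t : ℝ => x + t • a) (Set.Icc 0 1) (unitCube d) := by
    intro t ht
    have := (convex_unitCube d).add_smul_sub_mem hx hxa ht
    simpa using this
  have hder : ∀ t ∈ Set.Icc (0 : ℝ) 1, HasDerivWithinAt (fun t : ℝ => f (x + t • a))
      (inner ℝ (grad f (x + t • a)) a) (Set.Icc 0 1) t := by
    intro t ht
    refine hf.hasDerivWithinAt_comp (γ := fun t : ℝ => x + t • a) ?_ hmaps ht
    simpa using (((hasDerivAt_id t).smul_const a).const_add x).hasDerivWithinAt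
  obtain ⟨c, hc, h⟩ := exists_hasDerivAt_eq_slope (fun t : ℝ => f (x + t • a))
    (fun t => inner ℝ (grad f (x + t • a)) a) zero_lt_one
    (fun t ht => (hder t ht).continuousWithinAt)
    (fun t ht => (hder t ⟨ht.1.le, ht.2.le⟩).hasDerivAt (Icc_mem_nhds ht.1 ht.2))
  refine ⟨c, hc, hmaps ⟨hc.1.le, hc.2.le⟩, ?_⟩
  simpa using h.symm

theorem inner_grad_anti {x y a : Vec d} (hx : x ∈ unitCube d) (hy : y ∈ unitCube d)
    (hxy : ∀ i, x i ≤ y i) (ha : ∀ i, 0 ≤ a i) :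
    inner ℝ (grad f y) a ≤ inner ℝ (grad f x) a := by
  simp only [PiLp.inner_apply, RCLike.inner_apply, conj_trivial]
  exact Finset.sum_le_sum fun i _ =>
    mul_le_mul_of_nonneg_left (hf.dr_submodular x hx y hy hxy i) (ha i)

/-- Concavity along non-negative directions: the tangent at the lower end lies above. -/
theorem sub_le_inner_grad {x a : Vec d} (hx : x ∈ unitCube d) (hxa : x + a ∈ unitCube d)
    (ha : ∀ i, 0 ≤ a i) : f (x + a) - f x ≤ inner ℝ (grad f x) a := by
  obtain ⟨c, hc, hm, h⟩ := hf.exists_sub_eq_inner hx hxa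
  rw [h]
  refine hf.inner_grad_anti hx hm (fun i => ?_) ha
  simpa using mul_nonneg hc.1.le (ha i)

theorem inner_grad_le_sub {x a : Vec d} (hx : x ∈ unitCube d) (hxa : x + a ∈ unitCube d)
    (ha : ∀ i, 0 ≤ a i) : inner ℝ (grad f (x + a)) a ≤ f (x + a) - f x := by
  obtain ⟨c, hc, hm, h⟩ := hf.exists_sub_eq_inner hx hxa
  rw [h]
  refine hf.inner_grad_anti hm hxa (fun i => ?_) ha
  simpa using mul_le_of_le_one_left (ha i) hc.2.le

/-- Moving up by the fraction `t` of a non-negative vector costs at most the fraction `t` of the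
value, as `f` is concave along the segment and non-negative at its end. -/
theorem one_sub_mul_le {x a : Vec d} {t : ℝ} (hx : x ∈ unitCube d) (hxa : x + a ∈ unitCube d)
    (ha : ∀ i, 0 ≤ a i) (ht : t ∈ Set.Icc (0 : ℝ) 1) : (1 - t) * f x ≤ f (x + t • a) := by
  have hm : x + t • a ∈ unitCube d := by
    simpa using (convex_unitCube d).add_smul_sub_mem hx hxa ht
  have h1 := hf.inner_grad_le_sub hx hm (fun i => by simpa using mul_nonneg ht.1 (ha i))
  have he : x + t • a + (1 - t) • a = x + a := by module
  have h2 := hf.sub_le_inner_grad (a := (1 - t) • a) hm (by rwa [he])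
    (fun i => by simpa using mul_nonneg (sub_nonneg.2 ht.2) (ha i))
  rw [he] at h2
  rw [inner_smul_right] at h1 h2
  have h3 := hf.nonneg _ hxa
  nlinarith [ht.1, ht.2, mul_le_mul_of_nonneg_left h1 (sub_nonneg.2 ht.2),
    mul_le_mul_of_nonneg_left h2 ht.1, mul_nonneg ht.1 h3]

theorem M_nonneg (hK : IsConstraintSet K) : 0 ≤ M :=
  (norm_nonneg _).trans (hf.norm_grad_le 0 hK.zero_mem)

theorem abs_sub_le (hK : IsConstraintSet K) {x y : Vec d} (hx : x ∈ K) (hy : y ∈ K) :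
    |f y - f x| ≤ M * ‖y - x‖ := by
  have := hK.convex.norm_image_sub_le_of_norm_hasFDerivWithin_le (f := f)
    (f' := fun x => InnerProductSpace.toDual ℝ _ (grad f x)) (C := M)
    (fun x hx => ((hf.hasGradientWithinAt (hK.subset_cube hx)).hasFDerivWithinAt.mono
      hK.subset_cube)) (fun x hx => by simpa using hf.norm_grad_le x hx) hx hy
  simpa using this

theorem lipschitzOnWith (hK : IsConstraintSet K) : LipschitzOnWith M.toNNReal f K := by
  refine LipschitzOnWith.of_dist_le_mul fun x hx y hy => ?_
  rw [Real.coe_toNNReal _ (hf.M_nonneg hK), dist_eq_norm, dist_eq_norm]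
  exact hf.abs_sub_le hK hy hx

end IsObjective

theorem IsConstraintSet.isCompact (hK : IsConstraintSet K) : IsCompact K := by
  refine Metric.isCompact_of_isClosed_isBounded hK.isClosed ?_
  refine (Metric.isBounded_iff_subset_closedBall 0).2 ⟨Real.sqrt d, fun x hx => ?_⟩
  simpa using norm_sub_le_of_mem_unitCube (hK.subset_cube hx) (hK.subset_cube hK.zero_mem)

/-! ### Measurability of the gradient -/

/-- The gradient of a differentiable function is measurable on the cube: its `i`-th coordinate is a
limit of difference quotients, taken to the right or to the left so as to stay in the cube. -/
theorem measurable_indicator_grad_apply (hf : DifferentiableOn ℝ f (unitCube d)) (i : Fin d) :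
    Measurable ((unitCube d).indicator fun x => grad f x i) := by
  classical
  have hC := (isClosed_unitCube d).measurableSet
  have hFm : Measurable ((unitCube d).indicator f) := by
    rw [← Set.piecewise_eq_indicator]
    exact hf.continuousOn.measurable_piecewise continuousOn_const hC
  -- The sign of the step: a step of length at most `1 / 2` in direction `σ x` stays in `[0,1]`.
  set σ : Vec d → ℝ := fun x => if x i ≤ 1 / 2 then 1 else -1 with hσ
  have hci : Measurable fun x : Vec d => x i := by fun_prop
  have hσm : Measurable σ :=
    Measurable.ite (measurableSet_le hci measurable_const) measurable_const measurable_const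
  set h : ℕ → ℝ := fun n => 1 / ((n : ℝ) + 2) with hh
  have hpos : ∀ n, 0 < h n := fun n => by simp only [hh]; positivity
  have hle : ∀ n, h n ≤ 1 / 2 := fun n => by
    simp only [hh]; apply one_div_le_one_div_of_le <;> [norm_num; skip]
    have : (0 : ℝ) ≤ n := n.cast_nonneg
    linarith
  have hlim : Filter.Tendsto h Filter.atTop (nhds 0) := by
    have := (tendsto_one_div_add_atTop_nhds_zero_nat (𝕜 := ℝ)).comp (Filter.tendsto_add_atTop_nat 1)
    refine this.congr fun n => ?_
    simp only [hh, Function.comp_apply, Nat.cast_add, Nat.cast_one]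
    congr 1; ring
  refine measurable_of_tendsto_metrizable (f := fun n : ℕ => (unitCube d).indicator fun x =>
    σ x * ((h n)⁻¹ * ((unitCube d).indicator f
      (x + (h n * σ x) • EuclideanSpace.single i (1 : ℝ)) - (unitCube d).indicator f x)))
    (fun n => ?_) ?_
  · refine Measurable.indicator ?_ hC
    have h1 : Measurable fun x : Vec d => x + (h n * σ x) • EuclideanSpace.single i (1 : ℝ) :=
      measurable_id.add ((hσm.const_mul _).smul_const _)
    exact hσm.mul (((hFm.comp h1).sub hFm).const_mul _)
  · rw [tendsto_pi_nhds]
    intro x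
    by_cases hx : x ∈ unitCube d
    swap
    · simp [hx]
    simp only [hx, Set.indicator_of_mem]
    have hxi := hx i
    have hmaps : Set.MapsTo (fun t : ℝ => x + (t * σ x) • EuclideanSpace.single i (1 : ℝ))
        (Set.Icc 0 (1 / 2)) (unitCube d) := by
      intro t ht j
      simp only [PiLp.add_apply, PiLp.smul_apply, smul_eq_mul]
      rcases eq_or_ne j i with rfl | hj
      · simp only [PiLp.single_apply, if_true, mul_one, hσ]
        split_ifs with h
        · constructor <;> linarith [ht.1, ht.2]
        · constructor <;> linarith [ht.1, ht.2]
      · simpa [PiLp.single_apply, hj] using hx j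
    have hγ : HasDerivWithinAt (fun t : ℝ => x + (t * σ x) • EuclideanSpace.single i (1 : ℝ))
        (σ x • EuclideanSpace.single i (1 : ℝ)) (Set.Icc 0 (1 / 2)) 0 := by
      have := ((((hasDerivAt_id (0 : ℝ)).mul_const (σ x)).smul_const
        (EuclideanSpace.single i (1 : ℝ))).const_add x).hasDerivWithinAt (s := Set.Icc 0 (1 / 2))
      simpa using this
    have h0 : (0 : ℝ) ∈ Set.Icc (0 : ℝ) (1 / 2) := by constructor <;> norm_num
    have hd := (((hf _ (hmaps h0)).hasGradientWithinAt).hasFDerivWithinAt.comp_hasDerivWithinAt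
      0 hγ hmaps)
    have hs := (hasDerivWithinAt_iff_tendsto_slope.1 hd).comp
      (tendsto_nhdsWithin_iff.2 ⟨hlim, Filter.Eventually.of_forall fun n =>
        (⟨⟨(hpos n).le, hle n⟩, (hpos n).ne'⟩ : h n ∈ Set.Icc (0 : ℝ) (1 / 2) \ {0})⟩)
    have hs2 := hs.const_mul (σ x)
    have hσ2 : σ x * σ x = 1 := by simp only [hσ]; split_ifs <;> norm_num
    convert hs2 using 1
    · funext n
      rw [Set.indicator_of_mem (hmaps ⟨(hpos n).le, hle n⟩)]
      simp [slope_def_field, div_eq_inv_mul]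
    · simp only [zero_mul, zero_smul, add_zero, InnerProductSpace.toDual_apply_apply,
        inner_smul_right, EuclideanSpace.inner_single_right]
      rw [← mul_assoc, hσ2]
      simp [grad]

theorem measurable_indicator_grad (hf : DifferentiableOn ℝ f (unitCube d)) :
    Measurable ((unitCube d).indicator (grad f)) := by
  have : (unitCube d).indicator (grad f)
      = fun x => WithLp.toLp 2 fun i => (unitCube d).indicator (fun x => grad f x i) x := by
    funext x; by_cases hx : x ∈ unitCube d <;> ext i <;> simp [hx]
  rw [this]
  exact (WithLp.measurable_toLp 2 _).comp
    (measurable_pi_lambda _ fun i => measurable_indicator_grad_apply hf i)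

/-! ### The linearisation inequality -/

/-- The vector `1 - exp (-z p)` (coordinatewise). -/
noncomputable def oneSubExp (z : ℝ) (p : Vec d) : Vec d :=
  WithLp.toLp 2 fun i => 1 - Real.exp (-z * p i)

/-- The coordinatewise product of `a` with `exp (-z p)`. -/
noncomputable def expWeighted (z : ℝ) (p a : Vec d) : Vec d :=
  WithLp.toLp 2 fun i => Real.exp (-z * p i) * a i

theorem oneSubExp_mem_Icc {z : ℝ} (hz : 0 ≤ z) {p : Vec d} (hp : ∀ i, 0 ≤ p i) (i : Fin d) :
    0 ≤ oneSubExp z p i ∧ oneSubExp z p i ≤ z * p i := by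
  have h1 : 0 ≤ z * p i := mul_nonneg hz (hp i)
  have h2 := Real.add_one_le_exp (-z * p i)
  have h3 : Real.exp (-z * p i) ≤ 1 := Real.exp_le_one_iff.2 (by linarith)
  simp only [oneSubExp]
  constructor <;> linarith

theorem IsConstraintSet.oneSubExp_mem (hK : IsConstraintSet K) {z : ℝ} (hz : z ∈ Set.Icc (0 : ℝ) 1)
    {p : Vec d} (hp : p ∈ K) : oneSubExp z p ∈ K := by
  have hp0 := fun i => (hK.subset_cube hp i).1
  refine hK.down_closed p hp _ fun i => ⟨(oneSubExp_mem_Icc hz.1 hp0 i).1,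
    (oneSubExp_mem_Icc hz.1 hp0 i).2.trans (mul_le_of_le_one_left (hp0 i) hz.2)⟩

theorem hasDerivAt_oneSubExp (z : ℝ) (p : Vec d) :
    HasDerivAt (fun z => oneSubExp z p) (expWeighted z p p) z := by
  have h : HasDerivAt (fun z i => 1 - Real.exp (-z * p i))
      (fun i => Real.exp (-z * p i) * p i) z := by
    rw [hasDerivAt_pi]
    intro i
    simpa using (((hasDerivAt_id z).neg.mul_const (p i)).exp).const_sub 1
  exact (PiLp.continuousLinearEquiv 2 ℝ fun _ : Fin d => ℝ).symm.hasFDerivAt.comp_hasDerivAt z h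

theorem continuous_oneSubExp : Continuous fun a : ℝ × Vec d => oneSubExp a.1 a.2 := by
  unfold oneSubExp; fun_prop

theorem continuous_expWeighted :
    Continuous fun a : ℝ × Vec d × Vec d => expWeighted a.1 a.2.1 a.2.2 := by
  unfold expWeighted; fun_prop

theorem expWeighted_sub (z : ℝ) (p a b : Vec d) :
    expWeighted z p (a - b) = expWeighted z p a - expWeighted z p b := by
  ext i; simp [expWeighted, mul_sub]

theorem norm_expWeighted_le {z : ℝ} (hz : 0 ≤ z) {p : Vec d} (hp : ∀ i, 0 ≤ p i) (a : Vec d) :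
    ‖expWeighted z p a‖ ≤ ‖a‖ := by
  rw [EuclideanSpace.norm_eq, EuclideanSpace.norm_eq]
  refine Real.sqrt_le_sqrt (Finset.sum_le_sum fun i _ => ?_)
  have h3 : Real.exp (-z * p i) ≤ 1 :=
    Real.exp_le_one_iff.2 (by have := mul_nonneg hz (hp i); linarith)
  have : ‖expWeighted z p a i‖ ≤ ‖a i‖ := by
    simp only [expWeighted, norm_mul, Real.norm_eq_abs, Real.abs_exp]
    exact mul_le_of_le_one_left (abs_nonneg _) h3
  gcongr

theorem one_sub_exp_neg_one_pos : 0 < 1 - Real.exp (-1) := by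
  have : Real.exp (-1) < 1 := Real.exp_lt_one_iff.2 (by norm_num)
  linarith

theorem integral_zLaw (g : ℝ → ℝ) :
    ∫ z, g z ∂zLaw = (1 - Real.exp (-1))⁻¹ * ∫ z in (0 : ℝ)..1, Real.exp (z - 1) * g z := by
  have hpos := one_sub_exp_neg_one_pos
  unfold zLaw
  rw [integral_withDensity_eq_integral_toReal_smul (by fun_prop) (by simp),
    intervalIntegral.integral_of_le zero_le_one, ← integral_Icc_eq_integral_Ioc,
    ← integral_const_mul]
  refine integral_congr_ae (Filter.Eventually.of_forall fun z => ?_)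
  simp only [smul_eq_mul]
  rw [ENNReal.toReal_ofReal (by positivity)]
  field_simp

instance isProbabilityMeasure_zLaw : IsProbabilityMeasure zLaw := by
  have hpos := one_sub_exp_neg_one_pos
  refine ⟨?_⟩
  unfold zLaw
  rw [withDensity_apply _ MeasurableSet.univ, Measure.restrict_univ,
    ← ofReal_integral_eq_lintegral_ofReal]
  · rw [integral_Icc_eq_integral_Ioc, ← intervalIntegral.integral_of_le zero_le_one,
      intervalIntegral.integral_div]
    have : ∫ z in (0 : ℝ)..1, Real.exp (z - 1) = 1 - Real.exp (-1) := by
      rw [intervalIntegral.integral_comp_sub_right (fun x => Real.exp x)]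
      simp
    rw [this, div_self hpos.ne', ENNReal.ofReal_one]
  · exact (Continuous.continuousOn (by fun_prop)).integrableOn_compact isCompact_Icc
  · exact Filter.Eventually.of_forall fun z => by positivity

theorem ae_zLaw_mem : ∀ᵐ z ∂zLaw, z ∈ Set.Icc (0 : ℝ) 1 :=
  (withDensity_absolutelyContinuous _ _).ae_le (ae_restrict_mem measurableSet_Icc)

/-- The value at a point `o + s q` of the cube drops at most by the factor `exp (-z)` when the
coordinates `q` are replaced by `q + (1 - exp (-z p)) (1 - q)`. -/
theorem IsObjective.exp_neg_mul_le (hf : IsObjective K M f) {o p q : Vec d} {s z : ℝ} (hs : 0 ≤ s)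
    (hcube : ∀ x ∈ unitCube d, o + s • x ∈ unitCube d) (hp : p ∈ unitCube d)
    (hq : q ∈ unitCube d) (hz : z ∈ Set.Icc (0 : ℝ) 1) :
    Real.exp (-z) * f (o + s • q) ≤
      f (o + s • oneSubExp z p + s • expWeighted z p q) := by
  set t := 1 - Real.exp (-z) with ht
  have ht1 : t ∈ Set.Icc (0 : ℝ) 1 := by
    have h1 : Real.exp (-z) ≤ 1 := Real.exp_le_one_iff.2 (by linarith [hz.1])
    constructor <;> simp only [ht] <;> linarith [Real.exp_pos (-z)]
  have hb : ∀ i, oneSubExp z p i ≤ t := by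
    intro i
    have : Real.exp (-z) ≤ Real.exp (-z * p i) := by
      apply Real.exp_le_exp.2
      nlinarith [(hp i).2, hz.1]
    simp only [oneSubExp, ht]; linarith
  have h0 := fun i => (oneSubExp_mem_Icc hz.1 (fun i => (hp i).1) i).1
  -- The point is at the fraction `t` of a segment from `o + s q` to `o + s q + a` in the cube. For
  -- `t = 0` the quotient in `a` is `0`, and so is its numerator.
  set a : Vec d := WithLp.toLp 2 fun i => s * (oneSubExp z p i / t * (1 - q i)) with ha
  have hdiv : ∀ i, 0 ≤ oneSubExp z p i / t ∧ oneSubExp z p i / t ≤ 1 := fun i =>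
    ⟨div_nonneg (h0 i) ht1.1, div_le_one_of_le₀ (hb i) ht1.1⟩
  have hmul : ∀ i, t * (oneSubExp z p i / t) = oneSubExp z p i := by
    intro i
    by_cases h : t = 0
    · have := hb i
      have h2 := h0 i
      rw [h] at this ⊢
      linarith
    · field_simp
  have key := hf.one_sub_mul_le (x := o + s • q) (a := a) (t := t) (hcube q hq) ?_ ?_ ht1
  · have e1 : 1 - t = Real.exp (-z) := by simp [ht]
    have e2 : o + s • q + t • a = o + s • oneSubExp z p + s • expWeighted z p q := by
      ext i
      have e3 : Real.exp (-z * p i) = 1 - oneSubExp z p i := by simp [oneSubExp]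
      simp only [ha, PiLp.add_apply, PiLp.smul_apply, smul_eq_mul, expWeighted, e3]
      linear_combination (s * (1 - q i)) * hmul i
    rwa [e1, e2] at key
  · have e3 : o + s • q + a
        = o + s • (WithLp.toLp 2 fun i => q i + oneSubExp z p i / t * (1 - q i)) := by
      ext i
      simp only [ha, PiLp.add_apply, PiLp.smul_apply, smul_eq_mul]; ring
    rw [e3]
    refine hcube _ fun i => ?_
    have h1 := hq i
    have h2 := hdiv i
    constructor
    · exact add_nonneg h1.1 (mul_nonneg h2.1 (by linarith))
    · simp only
      nlinarith
  · intro i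
    have h1 := hq i
    exact mul_nonneg hs (mul_nonneg (hdiv i).1 (by linarith))

theorem measurable_inner_grad (hf : IsObjective K M f)
    {α : Type*} [MeasurableSpace α] {x a : α → Vec d} (hx : Measurable x) (ha : Measurable a) :
    Measurable fun ω => inner ℝ ((unitCube d).indicator (grad f) (x ω)) (a ω) :=
  ((measurable_indicator_grad hf.differentiableOn).comp hx).inner ha

/-- For a DR-submodular `f`, the query direction at `p`, averaged over the law of `z`, is a
linear upper bound for the gap `f(u)/e - f(h(p))`. The weight `exp (z - 1)` is the one for which
integration by parts cancels the terms with `f(h_z(p))`. -/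
theorem IsObjective.gap_le_integral_inner (hK : IsConstraintSet K) (hf : IsObjective K M f)
    {o p q : Vec d} {s : ℝ} (hs : 0 ≤ s)
    (hcube : ∀ x ∈ unitCube d, o + s • x ∈ unitCube d) (hoK : ∀ x ∈ K, o + s • x ∈ K)
    (hp : p ∈ K) (hq : q ∈ K) :
    f (o + s • q) / Real.exp 1 - f (o + s • oneSubExp 1 p) ≤ (1 - Real.exp (-1)) *
      ∫ z, inner ℝ (grad f (o + s • oneSubExp z p)) (s • expWeighted z p (q - p)) ∂zLaw := by
  have hpos := one_sub_exp_neg_one_pos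
  rw [integral_zLaw, ← mul_assoc, mul_inv_cancel₀ hpos.ne', one_mul]
  have hpc := hK.subset_cube hp
  have hqc := hK.subset_cube hq
  set γ : ℝ → Vec d := fun z => o + s • oneSubExp z p with hγ
  have hγK : ∀ z ∈ Set.Icc (0 : ℝ) 1, γ z ∈ K := fun z hz => hoK _ (hK.oneSubExp_mem hz hp)
  have hγc : Continuous γ := by
    have : Continuous fun z => oneSubExp z p :=
      continuous_oneSubExp.comp (continuous_id.prodMk continuous_const)
    exact continuous_const.add (this.const_smul s)
  have hwc : ∀ a : Vec d, Continuous fun z => s • expWeighted z p a := fun a =>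
    (continuous_expWeighted.comp
      (continuous_id.prodMk (continuous_const.prodMk continuous_const))).const_smul s
  have hγd : ∀ z, HasDerivAt γ (s • expWeighted z p p) z := fun z => by
    simpa [hγ] using ((hasDerivAt_oneSubExp z p).const_smul s).const_add o
  have hfd : ∀ z ∈ Set.Icc (0 : ℝ) 1, HasDerivWithinAt (fun z => f (γ z))
      (inner ℝ (grad f (γ z)) (s • expWeighted z p p)) (Set.Icc 0 1) z := fun z hz =>
    hf.hasDerivWithinAt_comp (hγd z).hasDerivWithinAt
      (fun z hz => hK.subset_cube (hγK z hz)) hz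
  have hfc : ContinuousOn (fun z => f (γ z)) (Set.Icc 0 1) := fun z hz =>
    (hfd z hz).continuousWithinAt
  have hint : ∀ a : Vec d, IntervalIntegrable
      (fun z => Real.exp (z - 1) * inner ℝ (grad f (γ z)) (s • expWeighted z p a)) volume 0 1 := by
    intro a
    rw [intervalIntegrable_iff_integrableOn_Icc_of_le zero_le_one]
    have hbd : IntegrableOn (fun z => inner ℝ ((unitCube d).indicator (grad f) (γ z))
        (s • expWeighted z p a)) (Set.Icc (0 : ℝ) 1) := by
      refine Measure.integrableOn_of_bounded (M := M * (s * ‖a‖)) (by simp)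
        (measurable_inner_grad hf hγc.measurable (hwc a).measurable).aestronglyMeasurable ?_
      refine (ae_restrict_iff' measurableSet_Icc).2 (Filter.Eventually.of_forall fun z hz => ?_)
      rw [Set.indicator_of_mem (hK.subset_cube (hγK z hz))]
      refine (norm_inner_le_norm _ _).trans (mul_le_mul (hf.norm_grad_le _ (hγK z hz)) ?_
        (norm_nonneg _) (hf.M_nonneg hK))
      rw [norm_smul, Real.norm_of_nonneg hs]
      exact mul_le_mul_of_nonneg_left (norm_expWeighted_le hz.1 (fun i => (hpc i).1) a) hs
    have h2 := hbd.continuousOn_mul (g := fun z => Real.exp (z - 1))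
      (Continuous.continuousOn (by fun_prop)) isCompact_Icc
    refine h2.congr_fun (fun z hz => ?_) measurableSet_Icc
    simp only [Set.indicator_of_mem (hK.subset_cube (hγK z hz))]
  have hfint : IntervalIntegrable (fun z => Real.exp (z - 1) * f (γ z)) volume 0 1 := by
    refine ContinuousOn.intervalIntegrable ?_
    rw [Set.uIcc_of_le zero_le_one]
    exact (Continuous.continuousOn (by fun_prop)).mul hfc
  -- The fundamental theorem of calculus for `z ↦ exp (z - 1) f(h_z(p))`.
  have hibp : ∫ z in (0 : ℝ)..1, (Real.exp (z - 1) * f (γ z) +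
      Real.exp (z - 1) * inner ℝ (grad f (γ z)) (s • expWeighted z p p))
      = f (γ 1) - Real.exp (-1) * f (γ 0) := by
    rw [intervalIntegral.integral_eq_sub_of_hasDerivAt_of_le (f := fun z => Real.exp (z - 1) * f (γ z))
      zero_le_one ((Continuous.continuousOn (by fun_prop)).mul hfc) _ (hfint.add (hint p))]
    · simp
    · intro z hz
      have h1 := (hfd z ⟨hz.1.le, hz.2.le⟩).hasDerivAt (Icc_mem_nhds hz.1 hz.2)
      have h2 : HasDerivAt (fun z : ℝ => Real.exp (z - 1)) (Real.exp (z - 1)) z := by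
        simpa using ((hasDerivAt_id z).sub_const 1).exp
      exact h2.mul h1
  rw [intervalIntegral.integral_add hfint (hint p)] at hibp
  -- Concavity along `q ⊙ exp (-z p)`, and the bound `exp (-z) f(o + s q)` for the upper end.
  have hlow : ∫ z in (0 : ℝ)..1, (Real.exp (-1) * f (o + s • q) - Real.exp (z - 1) * f (γ z)) ≤
      ∫ z in (0 : ℝ)..1, Real.exp (z - 1) * inner ℝ (grad f (γ z)) (s • expWeighted z p q) := by
    refine intervalIntegral.integral_mono_on zero_le_one (intervalIntegrable_const.sub hfint)
      (hint q) fun z hz => ?_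
    have h1 := hf.exp_neg_mul_le hs hcube hpc hqc hz
    have hup : γ z + s • expWeighted z p q ∈ unitCube d := by
      have e : γ z + s • expWeighted z p q
          = o + s • (oneSubExp z p + expWeighted z p q) := by simp only [hγ]; module
      rw [e]
      refine hcube _ fun i => ?_
      have h3 : Real.exp (-z * p i) ≤ 1 :=
        Real.exp_le_one_iff.2 (by have := mul_nonneg hz.1 (hpc i).1; linarith)
      have h4 := Real.exp_pos (-z * p i)
      have h5 := hqc i
      simp only [PiLp.add_apply, oneSubExp, expWeighted]
      constructor <;> nlinarith
    have h2 := hf.sub_le_inner_grad (hK.subset_cube (hγK z hz)) hup (fun i => by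
      simp only [PiLp.smul_apply, smul_eq_mul, expWeighted]
      exact mul_nonneg hs (mul_nonneg (Real.exp_pos _).le (hqc i).1))
    have h3 : Real.exp (z - 1) * Real.exp (-z) = Real.exp (-1) := by
      rw [← Real.exp_add]; congr 1; ring
    calc Real.exp (-1) * f (o + s • q) - Real.exp (z - 1) * f (γ z)
        = Real.exp (z - 1) * (Real.exp (-z) * f (o + s • q) - f (γ z)) := by rw [← h3]; ring
      _ ≤ _ := mul_le_mul_of_nonneg_left (by linarith) (Real.exp_pos _).le
  rw [intervalIntegral.integral_sub (by simp) hfint] at hlow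
  have hsplit : ∫ z in (0 : ℝ)..1, Real.exp (z - 1) *
        inner ℝ (grad f (γ z)) (s • expWeighted z p (q - p))
      = (∫ z in (0 : ℝ)..1, Real.exp (z - 1) * inner ℝ (grad f (γ z)) (s • expWeighted z p q))
      - ∫ z in (0 : ℝ)..1, Real.exp (z - 1) * inner ℝ (grad f (γ z)) (s • expWeighted z p p) := by
    rw [← intervalIntegral.integral_sub (hint q) (hint p)]
    congr 1
    funext z
    rw [expWeighted_sub, smul_sub, inner_sub_right]; ring
  -- The boundary term at `z = 0` has the right sign, as `f` is non-negative.
  have h0 : 0 ≤ f (γ 0) := hf.nonneg _ (hK.subset_cube (hγK 0 (by simp)))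
  have h0' := mul_nonneg (Real.exp_pos (-1)).le h0
  simp only [intervalIntegral.integral_const, sub_zero, one_smul] at hlow
  rw [hsplit, div_eq_mul_inv, ← Real.exp_neg, mul_comm]
  change _ - f (γ 1) ≤ _
  linarith

/-! ### Gauss' theorem on the unit ball -/

section Divergence

open Metric Filter Topology

section Cutoff

variable {E : Type*} [NormedAddCommGroup E]

variable (E) in
/-- The radial cutoff that is `1` for `‖w‖ ≤ 1 - η` and `0` for `‖w‖ ≥ 1`. -/
noncomputable def radialCutoff (η : ℝ) (w : E) : ℝ := max 0 (min 1 ((1 - ‖w‖) * η⁻¹))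

theorem hasDerivAt_norm_line {E : Type*} [NormedAddCommGroup E] [InnerProductSpace ℝ E] {w : E}
    (hw : w ≠ 0) (v : E) : HasDerivAt (fun t : ℝ => ‖w + t • v‖) (inner ℝ w v / ‖w‖) 0 := by
  have h1 : HasDerivAt (fun t : ℝ => w + t • v) v 0 := by
    simpa using ((hasDerivAt_id (0 : ℝ)).smul_const v).const_add w
  have h2 := h1.norm_sq.sqrt (by simpa using hw)
  have hn : ‖w‖ ≠ 0 := norm_ne_zero_iff.2 hw
  convert h2 using 1
  · funext t; rw [Real.sqrt_sq (norm_nonneg _)]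
  · simp only [zero_smul, add_zero, Real.sqrt_sq (norm_nonneg _)]
    field_simp

theorem radialCutoff_mem_Icc (η : ℝ) (w : E) : radialCutoff E η w ∈ Set.Icc (0 : ℝ) 1 :=
  ⟨le_max_left _ _, max_le zero_le_one (min_le_left _ _)⟩

theorem radialCutoff_of_one_le {η : ℝ} (hη : 0 < η) {w : E} (hw : 1 ≤ ‖w‖) :
    radialCutoff E η w = 0 := by
  refine max_eq_left ((min_le_right _ _).trans ?_)
  exact mul_nonpos_of_nonpos_of_nonneg (by linarith) (by positivity)

theorem radialCutoff_of_le {η : ℝ} (hη : 0 < η) {w : E} (hw : ‖w‖ ≤ 1 - η) :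
    radialCutoff E η w = 1 := by
  have : 1 ≤ (1 - ‖w‖) * η⁻¹ := by rw [← div_eq_mul_inv, one_le_div hη]; linarith
  simp [radialCutoff, min_eq_left this]

theorem radialCutoff_of_mem {η : ℝ} (hη : 0 < η) {w : E} (hw : 1 - η ≤ ‖w‖) (hw1 : ‖w‖ ≤ 1) :
    radialCutoff E η w = (1 - ‖w‖) * η⁻¹ := by
  have h1 : (1 - ‖w‖) * η⁻¹ ≤ 1 := by rw [← div_eq_mul_inv, div_le_one hη]; linarith
  have h2 : 0 ≤ (1 - ‖w‖) * η⁻¹ := mul_nonneg (by linarith) (by positivity)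
  rw [radialCutoff, min_eq_right h1, max_eq_right h2]

theorem lipschitzWith_radialCutoff {η : ℝ} (hη : 0 < η) :
    LipschitzWith (Real.toNNReal η⁻¹) (radialCutoff E η) := by
  have h : LipschitzWith (Real.toNNReal η⁻¹) fun w : E => (1 - ‖w‖) * η⁻¹ := by
    refine LipschitzWith.of_dist_le_mul fun x y => ?_
    rw [Real.coe_toNNReal _ (by positivity), Real.dist_eq, dist_eq_norm, ← sub_mul, abs_mul,
      abs_of_pos (a := η⁻¹) (by positivity), mul_comm]
    refine mul_le_mul_of_nonneg_left ?_ (by positivity)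
    have : 1 - ‖x‖ - (1 - ‖y‖) = ‖y‖ - ‖x‖ := by ring
    rw [this, norm_sub_rev]
    exact abs_norm_sub_norm_le y x
  exact (h.const_min 1).const_max 0

theorem hasCompactSupport_radialCutoff [ProperSpace E] {η : ℝ} (hη : 0 < η) :
    HasCompactSupport (radialCutoff E η) := by
  refine HasCompactSupport.intro (isCompact_closedBall (0 : E) 1) fun w hw => ?_
  have : 1 < ‖w‖ := by simpa using hw
  exact radialCutoff_of_one_le hη this.le

end Cutoff

variable {E : Type*} [NormedAddCommGroup E] [InnerProductSpace ℝ E] [FiniteDimensional ℝ E]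
  [MeasurableSpace E] [BorelSpace E] [Nontrivial E] (μ : Measure E) [μ.IsAddHaarMeasure]

/-- The mass of a shell in the radial factor of polar coordinates. -/
theorem volumeIoiPow_real_Ico {n : ℕ} {a : ℝ} (ha : 0 < a) (ha1 : a ≤ 1) :
    (Measure.volumeIoiPow n).real {r : Set.Ioi (0 : ℝ) | a ≤ r.1 ∧ r.1 < 1}
      = (1 - a ^ (n + 1)) / (n + 1) := by
  have h : {r : Set.Ioi (0 : ℝ) | a ≤ r.1 ∧ r.1 < 1}
      = Set.Iio ⟨1, Set.mem_Ioi.2 one_pos⟩ \ Set.Iio ⟨a, Set.mem_Ioi.2 ha⟩ := by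
    ext r
    simp only [Set.mem_ofPred_eq, Set.mem_sdiff, Set.mem_Iio, not_lt, ← Subtype.coe_lt_coe]
    tauto
  have hsub : (Set.Iio ⟨a, Set.mem_Ioi.2 ha⟩ : Set (Set.Ioi (0 : ℝ)))
      ⊆ Set.Iio ⟨1, Set.mem_Ioi.2 one_pos⟩ := Set.Iio_subset_Iio ha1
  rw [h, measureReal_def, measure_sdiff hsub measurableSet_Iio.nullMeasurableSet
    (by rw [Measure.volumeIoiPow_apply_Iio]; exact ENNReal.ofReal_ne_top),
    Measure.volumeIoiPow_apply_Iio, Measure.volumeIoiPow_apply_Iio,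
    ← ENNReal.ofReal_sub _ (by positivity), ENNReal.toReal_ofReal]
  · simp only [one_pow]; ring
  · have : a ^ (n + 1) ≤ 1 := pow_le_one₀ ha.le ha1
    simp only [one_pow]
    rw [← sub_div]
    apply div_nonneg <;> [linarith; positivity]

/-- Polar coordinates on a shell, for functions that do not depend on the radius. -/
theorem setIntegral_shell (φ : E → ℝ) {a : ℝ} (ha : 0 < a) (ha1 : a ≤ 1) :
    ∫ w in {w : E | a ≤ ‖w‖ ∧ ‖w‖ < 1}, φ (‖w‖⁻¹ • w) ∂μ
      = (1 - a ^ Module.finrank ℝ E) / Module.finrank ℝ E * ∫ v, φ v ∂μ.toSphere := by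
  classical
  have hk : Module.finrank ℝ E - 1 + 1 = Module.finrank ℝ E :=
    Nat.sub_add_cancel Module.finrank_pos
  have hS : MeasurableSet {w : E | a ≤ ‖w‖ ∧ ‖w‖ < 1} :=
    (measurableSet_le measurable_const measurable_norm).inter
      (measurableSet_lt measurable_norm measurable_const)
  set I : Set (Set.Ioi (0 : ℝ)) := {r | a ≤ r.1 ∧ r.1 < 1} with hI
  have hIm : MeasurableSet I :=
    (measurableSet_le measurable_const measurable_subtype_coe).inter
      (measurableSet_lt measurable_subtype_coe measurable_const)
  calc ∫ w in {w : E | a ≤ ‖w‖ ∧ ‖w‖ < 1}, φ (‖w‖⁻¹ • w) ∂μ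
      = ∫ w, {w : E | a ≤ ‖w‖ ∧ ‖w‖ < 1}.indicator (fun w => φ (‖w‖⁻¹ • w)) w ∂μ :=
        (integral_indicator hS).symm
    _ = ∫ w : ({(0 : E)}ᶜ : Set E), {w : E | a ≤ ‖w‖ ∧ ‖w‖ < 1}.indicator
          (fun w => φ (‖w‖⁻¹ • w)) w.1 ∂(μ.comap (↑)) := by
        rw [integral_subtype_comap (measurableSet_singleton _).compl
          ({w : E | a ≤ ‖w‖ ∧ ‖w‖ < 1}.indicator fun w => φ (‖w‖⁻¹ • w)),
          restrict_compl_singleton]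
    _ = ∫ p : sphere (0 : E) 1 × Set.Ioi (0 : ℝ), φ p.1 * I.indicator 1 p.2
          ∂(μ.toSphere.prod (Measure.volumeIoiPow (Module.finrank ℝ E - 1))) := by
        rw [← μ.measurePreserving_homeomorphUnitSphereProd.integral_comp
          (Homeomorph.measurableEmbedding _)]
        refine integral_congr_ae (Eventually.of_forall fun w => ?_)
        simp only [Set.indicator_apply, hI, Set.mem_ofPred_eq,
          homeomorphUnitSphereProd_apply_snd_coe, homeomorphUnitSphereProd_apply_fst_coe,
          Pi.one_apply]
        split_ifs <;> simp
    _ = _ := by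
        rw [integral_prod_mul (fun v : sphere (0 : E) 1 => φ v) (I.indicator (1 : Set.Ioi (0 : ℝ) → ℝ)),
          integral_indicator_one hIm, hI, volumeIoiPow_real_Ico ha ha1, hk, mul_comm]
        congr 2
        have : ((Module.finrank ℝ E - 1 : ℕ) : ℝ) + 1 = ((Module.finrank ℝ E - 1 + 1 : ℕ) : ℝ) := by
          push_cast; ring
        rw [this, hk]

/-- The derivative of the cutoff lives on the shell, where it is radial. The spheres that bound the
shell, on which the cutoff is not differentiable, are null sets. -/
theorem ae_lineDeriv_radialCutoff {η : ℝ} (hη : 0 < η) (hη1 : η < 1) (a : E) :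
    ∀ᵐ w ∂μ, lineDeriv ℝ (radialCutoff E η) w (-a)
      = {w : E | 1 - η ≤ ‖w‖ ∧ ‖w‖ < 1}.indicator
          (fun w => η⁻¹ * inner ℝ (‖w‖⁻¹ • w) a) w := by
  have hn : ∀ r : ℝ, ∀ᵐ w ∂μ, ‖w‖ ≠ r := fun r => by
    have := Measure.addHaar_sphere μ (0 : E) r
    rw [ae_iff]
    convert this using 2
    ext w; simp
  filter_upwards [hn 1, hn (1 - η)] with w h1 h2
  have hc : Continuous fun w : E => ‖w‖ := continuous_norm
  have hconst : ∀ c : ℝ, radialCutoff E η =ᶠ[𝓝 w] (fun _ => c) →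
      lineDeriv ℝ (radialCutoff E η) w (-a) = 0 := fun c h => by
    rw [h.lineDeriv_eq]; simp [lineDeriv]
  rcases lt_or_gt_of_ne h1 with h1 | h1
  · rcases lt_or_gt_of_ne h2 with h2 | h2
    · rw [hconst 1 ?_, Set.indicator_of_notMem]
      · exact fun h => absurd h.1 (not_le.2 h2)
      · filter_upwards [hc.continuousAt.eventually_lt_const h2] with x hx
        exact radialCutoff_of_le hη hx.le
    · rw [Set.indicator_of_mem (show w ∈ {w : E | 1 - η ≤ ‖w‖ ∧ ‖w‖ < 1} from ⟨h2.le, h1⟩)]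
      have he : radialCutoff E η =ᶠ[𝓝 w] fun x => (1 - ‖x‖) * η⁻¹ := by
        filter_upwards [hc.continuousAt.eventually_lt_const h1,
          hc.continuousAt.eventually_const_lt h2] with x hx hx2
        exact radialCutoff_of_mem hη hx2.le hx.le
      rw [he.lineDeriv_eq]
      have hw : w ≠ 0 := norm_pos_iff.1 (by linarith)
      have := ((hasDerivAt_norm_line hw (-a)).const_sub 1).mul_const η⁻¹
      rw [lineDeriv, this.deriv, inner_neg_right, inner_smul_left]
      simp only [conj_trivial]; ring
  · rw [hconst 0 ?_, Set.indicator_of_notMem]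
    · exact fun h => absurd h.2 (not_lt.2 h1.le)
    · filter_upwards [hc.continuousAt.eventually_const_lt h1] with x hx
      exact radialCutoff_of_one_le hη hx.le

/-- Gauss' theorem on the unit ball for a Lipschitz function: the flux through the sphere is the
integral of the directional derivative, which exists almost everywhere. It is the limit `η → 0` of
integration by parts against `radialCutoff`. -/
theorem integral_toSphere_mul_inner {F : E → ℝ} {C : NNReal} (hF : LipschitzWith C F) (a : E) :
    ∫ v : sphere (0 : E) 1, F v * inner ℝ (v : E) a ∂μ.toSphere
      = ∫ w in ball (0 : E) 1, lineDeriv ℝ F w a ∂μ := by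
  set k := Module.finrank ℝ E with hk
  have hkpos : (0 : ℝ) < k := Nat.cast_pos.2 Module.finrank_pos
  set Φ := ∫ v : sphere (0 : E) 1, F v * inner ℝ (v : E) a ∂μ.toSphere with hΦ
  -- The mass of the shell `1 - η ≤ ‖w‖ < 1`, relative to that of the sphere; `c η ~ η`.
  set c : ℝ → ℝ := fun η => (1 - (1 - η) ^ k) / k with hc
  have hsmall : ∀ᶠ η in 𝓝[>] (0 : ℝ), 0 < η ∧ η < 1 :=
    Ioo_mem_nhdsGT zero_lt_one
  have hL : Tendsto (fun η => ∫ w, lineDeriv ℝ F w a * radialCutoff E η w ∂μ) (𝓝[>] 0)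
      (𝓝 (∫ w, (ball (0 : E) 1).indicator (fun w => lineDeriv ℝ F w a) w ∂μ)) := by
    refine tendsto_integral_filter_of_dominated_convergence
      ((closedBall (0 : E) 1).indicator fun _ => C * ‖a‖) ?_ ?_ ?_ ?_
    · filter_upwards [hsmall] with η hη
      exact ((measurable_lineDeriv hF.continuous).mul
        (lipschitzWith_radialCutoff hη.1).continuous.measurable).aestronglyMeasurable
    · filter_upwards [hsmall] with η hη
      refine Eventually.of_forall fun w => ?_
      by_cases hw : w ∈ closedBall (0 : E) 1
      · rw [Set.indicator_of_mem hw, norm_mul]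
        have h1 := radialCutoff_mem_Icc η w
        have h2 : ‖radialCutoff E η w‖ ≤ 1 := by
          rw [Real.norm_of_nonneg h1.1]; exact h1.2
        exact (mul_le_of_le_one_right (norm_nonneg _) h2).trans
          (norm_lineDeriv_le_of_lipschitz ℝ hF)
      · rw [Set.indicator_of_notMem hw, radialCutoff_of_one_le hη.1]
        · simp
        · have : 1 < ‖w‖ := by simpa using hw
          exact this.le
    · rw [integrable_indicator_iff measurableSet_closedBall]
      exact integrableOn_const measure_closedBall_lt_top.ne
    · refine Eventually.of_forall fun w => ?_
      by_cases hw : w ∈ ball (0 : E) 1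
      · rw [Set.indicator_of_mem hw]
        have hw1 : 0 < 1 - ‖w‖ := by
          have : ‖w‖ < 1 := by simpa using hw
          linarith
        refine tendsto_const_nhds.congr' ?_
        filter_upwards [Ioo_mem_nhdsGT hw1] with η hη
        rw [radialCutoff_of_le hη.1 (by linarith [hη.2]), mul_one]
      · rw [Set.indicator_of_notMem hw]
        refine tendsto_const_nhds.congr' ?_
        filter_upwards [hsmall] with η hη
        rw [radialCutoff_of_one_le hη.1 (by simpa using hw), mul_zero]
  rw [integral_indicator measurableSet_ball] at hL
  have hc0 : Tendsto c (𝓝[>] 0) (𝓝 0) := by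
    have : Continuous c := by simp only [hc]; fun_prop
    have h := (this.tendsto 0).mono_left (nhdsWithin_le_nhds (s := Set.Ioi 0))
    simpa [hc] using h
  have hc1 : Tendsto (fun η => η⁻¹ * c η) (𝓝[>] 0) (𝓝 1) := by
    have hd : HasDerivAt c 1 0 := by
      have h : HasDerivAt c (-(k * (1 - id 0) ^ (k - 1) * -1) / k) 0 :=
        ((((hasDerivAt_id (0 : ℝ)).const_sub 1).pow k).const_sub 1).div_const (k : ℝ)
      have e : -(k * (1 - id (0 : ℝ)) ^ (k - 1) * -1) / (k : ℝ) = 1 := by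
        simp [hkpos.ne']
      rwa [e] at h
    have h := (hd.hasDerivWithinAt (s := Set.Ioi 0))
    rw [hasDerivWithinAt_iff_tendsto_slope' (by simp)] at h
    refine h.congr fun η => ?_
    simp [slope_def_field, hc, div_eq_inv_mul]
  have hR : Tendsto (fun η => ∫ w, lineDeriv ℝ (radialCutoff E η) w (-a) * F w ∂μ) (𝓝[>] 0)
      (𝓝 Φ) := by
    have hmain : Tendsto (fun η => η⁻¹ * c η * Φ) (𝓝[>] 0) (𝓝 Φ) := by
      simpa using hc1.mul_const Φ
    -- On the shell `F w` may be replaced by `F (w / ‖w‖)`, with an error of order `η`.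
    refine tendsto_of_tendsto_of_dist hmain ?_
    have hz : Tendsto (fun η => ‖a‖ * C * (c η * μ.toSphere.real Set.univ)) (𝓝[>] 0) (𝓝 0) := by
      simpa using (hc0.mul_const (μ.toSphere.real Set.univ)).const_mul (‖a‖ * C)
    refine squeeze_zero' (Eventually.of_forall fun _ => dist_nonneg) ?_ hz
    filter_upwards [hsmall] with η hη
    have ha0 : 0 < 1 - η := by linarith [hη.2]
    set S := {w : E | 1 - η ≤ ‖w‖ ∧ ‖w‖ < 1} with hS
    have hSm : MeasurableSet S :=
      (measurableSet_le measurable_const measurable_norm).inter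
        (measurableSet_lt measurable_norm measurable_const)
    have hSb : S ⊆ ball 0 1 := fun w hw => by simpa using hw.2
    have hSfin : μ S < ⊤ := (measure_mono hSb).trans_lt measure_ball_lt_top
    have hvol : μ.real S = c η * μ.toSphere.real Set.univ := by
      have := setIntegral_shell μ (fun _ => (1 : ℝ)) ha0 (by linarith [hη.1])
      simpa [hS, hc] using this
    have hshell := setIntegral_shell μ (fun v => F v * inner ℝ v a) ha0 (by linarith [hη.1])
    have e1 : ∫ w, lineDeriv ℝ (radialCutoff E η) w (-a) * F w ∂μ
        = η⁻¹ * ∫ w in S, inner ℝ (‖w‖⁻¹ • w) a * F w ∂μ := by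
      rw [← integral_const_mul, ← integral_indicator hSm]
      refine integral_congr_ae ?_
      filter_upwards [ae_lineDeriv_radialCutoff μ hη.1 hη.2 a] with w hw
      rw [hw]
      by_cases h : w ∈ S
      · rw [Set.indicator_of_mem h, Set.indicator_of_mem h, mul_assoc]
      · rw [Set.indicator_of_notMem h, Set.indicator_of_notMem h, zero_mul]
    have hinner : ∀ w : E, ‖(inner ℝ (‖w‖⁻¹ • w) a : ℝ)‖ ≤ ‖a‖ := fun w => by
      refine (norm_inner_le_norm _ _).trans (mul_le_of_le_one_left (norm_nonneg _) ?_)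
      rw [norm_smul, norm_inv, norm_norm]
      exact inv_mul_le_one
    have hFc := hF.continuous
    have hint : ∀ φ : E → ℝ, (∃ b : ℝ, ∀ w ∈ S, ‖φ w‖ ≤ b) → Measurable φ →
        IntegrableOn φ S μ := by
      rintro φ ⟨b, hb⟩ hm
      exact Measure.integrableOn_of_bounded (M := b) hSfin.ne hm.aestronglyMeasurable
        ((ae_restrict_iff' hSm).2 (Eventually.of_forall hb))
    obtain ⟨b, hb⟩ := (isCompact_closedBall (0 : E) 1).exists_bound_of_continuousOn
      hFc.continuousOn
    have hunit : ∀ w : E, ‖w‖⁻¹ • w ∈ closedBall (0 : E) 1 := fun w => by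
      simp only [mem_closedBall, dist_zero_right, norm_smul, norm_inv, norm_norm]
      exact inv_mul_le_one
    have hmu : Measurable fun w : E => ‖w‖⁻¹ • w := measurable_norm.inv.smul measurable_id
    have i1 : IntegrableOn (fun w => inner ℝ (‖w‖⁻¹ • w) a * F w) S μ := by
      refine hint _ ⟨‖a‖ * b, fun w hw => ?_⟩ ((hmu.inner measurable_const).mul hFc.measurable)
      rw [norm_mul]
      exact mul_le_mul (hinner w) (hb w (ball_subset_closedBall (hSb hw))) (norm_nonneg _)
        (norm_nonneg _)
    have i2 : IntegrableOn (fun w => F (‖w‖⁻¹ • w) * inner ℝ (‖w‖⁻¹ • w) a) S μ := by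
      refine hint _ ⟨b * ‖a‖, fun w hw => ?_⟩
        ((hFc.measurable.comp hmu).mul (hmu.inner measurable_const))
      rw [norm_mul]
      exact mul_le_mul (hb _ (hunit w)) (hinner w) (norm_nonneg _)
        ((norm_nonneg _).trans (hb _ (hunit w)))
    have e2 : η⁻¹ * c η * Φ = η⁻¹ * ∫ w in S, F (‖w‖⁻¹ • w) * inner ℝ (‖w‖⁻¹ • w) a ∂μ := by
      rw [hshell, mul_assoc]
    rw [e1, e2, Real.dist_eq, ← mul_sub, ← integral_sub i2 i1, abs_mul,
      abs_of_pos (inv_pos.2 hη.1), ← hvol]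
    have hbound : ‖∫ w in S, (F (‖w‖⁻¹ • w) * inner ℝ (‖w‖⁻¹ • w) a
        - inner ℝ (‖w‖⁻¹ • w) a * F w) ∂μ‖ ≤ ‖a‖ * (C * η) * μ.real S := by
      refine norm_setIntegral_le_of_norm_le_const hSfin fun w hw => ?_
      rw [mul_comm, ← mul_sub, norm_mul]
      refine mul_le_mul (hinner w) ?_ (norm_nonneg _) (norm_nonneg _)
      rw [← dist_eq_norm]
      refine (hF.dist_le_mul _ _).trans (mul_le_mul_of_nonneg_left ?_ C.2)
      have hw0 : 0 < ‖w‖ := by linarith [hw.1]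
      have : ‖w‖⁻¹ • w - w = (‖w‖⁻¹ * (1 - ‖w‖)) • w := by
        rw [mul_sub, mul_one, inv_mul_cancel₀ hw0.ne', sub_smul, one_smul]
      rw [dist_eq_norm, this, norm_smul, norm_mul, norm_inv, norm_norm, mul_right_comm,
        inv_mul_cancel₀ hw0.ne', one_mul, Real.norm_of_nonneg (by linarith [hw.2])]
      linarith [hw.1]
    rw [Real.norm_eq_abs] at hbound
    calc η⁻¹ * _ ≤ η⁻¹ * (‖a‖ * (C * η) * μ.real S) :=
          mul_le_mul_of_nonneg_left hbound (inv_pos.2 hη.1).le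
      _ = ‖a‖ * C * μ.real S := by
          have := hη.1.ne'
          field_simp
  have heq : (fun η => ∫ w, lineDeriv ℝ F w a * radialCutoff E η w ∂μ) =ᶠ[𝓝[>] 0]
      fun η => ∫ w, lineDeriv ℝ (radialCutoff E η) w (-a) * F w ∂μ := by
    filter_upwards [hsmall] with η hη
    exact hF.integral_lineDeriv_mul_eq (lipschitzWith_radialCutoff hη.1)
      (hasCompactSupport_radialCutoff hη.1) a
  exact tendsto_nhds_unique (hR.congr' heq.symm) hL

end Divergence

/-! ### The one-point gradient estimator -/

section OnePoint

open Metric Filter Topology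

variable {d : ℕ} (V : Submodule ℝ (Vec d))

/-- The uniform law on the unit ball of a linear subspace. -/
noncomputable def ballLaw : Measure (Vec d) :=
  (ProbabilityTheory.cond (Measure.addHaar : Measure V) (ball 0 1)).map fun v : V => (v : Vec d)

instance isProbabilityMeasure_ballLaw : IsProbabilityMeasure (ballLaw V) := by
  have h : IsProbabilityMeasure (ProbabilityTheory.cond (Measure.addHaar : Measure V) (ball 0 1)) :=
    ProbabilityTheory.cond_isProbabilityMeasure_of_finite
      (measure_ball_pos _ _ one_pos).ne' measure_ball_lt_top.ne
  exact Measure.isProbabilityMeasure_map measurable_subtype_coe.aemeasurable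

theorem isProbabilityMeasure_sphereLaw [Nontrivial V] : IsProbabilityMeasure (sphereLaw V) := by
  have h : IsProbabilityMeasure (ProbabilityTheory.cond
      (Measure.addHaar : Measure V).toSphere Set.univ) :=
    ProbabilityTheory.cond_isProbabilityMeasure fun h =>
      Measure.toSphere_ne_zero _ (Measure.measure_univ_eq_zero.1 h)
  exact Measure.isProbabilityMeasure_map (by fun_prop)

theorem ae_sphereLaw : ∀ᵐ v ∂sphereLaw V, v ∈ V ∧ ‖v‖ = 1 := by
  have hV : MeasurableSet {v : Vec d | v ∈ V ∧ ‖v‖ = 1} :=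
    V.closed_of_finiteDimensional.measurableSet.inter
      (measurableSet_eq_fun measurable_norm measurable_const)
  unfold sphereLaw
  rw [ae_map_iff (by fun_prop) hV]
  exact Eventually.of_forall fun v => ⟨v.1.2, norm_eq_of_mem_sphere v⟩

theorem ae_ballLaw : ∀ᵐ w ∂ballLaw V, w ∈ V ∧ ‖w‖ < 1 := by
  have hV : MeasurableSet {v : Vec d | v ∈ V ∧ ‖v‖ < 1} :=
    V.closed_of_finiteDimensional.measurableSet.inter
      (measurableSet_lt measurable_norm measurable_const)
  unfold ballLaw
  rw [ae_map_iff (by fun_prop) hV]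
  filter_upwards [ProbabilityTheory.ae_cond_mem (measurableSet_ball (x := (0 : V)) (ε := 1))]
    with v hv
  exact ⟨v.2, by simpa using hv⟩

/-- The one-point estimator with directions from the unit sphere of `V` is unbiased, along `V`, for
the gradient of the average of `F` over balls of radius `δ`. -/
theorem integral_sphereLaw_onePoint [Nontrivial V] {F : Vec d → ℝ} {C : NNReal}
    (hF : LipschitzWith C F) {δ : ℝ} (hδ : 0 < δ) (y : Vec d) {a : Vec d} (ha : a ∈ V) :
    ∫ v, (Module.finrank ℝ V : ℝ) / δ * F (y + δ • v) * inner ℝ v a ∂sphereLaw V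
      = ∫ w, lineDeriv ℝ F (y + δ • w) a ∂ballLaw V := by
  set μ : Measure V := Measure.addHaar
  set k := Module.finrank ℝ V with hk
  have hkpos : (0 : ℝ) < k := Nat.cast_pos.2 Module.finrank_pos
  set G : V → ℝ := fun v => F (y + δ • (v : Vec d)) with hG
  have hGL : LipschitzWith (C * Real.toNNReal δ) G := by
    refine LipschitzWith.of_dist_le_mul fun v w => (hF.dist_le_mul _ _).trans ?_
    rw [NNReal.coe_mul, Real.coe_toNNReal _ hδ.le, mul_assoc]
    refine mul_le_mul_of_nonneg_left ?_ C.2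
    rw [dist_add_left, dist_smul₀, Real.norm_of_nonneg hδ.le]
    rfl
  have hgauss := integral_toSphere_mul_inner μ hGL ⟨a, ha⟩
  have hline : ∀ w : V, lineDeriv ℝ G w ⟨a, ha⟩ = δ * lineDeriv ℝ F (y + δ • (w : Vec d)) a := by
    intro w
    have : lineDeriv ℝ G w ⟨a, ha⟩ = lineDeriv ℝ F (y + δ • (w : Vec d)) (δ • a) := by
      simp only [lineDeriv, hG, Submodule.coe_add, Submodule.coe_smul, smul_add, ← add_assoc,
        smul_comm δ]
    rw [this, lineDeriv_smul, smul_eq_mul]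
  have hball : 0 < μ.real (ball 0 1) :=
    ENNReal.toReal_pos (measure_ball_pos _ _ one_pos).ne' measure_ball_lt_top.ne
  have hFm : Measurable F := hF.continuous.measurable
  have hLm : Measurable fun w => lineDeriv ℝ F (y + δ • w) a :=
    (measurable_lineDeriv hF.continuous).comp (by fun_prop)
  unfold sphereLaw ballLaw
  rw [integral_map (by fun_prop) (by fun_prop),
    integral_map (by fun_prop) hLm.aestronglyMeasurable,
    ProbabilityTheory.cond, ProbabilityTheory.cond, Measure.restrict_univ, integral_smul_measure,
    integral_smul_measure, ENNReal.toReal_inv, ENNReal.toReal_inv, ← measureReal_def,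
    ← measureReal_def, Measure.toSphere_real_apply_univ]
  simp_rw [hline] at hgauss
  rw [integral_const_mul] at hgauss
  have e : ∀ v : sphere (0 : V) 1, (k : ℝ) / δ * F (y + δ • ((v : V) : Vec d))
      * inner ℝ ((v : V) : Vec d) a = k / δ * (G v * inner ℝ (v : V) ⟨a, ha⟩) := fun v => by
    simp only [hG, Submodule.coe_inner]; ring
  simp_rw [e]
  rw [integral_const_mul, hgauss, smul_eq_mul, smul_eq_mul]
  field_simp
  exact mul_div_mul_left _ _ hkpos.ne'

end OnePoint

/-! ### Regret of Improved Ader -/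

section Projection

variable {d : ℕ} {X : Set (Vec d)}

theorem proj_spec (hne : X.Nonempty) (hcl : IsClosed X) (x : Vec d) :
    proj X x ∈ X ∧ ∀ w ∈ X, dist x (proj X x) ≤ dist x w := by
  refine Classical.epsilon_spec (p := fun y => y ∈ X ∧ ∀ w ∈ X, dist x y ≤ dist x w) ?_
  obtain ⟨y, hy, h⟩ := hcl.exists_infDist_eq_dist hne x
  exact ⟨y, hy, fun w hw => h ▸ Metric.infDist_le_dist_of_mem hw⟩

theorem inner_sub_proj_nonpos (hne : X.Nonempty) (hcl : IsClosed X) (hconv : Convex ℝ X) (x : Vec d)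
    {w : Vec d} (hw : w ∈ X) : inner ℝ (x - proj X x) (w - proj X x) ≤ 0 := by
  obtain ⟨hmem, hmin⟩ := proj_spec hne hcl x
  have : Nonempty X := hne.to_subtype
  refine (norm_eq_iInf_iff_real_inner_le_zero hconv hmem).1 (le_antisymm ?_ ?_) w hw
  · refine le_ciInf fun v => ?_
    rw [← dist_eq_norm, ← dist_eq_norm]
    exact hmin v v.2
  · exact ciInf_le ⟨0, by rintro _ ⟨v, rfl⟩; exact norm_nonneg _⟩ (⟨_, hmem⟩ : X)

theorem norm_proj_sub_proj_le (hne : X.Nonempty) (hcl : IsClosed X) (hconv : Convex ℝ X)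
    (x y : Vec d) : ‖proj X x - proj X y‖ ≤ ‖x - y‖ := by
  have h1 := inner_sub_proj_nonpos hne hcl hconv x (proj_spec hne hcl y).1
  have h2 := inner_sub_proj_nonpos hne hcl hconv y (proj_spec hne hcl x).1
  set p := proj X x
  set q := proj X y
  have h3 : ‖p - q‖ ^ 2 ≤ inner ℝ (x - y) (p - q) := by
    rw [← real_inner_self_eq_norm_sq]
    have : inner ℝ (x - y) (p - q) - inner ℝ (p - q) (p - q)
        = - inner ℝ (x - p) (q - p) - inner ℝ (y - q) (p - q) := by
      rw [← inner_sub_left, ← inner_neg_right, neg_sub, ← inner_sub_left]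
      congr 1; abel
    linarith
  have h4 := h3.trans (real_inner_le_norm _ _)
  by_contra hlt
  push Not at hlt
  nlinarith [norm_nonneg (x - y), norm_nonneg (p - q)]

theorem proj_of_mem (hcl : IsClosed X) {x : Vec d} (hx : x ∈ X) : proj X x = x := by
  have h := (proj_spec ⟨x, hx⟩ hcl x).2 x hx
  rw [dist_self] at h
  exact (dist_le_zero.1 h).symm

theorem norm_proj_sub_le (hcl : IsClosed X) (hconv : Convex ℝ X) (x : Vec d) {w : Vec d}
    (hw : w ∈ X) : ‖proj X x - w‖ ≤ ‖x - w‖ := by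
  simpa [proj_of_mem hcl hw] using norm_proj_sub_proj_le ⟨w, hw⟩ hcl hconv x w

theorem continuous_proj (hne : X.Nonempty) (hcl : IsClosed X) (hconv : Convex ℝ X) :
    Continuous (proj X) := by
  refine (LipschitzWith.of_dist_le_mul (K := 1) fun x y => ?_).continuous
  simpa [dist_eq_norm] using norm_proj_sub_proj_le hne hcl hconv x y

end Projection

/-- The experts' points lie in `X` and their weights form a probability vector. -/
structure IAState.IsValid {d N : ℕ} (X : Set (Vec d)) (S : IAState d N) : Prop where
  pt_mem : ∀ i, S.pt i ∈ X
  wt_pos : ∀ i, 0 < S.wt i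
  sum_wt : ∑ i, S.wt i = 1

section Learner

variable {d N : ℕ} {X : Set (Vec d)}

theorem IAState.IsValid.action_mem {S : IAState d N} (hS : S.IsValid X) (hconv : Convex ℝ X) :
    S.action ∈ X :=
  hconv.sum_mem (fun i _ => (hS.wt_pos i).le) hS.sum_wt fun i _ => hS.pt_mem i

theorem IAState.IsValid.gain_pos {S : IAState d N} (hS : S.IsValid X) (lam : ℝ) (g : Vec d)
    (i : Fin N) : 0 < S.gain lam g i := mul_pos (hS.wt_pos i) (Real.exp_pos _)

theorem IAState.IsValid.sum_gain_pos {S : IAState d N} (hS : S.IsValid X) (lam : ℝ) (g : Vec d) :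
    0 < ∑ i, S.gain lam g i := by
  refine Finset.sum_pos (fun i _ => hS.gain_pos lam g i) ?_
  by_contra h
  have := hS.sum_wt
  rw [Finset.not_nonempty_iff_eq_empty.1 h] at this
  simp at this

theorem IAState.IsValid.update {S : IAState d N} (hS : S.IsValid X) (hne : X.Nonempty)
    (hcl : IsClosed X) (eta : ℕ → ℝ) (lam : ℝ) (g : Vec d) :
    (S.update X eta lam g).IsValid X where
  pt_mem i := (proj_spec hne hcl _).1
  wt_pos i := div_pos (hS.gain_pos lam g i) (hS.sum_gain_pos lam g)
  sum_wt := by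
    simp only [IAState.update]
    rw [← Finset.sum_div, div_self (hS.sum_gain_pos lam g).ne']

theorem sum_initial_weights (N : ℕ) :
    ∑ i ∈ Finset.range N, (1 / (((i : ℝ) + 1) * ((i : ℝ) + 2))) = N / (N + 1) := by
  induction N with
  | zero => simp
  | succ N ih =>
    rw [Finset.sum_range_succ, ih]
    have : (0 : ℝ) ≤ N := N.cast_nonneg
    push_cast
    field_simp
    ring

theorem isValid_iaInit (hN : 0 < N) {x₁ : ℕ → Vec d} (hx : ∀ i, x₁ i ∈ X) :
    (iaInit N x₁).IsValid X where
  pt_mem i := hx i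
  wt_pos i := by simp only [iaInit]; positivity
  sum_wt := by
    have hN' : (0 : ℝ) < N := Nat.cast_pos.2 hN
    simp only [iaInit]
    rw [Fin.sum_univ_eq_sum_range
      (fun i : ℕ => (1 + 1 / (N : ℝ)) / (((i : ℝ) + 1) * ((i : ℝ) + 2)))]
    simp_rw [div_eq_mul_one_div (1 + 1 / (N : ℝ))]
    rw [← Finset.mul_sum, sum_initial_weights]
    field_simp

theorem isValid_iaState (hne : X.Nonempty) (hcl : IsClosed X) (n : ℕ) (G : ℝ) {x₁ : ℕ → Vec d}
    (hx : ∀ i, x₁ i ∈ X) (fb : ℕ → Vec d → Vec d) (t : ℕ) :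
    (iaState X n G x₁ fb t).IsValid X := by
  induction t with
  | zero => exact isValid_iaInit (Nat.succ_pos _) hx
  | succ t ih => exact ih.update hne hcl _ _ _

theorem iaAction_mem (hne : X.Nonempty) (hcl : IsClosed X) (hconv : Convex ℝ X) (n : ℕ) (G : ℝ)
    {x₁ : ℕ → Vec d} (hx : ∀ i, x₁ i ∈ X) (fb : ℕ → Vec d → Vec d) (t : ℕ) :
    iaAction X n G x₁ fb t ∈ X := (isValid_iaState hne hcl n G hx fb t).action_mem hconv

/-- A quadratic upper bound for `exp` on `[-2, 2]`; the gains `y = λ ⟨g, x_i - x⟩` stay in this range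
because `(λ G D) ^ 2 = 2 / n`. -/
theorem exp_le_one_add_add_sq {y : ℝ} (hy : |y| ≤ 2) : Real.exp y ≤ 1 + y + 3 / 2 * y ^ 2 := by
  have h1 : |y / 2| ≤ 1 := by rw [abs_div, abs_two]; linarith
  have h2 := (abs_le.1 (Real.abs_exp_sub_one_sub_id_le h1)).2
  have h3 : Real.exp y = Real.exp (y / 2) ^ 2 := by
    rw [← Real.exp_nat_mul]; congr 1; push_cast; ring
  have h4 := Real.exp_pos (y / 2)
  obtain ⟨h5, h6⟩ := abs_le.1 h1
  set v := y / 2 with hv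
  have hy2 : y = 2 * v := by rw [hv]; ring
  rw [h3, hy2]
  have h7 : Real.exp v ≤ 1 + v + v ^ 2 := by linarith
  have h8 : Real.exp v ^ 2 ≤ (1 + v + v ^ 2) ^ 2 := by gcongr
  have h9 : v ^ 2 ≤ 1 := by nlinarith
  nlinarith [mul_nonneg (sq_nonneg v) (sub_nonneg.2 h6), mul_nonneg (sq_nonneg v) (sub_nonneg.2 h9)]

/-- One round of exponential weights: the logarithm of a weight grows by the relative gain of the
expert, up to a second order term. -/
theorem IAState.IsValid.log_wt_update {S : IAState d N} (hS : S.IsValid X) (hconv : Convex ℝ X)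
    (hb : Bornology.IsBounded X) {G lam : ℝ} (hlam : 0 ≤ lam) {g : Vec d} (hg : ‖g‖ ≤ G)
    (h2 : lam * (G * Metric.diam X) ≤ 2) (eta : ℕ → ℝ) (i : Fin N) :
    Real.log (S.wt i) + lam * inner ℝ g (S.pt i - S.action)
        - 3 / 2 * (lam * (G * Metric.diam X)) ^ 2
      ≤ Real.log ((S.update X eta lam g).wt i) := by
  set y : Fin N → ℝ := fun j => lam * inner ℝ g (S.pt j - S.action) with hy
  set b := lam * (G * Metric.diam X) with hbdef
  have hyb : ∀ j, |y j| ≤ b := fun j => by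
    rw [hy, abs_mul, abs_of_nonneg hlam]
    refine mul_le_mul_of_nonneg_left ?_ hlam
    refine (abs_real_inner_le_norm _ _).trans (mul_le_mul hg ?_ (norm_nonneg _)
      ((norm_nonneg _).trans hg))
    rw [← dist_eq_norm]
    exact Metric.dist_le_diam_of_mem hb (hS.pt_mem j) (hS.action_mem hconv)
  -- The mean of the gains vanishes, as the action is the mean of the points.
  have hsum0 : ∑ j, S.wt j * y j = 0 := by
    have : ∑ j, S.wt j * y j = lam * inner ℝ g (∑ j, S.wt j • (S.pt j - S.action)) := by
      rw [inner_sum, Finset.mul_sum]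
      refine Finset.sum_congr rfl fun j _ => ?_
      rw [inner_smul_right]; simp only [hy]; ring
    rw [this]
    have : ∑ j, S.wt j • (S.pt j - S.action) = 0 := by
      simp_rw [smul_sub]
      rw [Finset.sum_sub_distrib, ← Finset.sum_smul, hS.sum_wt, one_smul]
      exact sub_self _
    rw [this, inner_zero_right, mul_zero]
  have hsum : ∑ j, S.gain lam g j ≤ 1 + 3 / 2 * b ^ 2 := by
    calc ∑ j, S.gain lam g j ≤ ∑ j, (S.wt j + S.wt j * y j + S.wt j * (3 / 2 * b ^ 2)) := by
          refine Finset.sum_le_sum fun j _ => ?_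
          have h3 := exp_le_one_add_add_sq ((hyb j).trans h2)
          have h4 : y j ^ 2 ≤ b ^ 2 := sq_le_sq' (abs_le.1 (hyb j)).1 (abs_le.1 (hyb j)).2
          have h5 := mul_le_mul_of_nonneg_left
            (h3.trans (show _ ≤ 1 + y j + 3 / 2 * b ^ 2 by linarith)) (hS.wt_pos j).le
          simp only [IAState.gain]
          simp only [hy] at h5 ⊢
          linarith
      _ = 1 + 3 / 2 * b ^ 2 := by
          rw [Finset.sum_add_distrib, Finset.sum_add_distrib, ← Finset.sum_mul, hS.sum_wt, hsum0]
          ring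
  have hpos := hS.sum_gain_pos lam g
  have hlog : Real.log (∑ j, S.gain lam g j) ≤ 3 / 2 * b ^ 2 := by
    have := Real.log_le_sub_one_of_pos hpos
    linarith
  simp only [IAState.update]
  rw [Real.log_div (hS.gain_pos lam g i).ne' hpos.ne', IAState.gain,
    Real.log_mul (hS.wt_pos i).ne' (Real.exp_pos _).ne', Real.log_exp]
  linarith

/-- One step of projected gradient ascent against a moving comparator. -/
theorem norm_proj_step_sq_le (hcl : IsClosed X) (hconv : Convex ℝ X)
    (hb : Bornology.IsBounded X) {x u u' g : Vec d} {η G : ℝ} (hu : u ∈ X) (hu' : u' ∈ X)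
    (hg : ‖g‖ ≤ G) :
    ‖proj X (x + η • g) - u'‖ ^ 2 ≤ ‖x - u‖ ^ 2 - 2 * η * inner ℝ g (u - x) + η ^ 2 * G ^ 2
      + 2 * Metric.diam X * ‖u' - u‖ := by
  set p := proj X (x + η • g) with hp
  have hpX : p ∈ X := (proj_spec ⟨u, hu⟩ hcl _).1
  have h1 : ‖p - u‖ ≤ ‖x + η • g - u‖ := norm_proj_sub_le hcl hconv _ hu
  have h2 : ‖x + η • g - u‖ ^ 2 = ‖x - u‖ ^ 2 - 2 * η * inner ℝ g (u - x) + η ^ 2 * ‖g‖ ^ 2 := by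
    have : x + η • g - u = (x - u) + η • g := by abel
    rw [this, norm_add_sq_real, norm_smul, mul_pow, inner_smul_right, Real.norm_eq_abs, sq_abs,
      ← neg_sub x u, inner_neg_right, real_inner_comm g]
    ring
  have h3 : ‖p - u'‖ ≤ ‖p - u‖ + ‖u' - u‖ := by
    have : p - u' = (p - u) - (u' - u) := by abel
    rw [this]; exact norm_sub_le _ _
  have h4 : ‖p - u‖ ≤ Metric.diam X := by
    rw [← dist_eq_norm]; exact Metric.dist_le_diam_of_mem hb hpX hu
  have h5 : ‖p - u'‖ ≤ Metric.diam X := by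
    rw [← dist_eq_norm]; exact Metric.dist_le_diam_of_mem hb hpX hu'
  have h6 : ‖p - u‖ ^ 2 ≤ ‖x + η • g - u‖ ^ 2 := by gcongr
  have h7 : η ^ 2 * ‖g‖ ^ 2 ≤ η ^ 2 * G ^ 2 := by gcongr
  have h8 : ‖p - u'‖ ^ 2 ≤ ‖p - u‖ ^ 2 + 2 * Metric.diam X * ‖u' - u‖ := by
    have n1 := norm_nonneg (p - u)
    have n2 := norm_nonneg (p - u')
    have n3 := norm_nonneg (u' - u)
    rcases le_total ‖p - u'‖ ‖p - u‖ with h | h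
    · have : ‖p - u'‖ ^ 2 ≤ ‖p - u‖ ^ 2 := by gcongr
      nlinarith
    · nlinarith [mul_le_mul (sub_le_iff_le_add'.2 h3) (add_le_add h5 h4) (by positivity) n3]
  linarith

theorem log_inv_wt_iaInit_le (hN : 0 < N) (x₁ : ℕ → Vec d) (i : Fin N) :
    -Real.log ((iaInit N x₁).wt i) ≤ 2 * N := by
  have hN' : (0 : ℝ) < N := Nat.cast_pos.2 hN
  have hi : (i : ℝ) + 1 ≤ N := by exact_mod_cast i.2
  have hpos : (0 : ℝ) < ((i : ℝ) + 1) * ((i : ℝ) + 2) := by positivity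
  have h1 : 1 / (((i : ℝ) + 1) * ((i : ℝ) + 2)) ≤ (iaInit N x₁).wt i := by
    simp only [iaInit]
    gcongr
    have : 0 ≤ 1 / (N : ℝ) := by positivity
    linarith
  have h2 := Real.log_le_log (by positivity) h1
  rw [one_div, Real.log_inv, Real.log_mul (by positivity) (by positivity)] at h2
  have h3 := Real.log_le_sub_one_of_pos (show (0 : ℝ) < (i : ℝ) + 1 by positivity)
  have h4 := Real.log_le_sub_one_of_pos (show (0 : ℝ) < (i : ℝ) + 2 by positivity)
  linarith

variable {n : ℕ} {G : ℝ} {x₁ : ℕ → Vec d} {fb : ℕ → Vec d → Vec d} {m : ℕ}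

/-- The regret of the learner against one of its experts. -/
theorem sum_inner_expert_sub_action_le (hne : X.Nonempty) (hcl : IsClosed X) (hconv : Convex ℝ X)
    (hb : Bornology.IsBounded X) (hD : 0 < Metric.diam X) (hn : 0 < n) (hG : 0 < G)
    (hx : ∀ i, x₁ i ∈ X) (hm : m ≤ n)
    (hfb : ∀ t < m, ‖fb t (iaAction X n G x₁ fb t)‖ ≤ G) (i : Fin (iaNum n)) :
    ∑ t ∈ Finset.range m, inner ℝ (fb t (iaAction X n G x₁ fb t))
        ((iaState X n G x₁ fb t).pt i - iaAction X n G x₁ fb t)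
      ≤ (2 * iaNum n + 3) * (G * Real.sqrt (n * Metric.diam X ^ 2)) := by
  set D := Metric.diam X with hDdef
  set lam := iaLam n D G with hlam
  have hn' : (0 : ℝ) < n := Nat.cast_pos.2 hn
  have hn1 : (1 : ℝ) ≤ n := by exact_mod_cast hn
  have hlam0 : 0 < lam := by rw [hlam, iaLam]; positivity
  have hlamsq : lam ^ 2 = 2 / (n * G ^ 2 * D ^ 2) := by
    rw [hlam, iaLam, Real.sq_sqrt (by positivity)]
  have hbsq : (lam * (G * D)) ^ 2 = 2 / n := by
    rw [mul_pow, hlamsq]; field_simp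
  have hb2 : lam * (G * D) ≤ 2 := by
    have : (lam * (G * D)) ^ 2 ≤ 2 ^ 2 := by
      rw [hbsq, div_le_iff₀ hn']; linarith
    exact (pow_le_pow_iff_left₀ (by positivity) (by norm_num) two_ne_zero).1 this
  have hv := fun t => isValid_iaState hne hcl n G hx fb t
  have key : ∀ l ≤ m, Real.log ((iaState X n G x₁ fb 0).wt i)
      + lam * ∑ t ∈ Finset.range l, inner ℝ (fb t (iaAction X n G x₁ fb t))
        ((iaState X n G x₁ fb t).pt i - iaAction X n G x₁ fb t) - l * (3 / n)
      ≤ Real.log ((iaState X n G x₁ fb l).wt i) := by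
    intro l
    induction l with
    | zero => intro _; simp
    | succ l ih =>
      intro hl
      have h1 := ih (Nat.le_of_succ_le hl)
      have h2 := (hv l).log_wt_update hconv hb hlam0.le (hfb l hl) hb2 (iaEta n D G) i
      rw [hbsq] at h2
      rw [Finset.sum_range_succ, mul_add]
      have h3 : (iaState X n G x₁ fb (l + 1)).wt i = ((iaState X n G x₁ fb l).update X
        (iaEta n D G) lam (fb l (iaAction X n G x₁ fb l))).wt i := rfl
      rw [h3]
      push_cast
      have h4 : (3 : ℝ) / 2 * (2 / n) = 3 / n := by ring
      rw [h4] at h2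
      have h5 : inner ℝ (fb l (iaAction X n G x₁ fb l))
          ((iaState X n G x₁ fb l).pt i - (iaState X n G x₁ fb l).action)
          = inner ℝ (fb l (iaAction X n G x₁ fb l))
          ((iaState X n G x₁ fb l).pt i - iaAction X n G x₁ fb l) := rfl
      rw [h5] at h2
      linarith
  have hfin := key m le_rfl
  -- Weights never exceed `1`, so the total gain of an expert is at most `-log` of its initial weight
  -- plus the second order terms, `3 / n` per round.
  have hle0 : Real.log ((iaState X n G x₁ fb m).wt i) ≤ 0 := by
    refine Real.log_nonpos ((hv m).wt_pos i).le ?_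
    rw [← (hv m).sum_wt]
    exact Finset.single_le_sum (fun j _ => ((hv m).wt_pos j).le) (Finset.mem_univ i)
  have hinit : -Real.log ((iaState X n G x₁ fb 0).wt i) ≤ 2 * iaNum n :=
    log_inv_wt_iaInit_le (Nat.succ_pos _) x₁ i
  have hmn : (m : ℝ) * (3 / n) ≤ 3 := by
    have : (m : ℝ) ≤ n := by exact_mod_cast hm
    rw [mul_div_assoc', div_le_iff₀ hn']; linarith
  set Q := ∑ t ∈ Finset.range m, inner ℝ (fb t (iaAction X n G x₁ fb t))
        ((iaState X n G x₁ fb t).pt i - iaAction X n G x₁ fb t)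
  have h1 : lam * Q ≤ 2 * iaNum n + 3 := by linarith
  have h2 : 1 ≤ lam * (G * Real.sqrt (n * D ^ 2)) := by
    have : (1 : ℝ) ^ 2 ≤ (lam * (G * Real.sqrt (n * D ^ 2))) ^ 2 := by
      rw [mul_pow, mul_pow, Real.sq_sqrt (by positivity), hlamsq, one_pow]
      field_simp
      norm_num
    exact (pow_le_pow_iff_left₀ (by norm_num) (by positivity) two_ne_zero).1 this
  have h3 : (0 : ℝ) ≤ 2 * iaNum n + 3 := by positivity
  refine le_of_mul_le_mul_left ?_ hlam0
  calc lam * Q ≤ 2 * iaNum n + 3 := h1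
    _ ≤ (2 * iaNum n + 3) * (lam * (G * Real.sqrt (n * D ^ 2))) := le_mul_of_one_le_right h3 h2
    _ = _ := by ring

/-- The regret of one expert against a moving comparator. -/
theorem sum_inner_sub_expert_le (hcl : IsClosed X) (hconv : Convex ℝ X)
    (hb : Bornology.IsBounded X) (hx : ∀ i, x₁ i ∈ X)
    (hfb : ∀ t < m, ‖fb t (iaAction X n G x₁ fb t)‖ ≤ G) {u : ℕ → Vec d} (hu : ∀ t, u t ∈ X)
    (i : Fin (iaNum n)) :
    2 * iaEta n (Metric.diam X) G i * ∑ t ∈ Finset.range m,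
        inner ℝ (fb t (iaAction X n G x₁ fb t)) (u t - (iaState X n G x₁ fb t).pt i)
      ≤ Metric.diam X ^ 2 + 2 * Metric.diam X * ∑ t ∈ Finset.range m, ‖u (t + 1) - u t‖
        + m * (iaEta n (Metric.diam X) G i ^ 2 * G ^ 2) := by
  set D := Metric.diam X with hDdef
  set η := iaEta n D G i with hη
  have key : ∀ l ≤ m, 2 * η * ∑ t ∈ Finset.range l,
        inner ℝ (fb t (iaAction X n G x₁ fb t)) (u t - (iaState X n G x₁ fb t).pt i)
      ≤ D ^ 2 + 2 * D * ∑ t ∈ Finset.range l, ‖u (t + 1) - u t‖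
        + l * (η ^ 2 * G ^ 2) - ‖(iaState X n G x₁ fb l).pt i - u l‖ ^ 2 := by
    intro l
    induction l with
    | zero =>
      intro _
      have : ‖(iaState X n G x₁ fb 0).pt i - u 0‖ ≤ D := by
        rw [← dist_eq_norm]
        exact Metric.dist_le_diam_of_mem hb (hx i) (hu 0)
      have : ‖(iaState X n G x₁ fb 0).pt i - u 0‖ ^ 2 ≤ D ^ 2 := by gcongr
      simp
      linarith
    | succ l ih =>
      intro hl
      have h1 := ih (Nat.le_of_succ_le hl)
      have h2 := norm_proj_step_sq_le (x := (iaState X n G x₁ fb l).pt i) (η := η) hcl hconv hb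
        (hu l) (hu (l + 1)) (hfb l hl)
      have h3 : (iaState X n G x₁ fb (l + 1)).pt i = proj X ((iaState X n G x₁ fb l).pt i
        + η • fb l (iaAction X n G x₁ fb l)) := rfl
      rw [h3, Finset.sum_range_succ, Finset.sum_range_succ]
      push_cast
      linarith
  have := key m le_rfl
  have h0 := sq_nonneg ‖(iaState X n G x₁ fb m).pt i - u m‖
  linarith

/-- Among the step sizes one is optimal up to a factor of two, whatever the path length. -/
theorem exists_iaEta {D P : ℝ} (hD : 0 < D) (hn : 0 < n) (hG : 0 < G) (hP : 0 ≤ P)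
    (hPn : P ≤ n * D) : ∃ i : Fin (iaNum n), 0 < iaEta n D G i ∧
      n * (iaEta n D G i ^ 2 * G ^ 2) ≤ 7 / 2 * (D ^ 2 + D * P) ∧
      D ^ 2 + D * P ≤ 2 * (n * (iaEta n D G i ^ 2 * G ^ 2)) := by
  have hn' : (0 : ℝ) < n := Nat.cast_pos.2 hn
  -- The ratio of the optimal step size to the smallest one; the index rounds it down to `2 ^ i`.
  set ρ := Real.sqrt (1 + 4 * P / (7 * D)) with hρ
  have hρsq : ρ ^ 2 = 1 + 4 * P / (7 * D) := Real.sq_sqrt (by positivity)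
  have hρ1 : 1 ≤ ρ := by
    rw [hρ, Real.one_le_sqrt]
    have : 0 ≤ 4 * P / (7 * D) := by positivity
    linarith
  obtain ⟨i, hi1, hi2⟩ := exists_nat_pow_near hρ1 (one_lt_two)
  have hNlow : ρ ≤ 2 ^ (iaNum n - 1) := by
    have h1 : (1 / 2 : ℝ) * Real.logb 2 (1 + 4 * n / 7) ≤ ((iaNum n - 1 : ℕ) : ℝ) := by
      simp only [iaNum, Nat.add_sub_cancel]
      exact Nat.le_ceil _
    have h2 : (1 + 4 * (n : ℝ) / 7) = (2 : ℝ) ^ Real.logb 2 (1 + 4 * n / 7) :=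
      (Real.rpow_logb two_pos (by norm_num) (by positivity)).symm
    have h3 : ρ ^ 2 ≤ 1 + 4 * (n : ℝ) / 7 := by
      rw [hρsq]
      have : 4 * P / (7 * D) ≤ 4 * n / 7 := by
        rw [div_le_div_iff₀ (by positivity) (by norm_num)]; nlinarith
      linarith
    have h4 : ρ ^ 2 ≤ ((2 : ℝ) ^ (iaNum n - 1)) ^ 2 := by
      refine h3.trans ?_
      rw [h2, ← pow_mul, ← Real.rpow_natCast]
      refine Real.rpow_le_rpow_of_exponent_le one_le_two ?_
      push_cast
      linarith
    exact (pow_le_pow_iff_left₀ (by linarith) (by positivity) two_ne_zero).1 h4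
  have hiN : i < iaNum n := by
    have h1 : (2 : ℝ) ^ i ≤ 2 ^ (iaNum n - 1) := hi1.trans hNlow
    have h2 := (pow_le_pow_iff_right₀ (one_lt_two (α := ℝ))).1 h1
    have h3 : 0 < iaNum n := Nat.succ_pos _
    omega
  have hsq : (n : ℝ) * (iaEta n D G i ^ 2 * G ^ 2) = 7 / 2 * ((2 ^ i) ^ 2 * D ^ 2) := by
    rw [iaEta, mul_pow, Real.sq_sqrt (by positivity)]
    field_simp
  have hDρ : D ^ 2 * ρ ^ 2 = D ^ 2 + 4 / 7 * (D * P) := by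
    rw [hρsq]; field_simp
  have hi1' : ((2 : ℝ) ^ i) ^ 2 ≤ ρ ^ 2 := by gcongr
  have hi2' : ρ ^ 2 ≤ (2 * (2 : ℝ) ^ i) ^ 2 := by
    have : ρ ≤ 2 * 2 ^ i := by rw [← pow_succ']; exact hi2.le
    gcongr
  have hDP : 0 ≤ D * P := by positivity
  have hD2 : 0 < D ^ 2 := by positivity
  refine ⟨⟨i, hiN⟩, by simp only [iaEta]; positivity, ?_, ?_⟩
  · simp only [hsq]
    nlinarith [mul_le_mul_of_nonneg_left hi1' hD2.le]
  · simp only [hsq]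
    nlinarith [mul_le_mul_of_nonneg_left hi2' hD2.le]

/-- Dynamic regret of Improved Ader for linear rewards. -/
theorem sum_inner_sub_iaAction_le (hne : X.Nonempty) (hcl : IsClosed X) (hconv : Convex ℝ X)
    (hb : Bornology.IsBounded X) (hD : 0 < Metric.diam X) (hn : 0 < n) (hG : 0 < G)
    (hx : ∀ i, x₁ i ∈ X) (hm : m ≤ n)
    (hfb : ∀ t < m, ‖fb t (iaAction X n G x₁ fb t)‖ ≤ G) {u : ℕ → Vec d} (hu : ∀ t, u t ∈ X) :
    ∑ t ∈ Finset.range m, inner ℝ (fb t (iaAction X n G x₁ fb t))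
        (u t - iaAction X n G x₁ fb t)
      ≤ (2 * iaNum n + 8) * (G * Real.sqrt (n * (Metric.diam X ^ 2
          + Metric.diam X * ∑ t ∈ Finset.range m, ‖u (t + 1) - u t‖))) := by
  set D := Metric.diam X with hDdef
  set P := ∑ t ∈ Finset.range m, ‖u (t + 1) - u t‖ with hPdef
  have hP0 : 0 ≤ P := Finset.sum_nonneg fun _ _ => norm_nonneg _
  have hmn : (m : ℝ) ≤ n := by exact_mod_cast hm
  have hn' : (0 : ℝ) < n := Nat.cast_pos.2 hn
  have hPn : P ≤ n * D := by
    calc P ≤ ∑ _t ∈ Finset.range m, D := Finset.sum_le_sum fun t _ => by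
          rw [← dist_eq_norm]; exact Metric.dist_le_diam_of_mem hb (hu _) (hu _)
      _ = m * D := by simp
      _ ≤ n * D := by gcongr
  obtain ⟨i, hη0, hη1, hη2⟩ := exists_iaEta (G := G) hD hn hG hP0 hPn
  have h1 := sum_inner_expert_sub_action_le hne hcl hconv hb hD hn hG hx hm hfb i
  have h2 := sum_inner_sub_expert_le hcl hconv hb hx hfb hu i
  rw [← hDdef, ← hPdef] at h2
  rw [← hDdef] at h1
  set η := iaEta n D G i with hη
  set A := ∑ t ∈ Finset.range m,
        inner ℝ (fb t (iaAction X n G x₁ fb t)) (u t - (iaState X n G x₁ fb t).pt i) with hA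
  set W := D ^ 2 + D * P with hW
  have hDP : 0 ≤ D * P := by positivity
  have hW0 : 0 < W := by positivity
  set R := Real.sqrt (n * W) with hR
  have hRsq : R ^ 2 = n * W := Real.sq_sqrt (by positivity)
  have hR0 : 0 < R := by positivity
  have hm2 : (m : ℝ) * (η ^ 2 * G ^ 2) ≤ n * (η ^ 2 * G ^ 2) := by gcongr
  have h3 : 2 * η * A ≤ 11 / 2 * W := by
    have := sq_nonneg D
    nlinarith
  have h4 : 7 / 10 * W ≤ η * G * R := by
    have : (7 / 10 * W) ^ 2 ≤ (η * G * R) ^ 2 := by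
      rw [mul_pow, mul_pow, mul_pow, hRsq]
      nlinarith [mul_le_mul_of_nonneg_right hη2 hW0.le]
    exact (pow_le_pow_iff_left₀ (by positivity) (by positivity) two_ne_zero).1 this
  have h5 : A ≤ 5 * (G * R) := by
    refine le_of_mul_le_mul_left ?_ (show 0 < 2 * η by positivity)
    nlinarith
  have h6 : Real.sqrt (n * D ^ 2) ≤ R := by
    refine Real.sqrt_le_sqrt ?_
    gcongr
    linarith
  have h7 : (2 * (iaNum n : ℝ) + 3) * (G * Real.sqrt (n * D ^ 2))
      ≤ (2 * iaNum n + 3) * (G * R) := by gcongr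
  have hsplit : ∑ t ∈ Finset.range m, inner ℝ (fb t (iaAction X n G x₁ fb t))
        (u t - iaAction X n G x₁ fb t)
      = A + ∑ t ∈ Finset.range m, inner ℝ (fb t (iaAction X n G x₁ fb t))
        ((iaState X n G x₁ fb t).pt i - iaAction X n G x₁ fb t) := by
    rw [hA, ← Finset.sum_add_distrib]
    refine Finset.sum_congr rfl fun t _ => ?_
    rw [← inner_add_right]; congr 1; abel
  rw [hsplit]
  linarith

end Learner

/-! ### Resampling one of countably many independent draws -/

section Resampling

theorem integrable_of_measurable_of_bound {α : Type*} [MeasurableSpace α] {P : Measure α}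
    [IsFiniteMeasure P] {H : α → ℝ} (hH : Measurable H) {b : ℝ} (hb : ∀ ω, |H ω| ≤ b) :
    Integrable H P :=
  Integrable.of_bound hH.aestronglyMeasurable b (Filter.Eventually.of_forall hb)

/-- Replacing one coordinate of a product of probability measures by an independent copy does not
change the law. -/
theorem measurePreserving_update {ι : Type*} [DecidableEq ι] {A : ι → Type*}
    [∀ i, MeasurableSpace (A i)] (μ : ∀ i, Measure (A i)) [∀ i, IsProbabilityMeasure (μ i)]
    (i : ι) : MeasurePreserving (fun p : (∀ j, A j) × A i => Function.update p.1 i p.2)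
      ((Measure.infinitePi μ).prod (μ i)) (Measure.infinitePi μ) := by
  refine ⟨measurable_update', Measure.eq_infinitePi μ fun s t ht => ?_⟩
  rw [Measure.map_apply measurable_update'
    (MeasurableSet.pi s.countable_toSet fun j _ => ht j)]
  have hpre : (fun p : (∀ j, A j) × A i => Function.update p.1 i p.2) ⁻¹' (Set.pi s t)
      = (Set.pi (s.erase i) t) ×ˢ (if i ∈ s then t i else Set.univ) := by
    ext ⟨ω, a⟩
    simp only [Set.mem_preimage, Set.mem_pi, Finset.mem_coe, Set.mem_prod, Finset.mem_erase]
    constructor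
    · intro h
      refine ⟨fun j hj => by simpa [Function.update_of_ne hj.1] using h j hj.2, ?_⟩
      split_ifs with his
      · simpa using h i his
      · trivial
    · rintro ⟨h1, h2⟩ j hj
      rcases eq_or_ne j i with rfl | hji
      · simpa [hj] using h2
      · simpa [Function.update_of_ne hji] using h1 j ⟨hji, hj⟩
  rw [hpre, Measure.prod_prod, Measure.infinitePi_pi μ fun j _ => ht j]
  split_ifs with his
  · exact Finset.prod_erase_mul s _ his
  · rw [measure_univ, mul_one, Finset.erase_eq_of_notMem his]

variable {Ω A : Type*} [MeasurableSpace Ω] [MeasurableSpace A] {P : Measure Ω} {ρ : Measure A}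
  [IsProbabilityMeasure ρ] {R : Ω × A → Ω}

/-- If resampling one draw preserves the law, an expectation may be computed by averaging over the
resampled draw with the other draws fixed. -/
theorem integral_resample [IsProbabilityMeasure P] (hR : MeasurePreserving R (P.prod ρ) P)
    {H : Ω → ℝ} (hH : Measurable H) {b : ℝ} (hb : ∀ ω, |H ω| ≤ b) : ∫ ω, H ω ∂P = ∫ ω, ∫ a, H (R (ω, a)) ∂ρ ∂P := by
  rw [← integral_prod (fun p => H (R p))
    (integrable_of_measurable_of_bound (hH.comp hR.measurable) fun _ => hb _),
    ← integral_map hR.aemeasurable (by rw [hR.map_eq]; exact hH.aestronglyMeasurable), hR.map_eq]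

theorem ae_resample (hR : MeasurePreserving R (P.prod ρ) P) {S : Set Ω} (hS : MeasurableSet S)
    (h : ∀ ω, ∀ᵐ a ∂ρ, R (ω, a) ∈ S) : ∀ᵐ ω ∂P, ω ∈ S := by
  have h1 : ∀ᵐ p ∂P.prod ρ, R p ∈ S :=
    (Measure.ae_prod_iff_ae_ae (hR.measurable hS)).2 (Filter.Eventually.of_forall h)
  have h2 := (ae_map_iff hR.aemeasurable hS).2 h1
  rwa [hR.map_eq] at h2

end Resampling

theorem integral_uniformOn_Iio (L : ℕ) (g : ℕ → ℝ) :
    ∫ j, g j ∂(ProbabilityTheory.uniformOn (Set.Iio L)) = (L : ℝ)⁻¹ * ∑ j ∈ Finset.range L, g j := by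
  have hset : (Set.Iio L : Set ℕ) = (Finset.range L : Set ℕ) := by ext; simp
  have hcard : Measure.count (Set.Iio L : Set ℕ) = L := by
    rw [hset, Measure.count_apply_finset, Finset.card_range]
  rw [ProbabilityTheory.uniformOn, ProbabilityTheory.cond, integral_smul_measure, hcard]
  rw [hset, setIntegral_finset]
  · simp [measureReal_def]
  · rw [IntegrableOn, ← hset]
    have : IsFiniteMeasure ((Measure.count : Measure ℕ).restrict (Set.Iio L)) :=
      ⟨by rw [Measure.restrict_apply_univ, hcard]; exact ENNReal.natCast_lt_top L⟩
    refine Integrable.of_bound (C := ∑ j ∈ Finset.range L, ‖g j‖)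
      (measurable_from_top (f := g)).aestronglyMeasurable ?_
    refine (ae_restrict_iff' measurableSet_Iio).2 (Filter.Eventually.of_forall fun j hj => ?_)
    exact Finset.single_le_sum (f := fun j => ‖g j‖) (fun _ _ => norm_nonneg _)
      (Finset.mem_range.2 hj)

theorem isProbabilityMeasure_uniformOn_Iio {L : ℕ} (hL : 0 < L) :
    IsProbabilityMeasure (ProbabilityTheory.uniformOn (Set.Iio L) : Measure ℕ) :=
  ProbabilityTheory.isProbabilityMeasure_uniformOn (Set.finite_Iio L) ⟨0, hL⟩

theorem ae_uniformOn_Iio (L : ℕ) :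
    ∀ᵐ j ∂(ProbabilityTheory.uniformOn (Set.Iio L) : Measure ℕ), j < L :=
  ProbabilityTheory.ae_cond_mem measurableSet_Iio

/-- The law of the draws: for each block a pair `(z, j)`, and for each round a pair of a unit
vector and an oracle noise, here merged into one draw with values in `E`. -/
noncomputable abbrev drawLaw {E : Type*} [MeasurableSpace E] (L : ℕ) (μ : ℕ → Measure E) :
    Measure ((ℕ → ℝ × ℕ) × (ℕ → E)) :=
  (Measure.infinitePi fun _ : ℕ => zLaw.prod (ProbabilityTheory.uniformOn (Set.Iio L))).prod
    (Measure.infinitePi μ)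

section Draws

variable {E : Type*} [MeasurableSpace E] {L : ℕ} (μ : ℕ → Measure E)

theorem ae_drawLaw_mem [IsProbabilityMeasure (ProbabilityTheory.uniformOn (Set.Iio L) : Measure ℕ)] :
    ∀ᵐ ω ∂drawLaw L μ, ∀ q, (ω.1 q).1 ∈ Set.Icc (0 : ℝ) 1 ∧ (ω.1 q).2 < L := by
  set ρ : Measure (ℝ × ℕ) := zLaw.prod (ProbabilityTheory.uniformOn (Set.Iio L)) with hρ
  rw [ae_all_iff]
  intro q
  have h1 : ∀ᵐ a ∂ρ, a.1 ∈ Set.Icc (0 : ℝ) 1 ∧ a.2 < L := by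
    have e1 := Measure.quasiMeasurePreserving_fst (μ := zLaw)
      (ν := (ProbabilityTheory.uniformOn (Set.Iio L) : Measure ℕ)) |>.ae ae_zLaw_mem
    have e2 := Measure.quasiMeasurePreserving_snd (μ := zLaw)
      (ν := (ProbabilityTheory.uniformOn (Set.Iio L) : Measure ℕ)) |>.ae (ae_uniformOn_Iio L)
    exact e1.and e2
  exact ((measurePreserving_eval_infinitePi (fun _ : ℕ => ρ) q).quasiMeasurePreserving.comp
    Measure.quasiMeasurePreserving_fst).ae h1

variable [∀ t, IsProbabilityMeasure (μ t)]

theorem measurePreserving_update_block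
    [IsProbabilityMeasure (ProbabilityTheory.uniformOn (Set.Iio L) : Measure ℕ)] (q : ℕ) :
    MeasurePreserving
      (fun p : ((ℕ → ℝ × ℕ) × (ℕ → E)) × (ℝ × ℕ) => (Function.update p.1.1 q p.2, p.1.2))
      ((drawLaw L μ).prod (zLaw.prod (ProbabilityTheory.uniformOn (Set.Iio L)))) (drawLaw L μ) := by
  set ρ : Measure (ℝ × ℕ) := zLaw.prod (ProbabilityTheory.uniformOn (Set.Iio L))
  set P₁ := Measure.infinitePi fun _ : ℕ => ρ
  set P₂ := Measure.infinitePi μ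
  have h1 := measurePreserving_prodAssoc P₁ P₂ ρ
  have h2 := (MeasurePreserving.id P₁).prod (Measure.measurePreserving_swap (μ := P₂) (ν := ρ))
  have h3 := (measurePreserving_prodAssoc P₁ ρ P₂).symm
  have h4 := (measurePreserving_update (fun _ : ℕ => ρ) q).prod (MeasurePreserving.id P₂)
  exact h4.comp (h3.comp (h2.comp h1))

theorem measurePreserving_update_round
    [IsProbabilityMeasure (ProbabilityTheory.uniformOn (Set.Iio L) : Measure ℕ)] (t : ℕ) :
    MeasurePreserving
      (fun p : ((ℕ → ℝ × ℕ) × (ℕ → E)) × E => (p.1.1, Function.update p.1.2 t p.2))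
      ((drawLaw L μ).prod (μ t)) (drawLaw L μ) := by
  set ρ : Measure (ℝ × ℕ) := zLaw.prod (ProbabilityTheory.uniformOn (Set.Iio L))
  set P₁ := Measure.infinitePi fun _ : ℕ => ρ
  have h1 := measurePreserving_prodAssoc P₁ (Measure.infinitePi μ) (μ t)
  have h4 := (MeasurePreserving.id P₁).prod (measurePreserving_update μ t)
  exact h4.comp h1

end Draws

/-! ### Measurability of the learner and its dependence on the feedback -/

section Measurability

variable {d : ℕ} {X : Set (Vec d)} {Ω : Type*} [MeasurableSpace Ω] {n : ℕ} {G : ℝ}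
  {x₁ : ℕ → Vec d}

theorem measurable_iaState (hne : X.Nonempty) (hcl : IsClosed X) (hconv : Convex ℝ X)
    {fb : Ω → ℕ → Vec d → Vec d} (hfb : ∀ m, Measurable fun p : Ω × Vec d => fb p.1 m p.2)
    (t : ℕ) : (∀ i, Measurable fun ω => (iaState X n G x₁ (fb ω) t).pt i) ∧
      (∀ i, Measurable fun ω => (iaState X n G x₁ (fb ω) t).wt i) := by
  induction t with
  | zero => exact ⟨fun i => measurable_const, fun i => measurable_const⟩
  | succ t ih =>
    have hact : Measurable fun ω => (iaState X n G x₁ (fb ω) t).action :=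
      Finset.measurable_fun_sum _ fun i _ => (ih.2 i).smul (ih.1 i)
    have hg : Measurable fun ω => fb ω t (iaState X n G x₁ (fb ω) t).action :=
      (hfb t).comp (measurable_id.prodMk hact)
    have hgain : ∀ i, Measurable fun ω => (iaState X n G x₁ (fb ω) t).gain
        (iaLam n (Metric.diam X) G) (fb ω t (iaState X n G x₁ (fb ω) t).action) i := fun i =>
      (ih.2 i).mul ((hg.inner ((ih.1 i).sub hact)).const_mul _).exp
    refine ⟨fun i => ?_, fun i => ?_⟩
    · exact (continuous_proj hne hcl hconv).measurable.comp ((ih.1 i).add (hg.const_smul (iaEta n (Metric.diam X) G i)))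
    · exact (hgain i).div (Finset.measurable_fun_sum _ fun j _ => hgain j)

theorem measurable_iaAction (hne : X.Nonempty) (hcl : IsClosed X) (hconv : Convex ℝ X)
    {fb : Ω → ℕ → Vec d → Vec d} (hfb : ∀ m, Measurable fun p : Ω × Vec d => fb p.1 m p.2)
    (t : ℕ) : Measurable fun ω => iaAction X n G x₁ (fb ω) t := by
  have h := measurable_iaState (n := n) (G := G) (x₁ := x₁) hne hcl hconv hfb t
  unfold iaAction IAState.action
  exact Finset.measurable_fun_sum _ fun i _ => (h.2 i).smul (h.1 i)

theorem iaState_congr {fb fb' : ℕ → Vec d → Vec d} {t : ℕ}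
    (h : ∀ m < t, fb m (iaAction X n G x₁ fb m) = fb' m (iaAction X n G x₁ fb m)) :
    iaState X n G x₁ fb t = iaState X n G x₁ fb' t := by
  induction t with
  | zero => rfl
  | succ t ih =>
    have h1 := ih fun m hm => h m (Nat.lt_succ_of_lt hm)
    have h2 := h t (Nat.lt_succ_self t)
    simp only [iaAction] at h2
    simp only [iaState]
    rw [h2, h1]

theorem iaAction_congr {fb fb' : ℕ → Vec d → Vec d} {t : ℕ}
    (h : ∀ m < t, fb m (iaAction X n G x₁ fb m) = fb' m (iaAction X n G x₁ fb m)) :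
    iaAction X n G x₁ fb t = iaAction X n G x₁ fb' t := by
  rw [iaAction, iaState_congr h, iaAction]

end Measurability

/-! ### The domain `o + s K` and the query algorithm on it -/

section Domain

variable {d : ℕ} {K : Set (Vec d)} {o : Vec d} {s : ℝ}

theorem coord_add_smul (hs : s ≠ 0) (o p : Vec d) : coord o s (o + s • p) = p := by
  simp [coord, smul_smul, inv_mul_cancel₀ hs]

theorem hmap_add_smul (hs : s ≠ 0) (z : ℝ) (o p : Vec d) :
    hmap o s z (o + s • p) = o + s • oneSubExp z p := by
  rw [hmap, coord_add_smul hs]; rfl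

theorem inner_bqnd (hs : s ≠ 0) (z : ℝ) (resp : Vec d → Vec d) (o p w : Vec d) :
    inner ℝ (bqnd o s z resp (o + s • p)) w
      = inner ℝ (resp (o + s • oneSubExp z p)) (expWeighted z p w) := by
  simp only [bqnd, coord_add_smul hs, hmap_add_smul hs, PiLp.inner_apply, RCLike.inner_apply,
    conj_trivial, expWeighted]
  exact Finset.sum_congr rfl fun i _ => by ring

theorem IsConstraintSet.hmap_mem_dom (hK : IsConstraintSet K) (hs : s ≠ 0) {z : ℝ}
    (hz : z ∈ Set.Icc (0 : ℝ) 1) {x : Vec d} (hx : x ∈ dom o s K) : hmap o s z x ∈ dom o s K := by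
  obtain ⟨p, hp, rfl⟩ := hx
  exact ⟨oneSubExp z p, hK.oneSubExp_mem hz hp, (hmap_add_smul hs z o p).symm⟩

theorem IsConstraintSet.norm_bqnd_le (hK : IsConstraintSet K) (hs : s ≠ 0) {z : ℝ} (hz : 0 ≤ z)
    (resp : Vec d → Vec d) {x : Vec d} (hx : x ∈ dom o s K) :
    ‖bqnd o s z resp x‖ ≤ ‖resp (hmap o s z x)‖ := by
  obtain ⟨p, hp, rfl⟩ := hx
  have h := norm_expWeighted_le hz (fun i => (hK.subset_cube hp i).1)
    (resp (hmap o s z (o + s • p)))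
  convert h using 2
  simp only [bqnd, expWeighted, coord_add_smul hs]
  congr 1; funext i; ring

theorem measurable_hmap (o : Vec d) (s : ℝ) :
    Measurable fun p : ℝ × Vec d => hmap o s p.1 p.2 := by
  have : Continuous fun p : ℝ × Vec d => hmap o s p.1 p.2 := by
    unfold hmap coord; fun_prop
  exact this.measurable

theorem measurable_bqnd {E : Type*} [MeasurableSpace E] (o : Vec d) (s : ℝ)
    {resp : E → Vec d → Vec d} (hresp : Measurable fun p : E × Vec d => resp p.1 p.2) :
    Measurable fun p : ℝ × E × Vec d => bqnd o s p.1 (resp p.2.1) p.2.2 := by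
  have h1 : Measurable fun p : ℝ × E × Vec d => resp p.2.1 (hmap o s p.1 p.2.2) :=
    hresp.comp ((measurable_fst.comp measurable_snd).prodMk
      ((measurable_hmap o s).comp (measurable_fst.prodMk (measurable_snd.comp measurable_snd))))
  have h2 : Continuous fun q : ℝ × Vec d × Vec d =>
      (WithLp.toLp 2 fun i => q.2.1 i * Real.exp (-q.1 * coord o s q.2.2 i) : Vec d) := by
    unfold coord; fun_prop
  exact h2.measurable.comp
    (measurable_fst.prodMk (h1.prodMk (measurable_snd.comp measurable_snd)))

theorem IsConstraintSet.isCompact_dom (hK : IsConstraintSet K) : IsCompact (dom o s K) :=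
  hK.isCompact.image (by fun_prop)

theorem IsConstraintSet.convex_dom (hK : IsConstraintSet K) : Convex ℝ (dom o s K) := by
  rintro _ ⟨p, hp, rfl⟩ _ ⟨q, hq, rfl⟩ a b ha hb hab
  refine ⟨a • p + b • q, hK.convex hp hq ha hb hab, ?_⟩
  have : b = 1 - a := by linarith
  subst this
  module

theorem IsConstraintSet.nonempty_dom (hK : IsConstraintSet K) : (dom o s K).Nonempty :=
  ⟨_, 0, hK.zero_mem, rfl⟩

theorem IsConstraintSet.diam_dom_pos (hK : IsConstraintSet K) (hs : s ≠ 0) :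
    0 < Metric.diam (dom o s K) := by
  refine Metric.diam_pos ?_ hK.isCompact_dom.isBounded
  refine hK.nontrivial.image fun p q h => ?_
  exact smul_right_injective _ hs (add_left_cancel h)

theorem IsConstraintSet.diam_le {S : Set (Vec d)} (hK : IsConstraintSet K) (hS : S ⊆ K) :
    Metric.diam S ≤ Real.sqrt d :=
  Metric.diam_le_of_forall_dist_le (Real.sqrt_nonneg _) fun x hx y hy => by
    rw [dist_eq_norm]
    exact norm_sub_le_of_mem_unitCube (hK.subset_cube (hS hx)) (hK.subset_cube (hS hy))

theorem IsConstraintSet.one_le_dim (hK : IsConstraintSet K) : 1 ≤ d := by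
  rcases Nat.eq_zero_or_pos d with rfl | h
  · exact absurd hK.nontrivial (Set.not_nontrivial_iff.2 (Set.subsingleton_of_subsingleton))
  · exact h

theorem IsObjective.sub_le_of_mem {M : ℝ} {f : Vec d → ℝ} (hf : IsObjective K M f)
    (hK : IsConstraintSet K) {x y : Vec d} (hx : x ∈ K) (hy : y ∈ K) :
    f y - f x ≤ M * Real.sqrt d :=
  (le_abs_self _).trans ((hf.abs_sub_le hK hx hy).trans (mul_le_mul_of_nonneg_left
    (norm_sub_le_of_mem_unitCube (hK.subset_cube hy) (hK.subset_cube hx)) (hf.M_nonneg hK)))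

theorem IsObjective.integrable_comp {M : ℝ} {f : Vec d → ℝ} (hf : IsObjective K M f)
    (hK : IsConstraintSet K) {Ω : Type*} [MeasurableSpace Ω] {P : Measure Ω} [IsFiniteMeasure P]
    {y : Ω → Vec d} (hy : AEMeasurable y P) (hyK : ∀ᵐ ω ∂P, y ω ∈ K) :
    Integrable (fun ω => f (y ω)) P := by
  classical
  have hKm := hK.isClosed.measurableSet
  have hfc : ContinuousOn f K := hf.differentiableOn.continuousOn.mono hK.subset_cube
  have hm : Measurable (K.indicator f) := by
    rw [← Set.piecewise_eq_indicator]
    exact hfc.measurable_piecewise continuousOn_const hKm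
  obtain ⟨b, hb⟩ := hK.isCompact.exists_bound_of_continuousOn hfc
  refine Integrable.of_bound (C := b) ((hm.comp_aemeasurable hy).aestronglyMeasurable.congr ?_) ?_
  · filter_upwards [hyK] with ω hω
    simp [hω]
  · filter_upwards [hyK] with ω hω using hb _ hω

end Domain

/-! ### The block algorithm with truncated feedback -/

/-- The data of the block algorithm on a domain `o + s K ⊆ K`: the gradient estimator of round `t`
answers `resp t η y`, with noise `η` of law `μ t`, and is bounded by `G`. -/
structure IsBlockSetup {d : ℕ} {E : Type*} [MeasurableSpace E] (K : Set (Vec d)) (o : Vec d)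
    (s : ℝ) (T L : ℕ) (G : ℝ) (x₁ : ℕ → Vec d) (μ : ℕ → Measure E)
    (resp : ℕ → E → Vec d → Vec d) : Prop where
  constraint : IsConstraintSet K
  pos : 0 < s
  le_one : s ≤ 1
  subset : ∀ p ∈ K, o + s • p ∈ K
  length_pos : 0 < L
  bound_pos : 0 < G
  init_mem : ∀ i, x₁ i ∈ dom o s K
  measurable : ∀ t < T, Measurable fun p : E × Vec d => resp t p.1 p.2
  bounded : ∀ t < T, ∀ y ∈ dom o s K, ∀ᵐ η ∂μ t, ‖resp t η y‖ ≤ G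

/-- The estimator cut off to `0` where its bound fails and after the last round, so that it is
measurable and bounded everywhere. -/
noncomputable def truncResp {d : ℕ} {E : Type*} (T : ℕ) (G : ℝ) (resp : ℕ → E → Vec d → Vec d)
    (t : ℕ) (η : E) (y : Vec d) : Vec d := by
  classical exact if t < T ∧ ‖resp t η y‖ ≤ G then resp t η y else 0

/-- The nearest point of `[0,1]`. -/
noncomputable def clampUnit (z : ℝ) : ℝ := max 0 (min z 1)

/-- A position in a block, with `0` as the default for positions outside it. -/
def clampPos (L j : ℕ) : ℕ := if j < L then j else 0

theorem clampUnit_mem (z : ℝ) : clampUnit z ∈ Set.Icc (0 : ℝ) 1 :=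
  ⟨le_max_left _ _, max_le zero_le_one (min_le_right _ _)⟩

theorem clampUnit_of_mem {z : ℝ} (hz : z ∈ Set.Icc (0 : ℝ) 1) : clampUnit z = z := by
  rw [clampUnit, min_eq_left hz.2, max_eq_right hz.1]

theorem measurable_clampUnit : Measurable clampUnit := by
  unfold clampUnit; fun_prop

theorem clampPos_lt {L : ℕ} (hL : 0 < L) (j : ℕ) : clampPos L j < L := by
  unfold clampPos; split_ifs <;> assumption

theorem norm_truncResp_le {d : ℕ} {E : Type*} {T : ℕ} {G : ℝ} (hG : 0 ≤ G)
    (resp : ℕ → E → Vec d → Vec d) (t : ℕ) (η : E) (y : Vec d) :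
    ‖truncResp T G resp t η y‖ ≤ G := by
  unfold truncResp
  split_ifs with h
  · exact h.2
  · simpa using hG

section Block

variable {d : ℕ} {E : Type*} {K : Set (Vec d)} {o : Vec d}
  {s : ℝ} {T L : ℕ} {G : ℝ} {x₁ : ℕ → Vec d}
  {resp : ℕ → E → Vec d → Vec d}

/-- The feedback of block `m` in the block algorithm. -/
noncomputable def blockFeedback (o : Vec d) (s : ℝ) (L : ℕ) (resp : ℕ → E → Vec d → Vec d)
    (ω : (ℕ → ℝ × ℕ) × (ℕ → E)) (m : ℕ) : Vec d → Vec d :=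
  bqnd o s (ω.1 m).1 (resp (m * L + (ω.1 m).2) (ω.2 (m * L + (ω.1 m).2)))

/-- The feedback of block `m` with the estimator truncated and the draws clamped to their range, so
that it is bounded for every outcome. -/
noncomputable def truncFeedback (o : Vec d) (s : ℝ) (T L : ℕ) (G : ℝ)
    (resp : ℕ → E → Vec d → Vec d) (ω : (ℕ → ℝ × ℕ) × (ℕ → E)) (m : ℕ) : Vec d → Vec d :=
  blockFeedback o s L (truncResp T G resp)
    (fun q => (clampUnit (ω.1 q).1, clampPos L (ω.1 q).2), ω.2) m

/-- The action in block `q`. -/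
noncomputable def blockAction (K : Set (Vec d)) (o : Vec d) (s : ℝ) (T L : ℕ) (G : ℝ)
    (x₁ : ℕ → Vec d) (resp : ℕ → E → Vec d → Vec d) (ω : (ℕ → ℝ × ℕ) × (ℕ → E)) (q : ℕ) : Vec d :=
  iaAction (dom o s K) ⌈(T : ℝ) / (L : ℝ)⌉₊ G x₁ (blockFeedback o s L resp ω) q

/-- The action in block `q` of the learner with truncated feedback. -/
noncomputable def truncAction (K : Set (Vec d)) (o : Vec d) (s : ℝ) (T L : ℕ) (G : ℝ)
    (x₁ : ℕ → Vec d) (resp : ℕ → E → Vec d → Vec d) (ω : (ℕ → ℝ × ℕ) × (ℕ → E)) (q : ℕ) : Vec d :=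
  iaAction (dom o s K) ⌈(T : ℝ) / (L : ℝ)⌉₊ G x₁ (truncFeedback o s T L G resp ω) q

theorem truncAction_update_block (ω : (ℕ → ℝ × ℕ) × (ℕ → E)) (q : ℕ) (a : ℝ × ℕ) :
    truncAction K o s T L G x₁ resp (Function.update ω.1 q a, ω.2) q
      = truncAction K o s T L G x₁ resp ω q :=
  iaAction_congr fun m hm => by
    simp only [truncFeedback, blockFeedback, Function.update_of_ne hm.ne]

theorem truncAction_update_round (hL : 0 < L) (ω : (ℕ → ℝ × ℕ) × (ℕ → E)) {q t : ℕ}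
    (ht : q * L ≤ t) (b : E) :
    truncAction K o s T L G x₁ resp (ω.1, Function.update ω.2 t b) q
      = truncAction K o s T L G x₁ resp ω q :=
  iaAction_congr fun m hm => by
    have h1 := clampPos_lt hL (ω.1 m).2
    have h2 : (m + 1) * L ≤ q * L := Nat.mul_le_mul_right _ hm
    have h3 : m * L + clampPos L (ω.1 m).2 ≠ t := by
      rw [add_mul] at h2; omega
    simp only [truncFeedback, blockFeedback, Function.update_of_ne h3]

variable [MeasurableSpace E] {μ : ℕ → Measure E}

theorem measurable_truncResp (hm : ∀ t < T, Measurable fun p : E × Vec d => resp t p.1 p.2)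
    (t : ℕ) : Measurable fun p : E × Vec d => truncResp T G resp t p.1 p.2 := by
  by_cases ht : t < T
  · have h := hm t ht
    have : (fun p : E × Vec d => truncResp T G resp t p.1 p.2)
        = {p : E × Vec d | ‖resp t p.1 p.2‖ ≤ G}.indicator fun p => resp t p.1 p.2 := by
      funext p; simp [truncResp, ht, Set.indicator_apply]
    rw [this]
    exact h.indicator (measurableSet_le h.norm measurable_const)
  · have : (fun p : E × Vec d => truncResp T G resp t p.1 p.2) = fun _ => 0 := by
      funext p; simp [truncResp, ht]
    rw [this]; exact measurable_const

theorem measurable_truncFeedback (hm : ∀ t < T, Measurable fun p : E × Vec d => resp t p.1 p.2)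
    (m : ℕ) : Measurable fun p : ((ℕ → ℝ × ℕ) × (ℕ → E)) × Vec d =>
      truncFeedback o s T L G resp p.1 m p.2 := by
  have hk : ∀ k : ℕ, Measurable fun p : ℝ × (ℕ → E) × Vec d =>
      bqnd o s (clampUnit p.1) (truncResp T G resp k (p.2.1 k)) p.2.2 := fun k => by
    have h2 := measurable_bqnd o s (resp := truncResp T G resp k)
      (measurable_truncResp (resp := resp) (G := G) hm k)
    have hz : Measurable fun p : ℝ × (ℕ → E) × Vec d => clampUnit p.1 :=
      measurable_clampUnit.comp measurable_fst
    have hη : Measurable fun p : ℝ × (ℕ → E) × Vec d => p.2.1 k :=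
      (measurable_pi_apply k).comp (measurable_fst.comp measurable_snd)
    have hx : Measurable fun p : ℝ × (ℕ → E) × Vec d => p.2.2 := measurable_snd.comp measurable_snd
    have h3 := hz.prodMk (hη.prodMk hx)
    simpa only [Function.comp_def] using h2.comp h3
  have h1 : Measurable fun p : (ℝ × (ℕ → E) × Vec d) × ℕ =>
      bqnd o s (clampUnit p.1.1) (truncResp T G resp (m * L + clampPos L p.2)
        (p.1.2.1 (m * L + clampPos L p.2))) p.1.2.2 :=
    measurable_from_prod_countable_left fun j => hk (m * L + clampPos L j)
  have h4 : Measurable fun p : ((ℕ → ℝ × ℕ) × (ℕ → E)) × Vec d =>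
      ((((p.1.1 m).1, p.1.2, p.2), (p.1.1 m).2) : (ℝ × (ℕ → E) × Vec d) × ℕ) := by fun_prop
  exact h1.comp h4

namespace IsBlockSetup

variable (H : IsBlockSetup K o s T L G x₁ μ resp)
include H

theorem truncAction_mem (ω : (ℕ → ℝ × ℕ) × (ℕ → E)) (q : ℕ) :
    truncAction K o s T L G x₁ resp ω q ∈ dom o s K :=
  iaAction_mem H.constraint.nonempty_dom H.constraint.isCompact_dom.isClosed
    H.constraint.convex_dom _ _ H.init_mem _ _

theorem blockAction_mem (ω : (ℕ → ℝ × ℕ) × (ℕ → E)) (q : ℕ) :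
    blockAction K o s T L G x₁ resp ω q ∈ dom o s K :=
  iaAction_mem H.constraint.nonempty_dom H.constraint.isCompact_dom.isClosed
    H.constraint.convex_dom _ _ H.init_mem _ _

theorem dom_subset : dom o s K ⊆ K := by
  rintro _ ⟨p, hp, rfl⟩; exact H.subset p hp

theorem measurable_truncAction (q : ℕ) :
    Measurable fun ω => truncAction K o s T L G x₁ resp ω q :=
  measurable_iaAction H.constraint.nonempty_dom H.constraint.isCompact_dom.isClosed
    H.constraint.convex_dom (fun m => measurable_truncFeedback H.measurable m) q

theorem norm_truncFeedback_le (ω : (ℕ → ℝ × ℕ) × (ℕ → E)) (m : ℕ) {x : Vec d}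
    (hx : x ∈ dom o s K) : ‖truncFeedback o s T L G resp ω m x‖ ≤ G :=
  (H.constraint.norm_bqnd_le H.pos.ne' (clampUnit_mem _).1 _ hx).trans
    (norm_truncResp_le H.bound_pos.le _ _ _ _)

variable [∀ t, IsProbabilityMeasure (μ t)]

/-- Truncation does not change the actions, almost surely: the noise at a query is independent of
the query point, so the bound of the estimator holds there. -/
theorem ae_blockAction_eq : ∀ᵐ ω ∂drawLaw L μ, ∀ q, q * L ≤ T →
    blockAction K o s T L G x₁ resp ω q = truncAction K o s T L G x₁ resp ω q := by
  have := isProbabilityMeasure_uniformOn_Iio H.length_pos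
  have hbd : ∀ m j : ℕ, ∀ᵐ ω ∂drawLaw L μ, m * L + j < T →
      ‖resp (m * L + j) (ω.2 (m * L + j)) (hmap o s (clampUnit (ω.1 m).1)
        (truncAction K o s T L G x₁ resp ω m))‖ ≤ G := by
    intro m j
    by_cases ht : m * L + j < T
    swap
    · exact Filter.Eventually.of_forall fun ω h => absurd h ht
    have hz : Measurable fun ω : (ℕ → ℝ × ℕ) × (ℕ → E) => clampUnit (ω.1 m).1 :=
      measurable_clampUnit.comp (by fun_prop)
    have hη : Measurable fun ω : (ℕ → ℝ × ℕ) × (ℕ → E) => ω.2 (m * L + j) :=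
      (measurable_pi_apply (m * L + j)).comp measurable_snd
    have hy := (measurable_hmap o s).comp (hz.prodMk (H.measurable_truncAction m))
    have hpair := hη.prodMk hy
    have hresp := (H.measurable _ ht).comp hpair
    have hS : MeasurableSet {ω : (ℕ → ℝ × ℕ) × (ℕ → E) |
        ‖resp (m * L + j) (ω.2 (m * L + j)) (hmap o s (clampUnit (ω.1 m).1)
          (truncAction K o s T L G x₁ resp ω m))‖ ≤ G} :=
      measurableSet_le hresp.norm measurable_const
    have := ae_resample (measurePreserving_update_round μ (L := L) (m * L + j)) hS fun ω => by
      have hmem := H.constraint.hmap_mem_dom H.pos.ne' (clampUnit_mem (ω.1 m).1)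
        (H.truncAction_mem ω m)
      filter_upwards [H.bounded _ ht _ hmem] with b hb
      rw [truncAction_update_round H.length_pos ω (Nat.le_add_right _ _)]
      simpa using hb
    filter_upwards [this] with ω hω _ using hω
  have hbd' := ae_all_iff.2 fun m => ae_all_iff.2 (hbd m)
  filter_upwards [hbd', ae_drawLaw_mem μ (L := L)] with ω hω hdraw q hq
  refine (iaAction_congr fun m hm => ?_).symm
  have h2 : (m + 1) * L ≤ q * L := Nat.mul_le_mul_right _ hm
  rw [add_mul, one_mul] at h2
  have hj := (hdraw m).2
  have ht : m * L + (ω.1 m).2 < T := by omega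
  have hpos : clampPos L (ω.1 m).2 = (ω.1 m).2 := if_pos hj
  have h3 := hω m (ω.1 m).2 ht
  have hclamp := clampUnit_of_mem (hdraw m).1
  rw [hclamp] at h3
  have h4 : truncResp T G resp (m * L + (ω.1 m).2) (ω.2 (m * L + (ω.1 m).2))
      (hmap o s (ω.1 m).1 (truncAction K o s T L G x₁ resp ω m))
      = resp (m * L + (ω.1 m).2) (ω.2 (m * L + (ω.1 m).2))
      (hmap o s (ω.1 m).1 (truncAction K o s T L G x₁ resp ω m)) := by
    unfold truncResp; rw [if_pos ⟨ht, h3⟩]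
  simp only [truncFeedback, blockFeedback, hpos, hclamp, bqnd]
  simp only [truncAction] at h4
  rw [h4]

end IsBlockSetup
end Block

/-! ### The expected regret of the block algorithm -/

section Expectation

theorem measurable_inner_real {d : ℕ} {α : Type*} [MeasurableSpace α] {g w : α → Vec d}
    (hg : Measurable g) (hw : Measurable w) : Measurable fun a => (inner ℝ (g a) (w a) : ℝ) :=
  hg.inner hw

variable {d : ℕ} {E : Type*} {K : Set (Vec d)} {o : Vec d}
  {s : ℝ} {T L : ℕ} {G : ℝ} {x₁ : ℕ → Vec d}
  {resp : ℕ → E → Vec d → Vec d} [MeasurableSpace E] {μ : ℕ → Measure E}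
  {M ε : ℝ} {f : ℕ → Vec d → ℝ}

namespace IsBlockSetup

/-- The reward in direction `u - x` of the truncated query at `x` in round `t`. -/
noncomputable def truncReward (o : Vec d) (s : ℝ) (T : ℕ) (G : ℝ) (resp : ℕ → E → Vec d → Vec d)
    (u : Vec d) (t : ℕ) (z : ℝ) (b : E) (x : Vec d) : ℝ :=
  inner ℝ (bqnd o s (clampUnit z) (truncResp T G resp t b) x) (u - x)

variable (H : IsBlockSetup K o s T L G x₁ μ resp)
include H

theorem measurable_truncReward (u : Vec d) (t : ℕ) :
    Measurable fun p : ℝ × E × Vec d => truncReward o s T G resp u t p.1 p.2.1 p.2.2 := by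
  have h1 := measurable_bqnd o s (resp := truncResp T G resp t)
    (measurable_truncResp (resp := resp) (G := G) H.measurable t)
  have hz : Measurable fun p : ℝ × E × Vec d => clampUnit p.1 :=
    measurable_clampUnit.comp measurable_fst
  have h2 := h1.comp (hz.prodMk (measurable_snd (α := ℝ) (β := E × Vec d)))
  have hx : Measurable fun p : ℝ × E × Vec d => p.2.2 := measurable_snd.comp measurable_snd
  have h3 := measurable_inner_real h2 ((measurable_const (a := u)).sub hx)
  simpa only [Function.comp_def, Pi.sub_apply, truncReward] using h3

theorem abs_truncReward_le {u : Vec d} (hu : u ∈ dom o s K) (t : ℕ) (z : ℝ) (b : E) {x : Vec d}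
    (hx : x ∈ dom o s K) :
    |truncReward o s T G resp u t z b x| ≤ G * Metric.diam (dom o s K) := by
  refine (abs_real_inner_le_norm _ _).trans (mul_le_mul ?_ ?_ (norm_nonneg _) H.bound_pos.le)
  · exact (H.constraint.norm_bqnd_le H.pos.ne' (clampUnit_mem _).1 _ hx).trans
      (norm_truncResp_le H.bound_pos.le _ _ _ _)
  · rw [← dist_eq_norm]
    exact Metric.dist_le_diam_of_mem H.constraint.isCompact_dom.isBounded hu hx

variable [∀ t, IsProbabilityMeasure (μ t)]

/-- Conditionally on the action `x`, the expected reward of a query in round `t` bounds the gap. -/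
theorem gap_le_integral_truncReward
    (hgap : ∀ t < T, ∀ x ∈ dom o s K, ∀ u ∈ dom o s K,
      f t u / Real.exp 1 - f t (hmap o s 1 x) ≤ (1 - Real.exp (-1)) *
        (∫ z, ∫ η, inner ℝ (bqnd o s z (resp t η) x) (u - x) ∂μ t ∂zLaw) + ε)
    {t : ℕ} (ht : t < T) {x u : Vec d} (hx : x ∈ dom o s K) (hu : u ∈ dom o s K) :
    f t u / Real.exp 1 - f t (hmap o s 1 x) - ε ≤ (1 - Real.exp (-1)) *
        ∫ b, ∫ z, truncReward o s T G resp u t z b x ∂zLaw ∂μ t := by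
  have hm : Measurable fun p : ℝ × E => truncReward o s T G resp u t p.1 p.2 x := by
    have h1 : Measurable fun p : ℝ × E => (p.1, p.2, x) := by fun_prop
    simpa only [Function.comp_def] using (H.measurable_truncReward u t).comp h1
  have hswap : ∫ b, ∫ z, truncReward o s T G resp u t z b x ∂zLaw ∂μ t
      = ∫ z, ∫ b, truncReward o s T G resp u t z b x ∂μ t ∂zLaw :=
    (integral_integral_swap (f := fun z b => truncReward o s T G resp u t z b x)
      (integrable_of_measurable_of_bound hm fun p => H.abs_truncReward_le hu t p.1 p.2 hx)).symm
  have hcongr : ∫ z, ∫ b, truncReward o s T G resp u t z b x ∂μ t ∂zLaw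
      = ∫ z, ∫ η, inner ℝ (bqnd o s z (resp t η) x) (u - x) ∂μ t ∂zLaw := by
    refine integral_congr_ae ?_
    filter_upwards [ae_zLaw_mem] with z hz
    refine integral_congr_ae ?_
    filter_upwards [H.bounded t ht _ (H.constraint.hmap_mem_dom H.pos.ne' hz hx)] with b hb
    have : truncResp T G resp t b (hmap o s z x) = resp t b (hmap o s z x) := by
      unfold truncResp; rw [if_pos ⟨ht, hb⟩]
    simp only [truncReward, clampUnit_of_mem hz, bqnd, this]
  rw [hswap, hcongr]
  linarith [hgap t ht x hx u hu]

/-- In a full block the query round is uniform among the rounds of the block and independent of the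
action, so the expected reward of the feedback bounds the average gap over the block. -/
theorem sum_gap_le_integral_inner (hf : ∀ t < T, IsObjective K M (f t))
    (hgap : ∀ t < T, ∀ x ∈ dom o s K, ∀ u ∈ dom o s K,
      f t u / Real.exp 1 - f t (hmap o s 1 x) ≤ (1 - Real.exp (-1)) *
        (∫ z, ∫ η, inner ℝ (bqnd o s z (resp t η) x) (u - x) ∂μ t ∂zLaw) + ε)
    {q : ℕ} (hq : (q + 1) * L ≤ T) {u : Vec d} (hu : u ∈ dom o s K) :
    ∑ j ∈ Finset.range L, (f (q * L + j) u / Real.exp 1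
        - (∫ ω, f (q * L + j) (hmap o s 1 (truncAction K o s T L G x₁ resp ω q)) ∂drawLaw L μ) - ε)
      ≤ (1 - Real.exp (-1)) * (L * ∫ ω, inner ℝ
          (truncFeedback o s T L G resp ω q (truncAction K o s T L G x₁ resp ω q))
          (u - truncAction K o s T L G x₁ resp ω q) ∂drawLaw L μ) := by
  have hUprob := isProbabilityMeasure_uniformOn_Iio H.length_pos
  have hL' : (0 : ℝ) < L := Nat.cast_pos.2 H.length_pos
  set P := drawLaw L μ with hP
  set x := fun ω => truncAction K o s T L G x₁ resp ω q with hx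
  have hxm : Measurable x := H.measurable_truncAction q
  have hxd : ∀ ω, x ω ∈ dom o s K := fun ω => H.truncAction_mem ω q
  set b₀ := G * Metric.diam (dom o s K) with hb₀
  set ψ := fun j => truncReward o s T G resp u (q * L + j) with hψ
  have hψm : ∀ j, Measurable fun p : ℝ × E × Vec d => ψ j p.1 p.2.1 p.2.2 := fun j =>
    H.measurable_truncReward u (q * L + j)
  have hψb : ∀ j z b ω, |ψ j z b (x ω)| ≤ b₀ := fun j z b ω =>
    H.abs_truncReward_le hu _ z b (hxd ω)
  set κ : ℕ → E → Vec d → ℝ := fun j b y => ∫ z, ψ j z b y ∂zLaw with hκ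
  have hκm : ∀ j, Measurable fun p : E × Vec d => κ j p.1 p.2 := fun j =>
    ((hψm j).stronglyMeasurable.integral_prod_left (μ := zLaw)).measurable
  have hκb : ∀ j b ω, |κ j b (x ω)| ≤ b₀ := fun j b ω => by
    simpa using norm_integral_le_of_norm_le_const (μ := zLaw) (f := fun z => ψ j z b (x ω)) (C := b₀)
      (Filter.Eventually.of_forall fun z => hψb j z b ω)
  have hHe : ∀ ω, inner ℝ (truncFeedback o s T L G resp ω q (x ω)) (u - x ω)
      = ψ (clampPos L (ω.1 q).2) (ω.1 q).1 (ω.2 (q * L + clampPos L (ω.1 q).2)) (x ω) :=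
    fun ω => rfl
  have hHm : Measurable fun ω => inner ℝ (truncFeedback o s T L G resp ω q (x ω)) (u - x ω) := by
    have h1 := (measurable_truncFeedback (o := o) (s := s) (L := L) (resp := resp) (G := G)
      H.measurable q).comp (measurable_id.prodMk hxm)
    have h2 := measurable_inner_real h1 ((measurable_const (a := u)).sub hxm)
    simpa only [Function.comp_def, Pi.sub_apply, id] using h2
  -- Averaging over the draws `(z, j)` of the block, on which the action does not depend.
  have hstep1 : ∫ ω, inner ℝ (truncFeedback o s T L G resp ω q (x ω)) (u - x ω) ∂P
      = ∫ ω, (L : ℝ)⁻¹ * ∑ j ∈ Finset.range L, κ j (ω.2 (q * L + j)) (x ω) ∂P := by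
    rw [integral_resample (measurePreserving_update_block μ q) hHm
      (b := b₀) fun ω => by rw [hHe]; exact hψb _ _ _ _]
    refine integral_congr_ae (Filter.Eventually.of_forall fun ω => ?_)
    have h1 : ∀ a : ℝ × ℕ, inner ℝ (truncFeedback o s T L G resp (Function.update ω.1 q a, ω.2) q
        (x (Function.update ω.1 q a, ω.2))) (u - x (Function.update ω.1 q a, ω.2))
        = ψ (clampPos L a.2) a.1 (ω.2 (q * L + clampPos L a.2)) (x ω) := fun a => by
      rw [hHe]
      simp only [hx, truncAction_update_block, Function.update_self]
    simp only [h1]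
    have h2 : Measurable fun a : ℝ × ℕ =>
        ψ (clampPos L a.2) a.1 (ω.2 (q * L + clampPos L a.2)) (x ω) := by
      refine measurable_from_prod_countable_left fun j => ?_
      have h3 : Measurable fun z : ℝ => (z, ω.2 (q * L + clampPos L j), x ω) :=
        measurable_id.prodMk measurable_const
      have h4 := (hψm (clampPos L j)).comp h3
      simpa only [Function.comp_def] using h4
    rw [integral_prod_symm _ (integrable_of_measurable_of_bound h2 fun a => hψb _ _ _ _),
      integral_uniformOn_Iio]
    congr 1
    refine Finset.sum_congr rfl fun j hj => ?_
    have : clampPos L j = j := if_pos (Finset.mem_range.1 hj)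
    simp only [this, hκ]
  have hκi : ∀ j, Integrable (fun ω => κ j (ω.2 (q * L + j)) (x ω)) P := fun j => by
    have h1 : Measurable fun ω : (ℕ → ℝ × ℕ) × (ℕ → E) => ω.2 (q * L + j) :=
      (measurable_pi_apply (q * L + j)).comp measurable_snd
    have h2 := (hκm j).comp (h1.prodMk hxm)
    exact integrable_of_measurable_of_bound h2 fun ω => hκb _ _ _
  have hstep2 : ∀ j, ∫ ω, κ j (ω.2 (q * L + j)) (x ω) ∂P
      = ∫ ω, ∫ b, κ j b (x ω) ∂μ (q * L + j) ∂P := fun j => by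
    have h1 : Measurable fun ω : (ℕ → ℝ × ℕ) × (ℕ → E) => ω.2 (q * L + j) :=
      (measurable_pi_apply (q * L + j)).comp measurable_snd
    have h2 := (hκm j).comp (h1.prodMk hxm)
    simp only [Function.comp_def] at h2
    rw [integral_resample (measurePreserving_update_round μ (q * L + j)) h2
      (b := b₀) fun ω => hκb _ _ _]
    simp only [hx, truncAction_update_round H.length_pos _ (Nat.le_add_right _ _),
      Function.update_self]
    rw [hP]
  rw [hstep1, integral_const_mul, integral_finsetSum _ fun j _ => hκi j, ← mul_assoc (L : ℝ),
    mul_inv_cancel₀ hL'.ne', one_mul, Finset.mul_sum]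
  refine Finset.sum_le_sum fun j hj => ?_
  have ht : q * L + j < T := by
    have := Finset.mem_range.1 hj
    rw [add_mul] at hq
    omega
  rw [hstep2]
  have hyK : ∀ ω, hmap o s 1 (x ω) ∈ K := fun ω =>
    H.dom_subset (H.constraint.hmap_mem_dom H.pos.ne' (by simp) (hxd ω))
  have hym : Measurable fun ω => hmap o s 1 (x ω) := by
    have := (measurable_hmap o s).comp ((measurable_const (a := (1 : ℝ))).prodMk hxm)
    simpa only [Function.comp_def] using this
  have hfi : Integrable (fun ω => f (q * L + j) (hmap o s 1 (x ω))) P :=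
    (hf _ ht).integrable_comp H.constraint hym.aemeasurable (Filter.Eventually.of_forall hyK)
  have hκ2 : Integrable (fun ω => ∫ b, κ j b (x ω) ∂μ (q * L + j)) P := by
    have h1 : Measurable fun p : ((ℕ → ℝ × ℕ) × (ℕ → E)) × E => κ j p.2 (x p.1) := by
      have := (hκm j).comp ((measurable_snd).prodMk (hxm.comp (measurable_fst (β := E))))
      simpa only [Function.comp_def] using this
    refine integrable_of_measurable_of_bound
      (h1.stronglyMeasurable.integral_prod_right (ν := μ (q * L + j))).measurable (b := b₀)
      fun ω => ?_
    simpa using norm_integral_le_of_norm_le_const (μ := μ (q * L + j))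
      (f := fun b => κ j b (x ω)) (C := b₀)
      (Filter.Eventually.of_forall fun b => hκb j b ω)
  calc f (q * L + j) u / Real.exp 1 - (∫ ω, f (q * L + j) (hmap o s 1 (x ω)) ∂P) - ε
      = ∫ ω, (f (q * L + j) u / Real.exp 1 - ε - f (q * L + j) (hmap o s 1 (x ω))) ∂P := by
        rw [integral_sub (integrable_const _) hfi]
        simp only [integral_const, probReal_univ, one_smul]
        ring
    _ ≤ ∫ ω, (1 - Real.exp (-1)) * ∫ b, κ j b (x ω) ∂μ (q * L + j) ∂P := by
        refine integral_mono ((integrable_const _).sub hfi) (hκ2.const_mul _) fun ω => ?_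
        have := H.gap_le_integral_truncReward hgap ht (hxd ω) hu
        simp only [hκ, hψ]
        linarith
    _ = _ := integral_const_mul _ _

end IsBlockSetup
end Expectation

/-! ### Summation over blocks -/

section Blocks

theorem sum_range_mul_eq {A : Type*} [AddCommMonoid A] (g : ℕ → A) (Q L : ℕ) :
    ∑ t ∈ Finset.range (Q * L), g t
      = ∑ q ∈ Finset.range Q, ∑ j ∈ Finset.range L, g (q * L + j) := by
  induction Q with
  | zero => simp
  | succ Q ih => rw [add_mul, one_mul, Finset.sum_range_add, ih, Finset.sum_range_succ]

variable {V : Type*} [NormedAddCommGroup V]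

theorem norm_sub_le_sum_steps (w : ℕ → V) (a j : ℕ) :
    ‖w (a + j) - w a‖ ≤ ∑ i ∈ Finset.range j, ‖w (a + i + 1) - w (a + i)‖ := by
  have h := dist_le_range_sum_dist (fun i => w (a + i)) j
  simp only [dist_eq_norm, add_zero] at h
  rw [norm_sub_rev]
  refine h.trans (le_of_eq (Finset.sum_congr rfl fun i _ => ?_))
  rw [norm_sub_rev, add_assoc]

theorem sum_norm_block_step_le (w : ℕ → V) (Q L : ℕ) :
    ∑ q ∈ Finset.range Q, ‖w ((q + 1) * L) - w (q * L)‖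
      ≤ ∑ t ∈ Finset.range (Q * L), ‖w (t + 1) - w t‖ := by
  rw [sum_range_mul_eq]
  refine Finset.sum_le_sum fun q _ => ?_
  rw [add_mul, one_mul]
  exact norm_sub_le_sum_steps w (q * L) L

/-- Within blocks a sequence of bounded diameter `D` deviates from its values at the block starts
by at most `L √(Q D P)` in total: in each block the deviation is at most `min D P_q ≤ √(D P_q)`,
where `P_q` is the path length in the block. -/
theorem sum_norm_sub_block_start_le {w : ℕ → V} {D : ℝ} (hD : ∀ a b, ‖w a - w b‖ ≤ D) (Q L : ℕ) :
    ∑ q ∈ Finset.range Q, ∑ j ∈ Finset.range L, ‖w (q * L + j) - w (q * L)‖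
      ≤ L * Real.sqrt (Q * (D * ∑ t ∈ Finset.range (Q * L), ‖w (t + 1) - w t‖)) := by
  have hD0 : 0 ≤ D := (norm_nonneg _).trans (hD 0 0)
  set p : ℕ → ℝ := fun q => ∑ i ∈ Finset.range L, ‖w (q * L + i + 1) - w (q * L + i)‖ with hp
  have hp0 : ∀ q, 0 ≤ p q := fun q => Finset.sum_nonneg fun _ _ => norm_nonneg _
  have h1 : ∀ q, ∑ j ∈ Finset.range L, ‖w (q * L + j) - w (q * L)‖ ≤ L * Real.sqrt (D * p q) := by
    intro q
    calc _ ≤ ∑ _j ∈ Finset.range L, Real.sqrt (D * p q) := by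
          refine Finset.sum_le_sum fun j hj => Real.le_sqrt_of_sq_le ?_
          have h2 : ‖w (q * L + j) - w (q * L)‖ ≤ p q :=
            (norm_sub_le_sum_steps w (q * L) j).trans
              (Finset.sum_le_sum_of_subset_of_nonneg
                (Finset.range_subset_range.2 (Finset.mem_range.1 hj).le)
                fun _ _ _ => norm_nonneg _)
          rw [sq]
          exact mul_le_mul (hD _ _) h2 (norm_nonneg _) hD0
      _ = _ := by simp
  have h2 : ∑ q ∈ Finset.range Q, Real.sqrt (D * p q)
      ≤ Real.sqrt (Q * (D * ∑ q ∈ Finset.range Q, p q)) := by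
    refine Real.le_sqrt_of_sq_le ?_
    have h3 := sq_sum_le_card_mul_sum_sq (s := Finset.range Q) (f := fun q => Real.sqrt (D * p q))
    rw [Finset.card_range] at h3
    refine h3.trans (le_of_eq ?_)
    congr 1
    rw [Finset.mul_sum]
    exact Finset.sum_congr rfl fun q _ => Real.sq_sqrt (mul_nonneg hD0 (hp0 q))
  rw [sum_range_mul_eq]
  calc _ ≤ ∑ q ∈ Finset.range Q, L * Real.sqrt (D * p q) := Finset.sum_le_sum fun q _ => h1 q
    _ = L * ∑ q ∈ Finset.range Q, Real.sqrt (D * p q) := (Finset.mul_sum _ _ _).symm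
    _ ≤ _ := mul_le_mul_of_nonneg_left h2 (Nat.cast_nonneg L)

theorem sum_norm_step_min_le {d : ℕ} (T : ℕ) (u : ℕ → Vec d) (m : ℕ) :
    ∑ t ∈ Finset.range m, ‖u (min (t + 1) (T - 1)) - u (min t (T - 1))‖ ≤ pathLength T u := by
  have h1 : ∀ t, ‖u (min (t + 1) (T - 1)) - u (min t (T - 1))‖
      = if t < T - 1 then ‖u (t + 1) - u t‖ else 0 := by
    intro t
    split_ifs with h
    · rw [min_eq_left (Nat.succ_le_of_lt h), min_eq_left h.le]
    · push Not at h
      rw [min_eq_right h, min_eq_right (h.trans (Nat.le_succ t)), sub_self, norm_zero]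
  simp only [h1]
  rw [← Finset.sum_filter]
  refine Finset.sum_le_sum_of_subset_of_nonneg (fun t ht => ?_) fun _ _ _ => norm_nonneg _
  exact Finset.mem_range.2 (Finset.mem_filter.1 ht).2

end Blocks

section Regret

variable {d : ℕ} {E : Type*} {K : Set (Vec d)} {o : Vec d}
  {s : ℝ} {T L : ℕ} {G : ℝ} {x₁ : ℕ → Vec d}
  {resp : ℕ → E → Vec d → Vec d} [MeasurableSpace E] {μ : ℕ → Measure E}
  {M ε κ : ℝ} {f : ℕ → Vec d → ℝ} {u : ℕ → Vec d}

theorem div_le_ceil_div (T L : ℕ) : T / L ≤ ⌈(T : ℝ) / (L : ℝ)⌉₊ := by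
  have h1 : ((T / L : ℕ) : ℝ) ≤ (T : ℝ) / L := Nat.cast_div_le
  exact_mod_cast h1.trans (Nat.le_ceil _)

namespace IsBlockSetup

variable (H : IsBlockSetup K o s T L G x₁ μ resp)
include H

theorem measurable_hmap_truncAction (q : ℕ) :
    Measurable fun ω => hmap o s 1 (truncAction K o s T L G x₁ resp ω q) := by
  have := (measurable_hmap o s).comp
    ((measurable_const (a := (1 : ℝ))).prodMk (H.measurable_truncAction q))
  simpa only [Function.comp_def] using this

theorem hmap_truncAction_mem (ω : (ℕ → ℝ × ℕ) × (ℕ → E)) (q : ℕ) :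
    hmap o s 1 (truncAction K o s T L G x₁ resp ω q) ∈ K :=
  H.dom_subset (H.constraint.hmap_mem_dom H.pos.ne' (by simp) (H.truncAction_mem ω q))

variable [∀ t, IsProbabilityMeasure (μ t)]

/-- The expected linear regret over the full blocks. The last block, if it is incomplete, is left out:
its query may fall beyond the horizon. -/
theorem sum_integral_inner_le (hT : 1 ≤ T) {v : ℕ → Vec d} (hv : ∀ q, v q ∈ dom o s K) :
    ∑ q ∈ Finset.range (T / L), ∫ ω, inner ℝ
          (truncFeedback o s T L G resp ω q (truncAction K o s T L G x₁ resp ω q))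
          (v q - truncAction K o s T L G x₁ resp ω q) ∂drawLaw L μ
      ≤ (2 * iaNum ⌈(T : ℝ) / (L : ℝ)⌉₊ + 8) * (G * Real.sqrt (⌈(T : ℝ) / (L : ℝ)⌉₊ *
          (Metric.diam (dom o s K) ^ 2 + Metric.diam (dom o s K) *
            ∑ q ∈ Finset.range (T / L), ‖v (q + 1) - v q‖))) := by
  have hUprob := isProbabilityMeasure_uniformOn_Iio H.length_pos
  have hb := (H.constraint.isCompact_dom (o := o) (s := s)).isBounded
  have hm : ∀ q, Measurable fun ω => (inner ℝ
      (truncFeedback o s T L G resp ω q (truncAction K o s T L G x₁ resp ω q))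
      (v q - truncAction K o s T L G x₁ resp ω q) : ℝ) := fun q => by
    have h1 := (measurable_truncFeedback (o := o) (s := s) (L := L) (resp := resp) (G := G)
      H.measurable q).comp (measurable_id.prodMk (H.measurable_truncAction q))
    have h2 := measurable_inner_real h1
      ((measurable_const (a := v q)).sub (H.measurable_truncAction q))
    simpa only [Function.comp_def, Pi.sub_apply, id] using h2
  have hi : ∀ q, Integrable (fun ω => (inner ℝ
      (truncFeedback o s T L G resp ω q (truncAction K o s T L G x₁ resp ω q))
      (v q - truncAction K o s T L G x₁ resp ω q) : ℝ)) (drawLaw L μ) := fun q => by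
    refine integrable_of_measurable_of_bound (hm q) (b := G * Metric.diam (dom o s K)) fun ω => ?_
    refine (abs_real_inner_le_norm _ _).trans (mul_le_mul
      (H.norm_truncFeedback_le ω q (H.truncAction_mem ω q)) ?_ (norm_nonneg _) H.bound_pos.le)
    rw [← dist_eq_norm]
    exact Metric.dist_le_diam_of_mem hb (hv q) (H.truncAction_mem ω q)
  rw [← integral_finsetSum _ fun q _ => hi q]
  have hn : 0 < ⌈(T : ℝ) / (L : ℝ)⌉₊ := Nat.ceil_pos.2
    (div_pos (Nat.cast_pos.2 hT) (Nat.cast_pos.2 H.length_pos))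
  have hpath : ∀ ω, ∑ q ∈ Finset.range (T / L), (inner ℝ
      (truncFeedback o s T L G resp ω q (truncAction K o s T L G x₁ resp ω q))
      (v q - truncAction K o s T L G x₁ resp ω q) : ℝ) ≤ _ := fun ω =>
    sum_inner_sub_iaAction_le H.constraint.nonempty_dom H.constraint.isCompact_dom.isClosed
      H.constraint.convex_dom hb (H.constraint.diam_dom_pos H.pos.ne') hn H.bound_pos H.init_mem
      (div_le_ceil_div T L) (fb := truncFeedback o s T L G resp ω)
      (fun q _ => H.norm_truncFeedback_le ω q (H.truncAction_mem ω q)) hv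
  have := integral_mono (μ := drawLaw L μ) (integrable_finsetSum _ fun q _ => hi q)
    (integrable_const _) hpath
  simpa using this

/-- The expected regret of playing `h(x)` in every round, where `x` is the action of the block. -/
theorem sum_gap_le (hT : 1 ≤ T) (hf : ∀ t < T, IsObjective K M (f t)) (hε : 0 ≤ ε)
    (hgap : ∀ t < T, ∀ x ∈ dom o s K, ∀ u ∈ dom o s K,
      f t u / Real.exp 1 - f t (hmap o s 1 x) ≤ (1 - Real.exp (-1)) *
        (∫ z, ∫ η, inner ℝ (bqnd o s z (resp t η) x) (u - x) ∂μ t ∂zLaw) + ε)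
    (hu : ∀ t < T, u t ∈ K) (hκ : ∀ p ∈ K, ‖p - (o + s • p)‖ ≤ κ) :
    ∑ t ∈ Finset.range T, (f t (u t) / Real.exp 1
        - ∫ ω, f t (hmap o s 1 (blockAction K o s T L G x₁ resp ω (t / L))) ∂drawLaw L μ)
      ≤ L * ((2 * iaNum ⌈(T : ℝ) / (L : ℝ)⌉₊ + 8) * (G * Real.sqrt (⌈(T : ℝ) / (L : ℝ)⌉₊ *
          (Metric.diam (dom o s K) ^ 2 + Metric.diam (dom o s K) * pathLength T u))))
        + T * ε + M * (L * Real.sqrt (⌈(T : ℝ) / (L : ℝ)⌉₊ * (Real.sqrt d * pathLength T u))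
        + T * κ) + L * (M * Real.sqrt d) := by
  have hUprob := isProbabilityMeasure_uniformOn_Iio H.length_pos
  have hK := H.constraint
  have hM : 0 ≤ M := (hf 0 hT).M_nonneg hK
  have hκ0 : 0 ≤ κ := (norm_nonneg _).trans (hκ 0 hK.zero_mem)
  set n := ⌈(T : ℝ) / (L : ℝ)⌉₊ with hn
  set Q := T / L with hQ
  set P := drawLaw L μ with hP
  set D := Metric.diam (dom o s K) with hD
  have hD0 : 0 ≤ D := Metric.diam_nonneg
  have hQn : (Q : ℝ) ≤ n := by exact_mod_cast div_le_ceil_div T L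
  have hPL : 0 ≤ pathLength T u := Finset.sum_nonneg fun _ _ => norm_nonneg _
  set y : ((ℕ → ℝ × ℕ) × (ℕ → E)) → ℕ → Vec d :=
    fun ω q => hmap o s 1 (truncAction K o s T L G x₁ resp ω q) with hy
  have hyi : ∀ t < T, ∀ q, Integrable (fun ω => f t (y ω q)) P := fun t ht q =>
    (hf t ht).integrable_comp hK (H.measurable_hmap_truncAction q).aemeasurable
      (Filter.Eventually.of_forall fun ω => H.hmap_truncAction_mem ω q)
  -- The truncated learner plays the same actions.
  have hrepl : ∀ t < T, ∫ ω, f t (hmap o s 1 (blockAction K o s T L G x₁ resp ω (t / L))) ∂P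
      = ∫ ω, f t (y ω (t / L)) ∂P := fun t ht => by
    refine integral_congr_ae ?_
    filter_upwards [H.ae_blockAction_eq] with ω hω
    rw [hω _ ((Nat.div_mul_le_self t L).trans ht.le)]
  set g : ℕ → ℝ := fun t => f t (u t) / Real.exp 1 - ∫ ω, f t (y ω (t / L)) ∂P with hg
  have hsum : ∑ t ∈ Finset.range T, (f t (u t) / Real.exp 1
        - ∫ ω, f t (hmap o s 1 (blockAction K o s T L G x₁ resp ω (t / L))) ∂P)
      = ∑ t ∈ Finset.range T, g t :=
    Finset.sum_congr rfl fun t ht => by rw [hrepl t (Finset.mem_range.1 ht)]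
  rw [hsum]
  have he1 : 1 ≤ Real.exp 1 := Real.one_le_exp zero_le_one
  have hdiv : ∀ a : ℝ, 0 ≤ a → a / Real.exp 1 ≤ a := fun a ha => div_le_self ha he1
  -- A single round costs at most `M √d`; this is used for the incomplete last block.
  have hround : ∀ t < T, g t ≤ M * Real.sqrt d := fun t ht => by
    have h1 : f t (u t) / Real.exp 1 ≤ f t (u t) :=
      hdiv _ ((hf t ht).nonneg _ (hK.subset_cube (hu t ht)))
    have h2 : ∫ _ω, (f t (u t) - M * Real.sqrt d) ∂P ≤ ∫ ω, f t (y ω (t / L)) ∂P :=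
      integral_mono (integrable_const _) (hyi t ht _) fun ω => by
        have := (hf t ht).sub_le_of_mem hK (H.hmap_truncAction_mem ω (t / L)) (hu t ht)
        simp only [hy]; linarith
    simp only [integral_const, probReal_univ, one_smul] at h2
    simp only [hg]; linarith
  have hsplit : ∑ t ∈ Finset.range T, g t
      = (∑ q ∈ Finset.range Q, ∑ j ∈ Finset.range L, g (q * L + j))
        + ∑ j ∈ Finset.range (T % L), g (Q * L + j) := by
    rw [← sum_range_mul_eq, ← Finset.sum_range_add]
    congr 2
    rw [hQ, Nat.div_add_mod']
  have hQL : Q * L ≤ T := Nat.div_mul_le_self T L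
  have hrest : ∑ j ∈ Finset.range (T % L), g (Q * L + j) ≤ L * (M * Real.sqrt d) := by
    calc _ ≤ ∑ _j ∈ Finset.range (T % L), M * Real.sqrt d := by
          refine Finset.sum_le_sum fun j hj => hround _ ?_
          have h1 := Finset.mem_range.1 hj
          have h2 := Nat.div_add_mod' T L
          rw [← hQ] at h2
          omega
      _ = (T % L : ℕ) * (M * Real.sqrt d) := by simp
      _ ≤ L * (M * Real.sqrt d) := by
          have : ((T % L : ℕ) : ℝ) ≤ L := by
            exact_mod_cast (Nat.mod_lt T H.length_pos).le
          gcongr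
  -- The comparator of a block is the image of the maximiser of its first round.
  -- Beyond the horizon the sequence is continued by its last value, so as not to add to the path.
  set w : ℕ → Vec d := fun t => u (min t (T - 1)) with hw
  have hwK : ∀ t, w t ∈ K := fun t => hu _ (by have := min_le_right t (T - 1); omega)
  set v : ℕ → Vec d := fun q => o + s • w (q * L) with hv
  have hvd : ∀ q, v q ∈ dom o s K := fun q => ⟨_, hwK _, rfl⟩
  have hwcube : ∀ a b, ‖w a - w b‖ ≤ Real.sqrt d := fun a b =>
    norm_sub_le_of_mem_unitCube (hK.subset_cube (hwK a)) (hK.subset_cube (hwK b))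
  have hwpath : ∑ t ∈ Finset.range (Q * L), ‖w (t + 1) - w t‖ ≤ pathLength T u :=
    sum_norm_step_min_le T u (Q * L)
  have hvpath : ∑ q ∈ Finset.range Q, ‖v (q + 1) - v q‖ ≤ pathLength T u := by
    refine le_trans ?_ ((sum_norm_block_step_le w Q L).trans hwpath)
    refine Finset.sum_le_sum fun q _ => ?_
    have : v (q + 1) - v q = s • (w ((q + 1) * L) - w (q * L)) := by simp only [hv]; module
    rw [this, norm_smul, Real.norm_of_nonneg H.pos.le]
    exact mul_le_of_le_one_left (norm_nonneg _) H.le_one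
  set I : ℕ → ℝ := fun q => ∫ ω, inner ℝ
          (truncFeedback o s T L G resp ω q (truncAction K o s T L G x₁ resp ω q))
          (v q - truncAction K o s T L G x₁ resp ω q) ∂P with hI
  have hblock : ∀ q < Q, ∑ j ∈ Finset.range L, g (q * L + j) ≤ (1 - Real.exp (-1)) * (L * I q)
      + ∑ j ∈ Finset.range L, (ε + M * (‖w (q * L + j) - w (q * L)‖ + κ)) := by
    intro q hq
    have hq' : (q + 1) * L ≤ T := (Nat.mul_le_mul_right L hq).trans hQL
    refine le_trans ?_ (add_le_add_left (H.sum_gap_le_integral_inner hf hgap hq' (hvd q)) _)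
    rw [← Finset.sum_add_distrib]
    refine Finset.sum_le_sum fun j hj => ?_
    have hj' := Finset.mem_range.1 hj
    have ht : q * L + j < T := by rw [add_mul] at hq'; omega
    have hdivq : (q * L + j) / L = q := by
      rw [mul_comm, Nat.mul_add_div H.length_pos, Nat.div_eq_of_lt hj', add_zero]
    have hwt : w (q * L + j) = u (q * L + j) := by
      simp only [hw]; rw [min_eq_left (by omega)]
    have h1 := (hf _ ht).abs_sub_le hK (H.dom_subset (hvd q)) (hu _ ht)
    have h2 : ‖u (q * L + j) - v q‖ ≤ ‖w (q * L + j) - w (q * L)‖ + κ := by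
      have : u (q * L + j) - v q = (w (q * L + j) - w (q * L)) + (w (q * L) - v q) := by
        rw [hwt]; abel
      rw [this]
      exact (norm_add_le _ _).trans (add_le_add_right (hκ _ (hwK _)) _)
    have h3 : f (q * L + j) (u (q * L + j)) / Real.exp 1 - f (q * L + j) (v q) / Real.exp 1
        ≤ M * (‖w (q * L + j) - w (q * L)‖ + κ) := by
      rw [← sub_div]
      calc _ ≤ |f (q * L + j) (u (q * L + j)) - f (q * L + j) (v q)| / Real.exp 1 := by
            gcongr; exact le_abs_self _
        _ ≤ |f (q * L + j) (u (q * L + j)) - f (q * L + j) (v q)| := hdiv _ (abs_nonneg _)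
        _ ≤ _ := h1.trans (mul_le_mul_of_nonneg_left h2 hM)
    simp only [hg, hdivq, hy]
    linarith
  have hreg := H.sum_integral_inner_le hT hvd
  have hfull := Finset.sum_le_sum fun q hq => hblock q (Finset.mem_range.1 hq)
  rw [Finset.sum_add_distrib, ← Finset.mul_sum, ← Finset.mul_sum] at hfull
  set R := (2 * (iaNum n : ℝ) + 8) * (G * Real.sqrt (n * (D ^ 2 + D * pathLength T u))) with hR
  have hG := H.bound_pos
  have hR0 : 0 ≤ R := by positivity
  have hIR : ∑ q ∈ Finset.range Q, I q ≤ R := by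
    refine hreg.trans ?_
    simp only [hR]
    gcongr
  have hexp : 0 ≤ 1 - Real.exp (-1) := one_sub_exp_neg_one_pos.le
  have hexp1 : 1 - Real.exp (-1) ≤ 1 := by linarith [Real.exp_pos (-1)]
  have hlin : (1 - Real.exp (-1)) * (L * ∑ q ∈ Finset.range Q, I q) ≤ L * R := by
    calc _ ≤ (1 - Real.exp (-1)) * (L * R) := by gcongr
      _ ≤ L * R := mul_le_of_le_one_left (by positivity) hexp1
  have herr : ∑ q ∈ Finset.range Q, ∑ j ∈ Finset.range L,
      (ε + M * (‖w (q * L + j) - w (q * L)‖ + κ))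
      ≤ T * ε + M * (L * Real.sqrt (n * (Real.sqrt d * pathLength T u)) + T * κ) := by
    have h1 := sum_norm_sub_block_start_le hwcube Q L
    have h2 : Real.sqrt (Q * (Real.sqrt d * ∑ t ∈ Finset.range (Q * L), ‖w (t + 1) - w t‖))
        ≤ Real.sqrt (n * (Real.sqrt d * pathLength T u)) := by
      refine Real.sqrt_le_sqrt (mul_le_mul hQn ?_ ?_ (Nat.cast_nonneg n))
      · exact mul_le_mul_of_nonneg_left hwpath (Real.sqrt_nonneg _)
      · exact mul_nonneg (Real.sqrt_nonneg _) (Finset.sum_nonneg fun _ _ => norm_nonneg _)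
    have h3 : (Q : ℝ) * L ≤ T := by exact_mod_cast hQL
    have h4 : ∑ q ∈ Finset.range Q, ∑ j ∈ Finset.range L,
        (ε + M * (‖w (q * L + j) - w (q * L)‖ + κ))
        = (Q * L) * ε + M * ((∑ q ∈ Finset.range Q, ∑ j ∈ Finset.range L,
          ‖w (q * L + j) - w (q * L)‖) + (Q * L) * κ) := by
      simp only [Finset.sum_add_distrib, ← Finset.mul_sum, Finset.sum_const, Finset.card_range,
        nsmul_eq_mul]
      ring
    rw [h4]
    have h5 : ∑ q ∈ Finset.range Q, ∑ j ∈ Finset.range L, ‖w (q * L + j) - w (q * L)‖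
        ≤ L * Real.sqrt (n * (Real.sqrt d * pathLength T u)) :=
      h1.trans (mul_le_mul_of_nonneg_left h2 (Nat.cast_nonneg L))
    gcongr
  rw [hsplit]
  linarith

end IsBlockSetup
end Regret

/-! ### The actions played and the size of the bounds -/

section Play

theorem iaNum_le {n T : ℕ} (hT : 1 ≤ T) (hn : n ≤ T) : (iaNum n : ℝ) ≤ 3 + Real.log T := by
  have hT' : (1 : ℝ) ≤ T := by exact_mod_cast hT
  have hn' : (n : ℝ) ≤ T := by exact_mod_cast hn
  have hn0 : (0 : ℝ) ≤ n := Nat.cast_nonneg n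
  have hlog : 0 ≤ Real.log T := Real.log_nonneg hT'
  have h2 : 1 / 2 ≤ Real.log 2 := by linarith [Real.log_two_gt_d9]
  have h1 : Real.logb 2 (1 + 4 * (n : ℝ) / 7) ≤ 1 + 2 * Real.log T := by
    have : Real.logb 2 (1 + 4 * (n : ℝ) / 7) ≤ Real.logb 2 (2 * T) :=
      Real.logb_le_logb_of_le one_lt_two (by positivity) (by linarith)
    refine this.trans ?_
    rw [Real.logb, Real.log_mul two_ne_zero (by positivity), add_div, div_self (by positivity)]
    have : Real.log T / Real.log 2 ≤ 2 * Real.log T := by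
      rw [div_le_iff₀ (by positivity)]; nlinarith
    linarith
  have h0 : 0 ≤ (1 / 2 : ℝ) * Real.logb 2 (1 + 4 * (n : ℝ) / 7) := by
    refine mul_nonneg (by norm_num) (Real.logb_nonneg one_lt_two ?_)
    have : 0 ≤ 4 * (n : ℝ) / 7 := by positivity
    linarith
  have h3 := (Nat.ceil_lt_add_one h0).le
  rw [iaNum]
  push_cast
  linarith

theorem ceil_div_le_self {T L : ℕ} (hL : 0 < L) : ⌈(T : ℝ) / (L : ℝ)⌉₊ ≤ T :=
  Nat.ceil_le.2 (div_le_self (Nat.cast_nonneg T) (by exact_mod_cast hL))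

variable {d : ℕ} {E : Type*} {K : Set (Vec d)} {o : Vec d}
  {s : ℝ} {T L : ℕ} {G : ℝ} {x₁ : ℕ → Vec d}
  {resp : ℕ → E → Vec d → Vec d} {M ε κ : ℝ} {f : ℕ → Vec d → ℝ} {u : ℕ → Vec d}

/-- The action of the block algorithm in round `t`. -/
noncomputable def blockPlay (K : Set (Vec d)) (o : Vec d) (s : ℝ) (T L : ℕ) (G : ℝ)
    (x₁ : ℕ → Vec d) (resp : ℕ → E → Vec d → Vec d) (ω : (ℕ → ℝ × ℕ) × (ℕ → E)) (t : ℕ) : Vec d :=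
  sfttPlay o s K T L G x₁ (fun q => (ω.1 q).1) (fun q => (ω.1 q).2) (fun m => resp m (ω.2 m)) t

/-- The indicator of the event that round `t` is a query round. -/
noncomputable def isQuery (L t : ℕ) (ω : (ℕ → ℝ × ℕ) × (ℕ → E)) : ℝ :=
  if t = t / L * L + (ω.1 (t / L)).2 then 1 else 0

theorem blockPlay_eq (ω : (ℕ → ℝ × ℕ) × (ℕ → E)) (t : ℕ) :
    blockPlay K o s T L G x₁ resp ω t = if t = t / L * L + (ω.1 (t / L)).2 then
      hmap o s (ω.1 (t / L)).1 (blockAction K o s T L G x₁ resp ω (t / L))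
      else hmap o s 1 (blockAction K o s T L G x₁ resp ω (t / L)) := rfl

variable [MeasurableSpace E] {μ : ℕ → Measure E}

theorem measurableSet_isQuery (L t : ℕ) :
    MeasurableSet {ω : (ℕ → ℝ × ℕ) × (ℕ → E) | t = t / L * L + (ω.1 (t / L)).2} := by
  have h : Measurable fun ω : (ℕ → ℝ × ℕ) × (ℕ → E) => t / L * L + (ω.1 (t / L)).2 := by fun_prop
  exact measurableSet_eq_fun measurable_const h

theorem integrable_isQuery [∀ t, IsProbabilityMeasure (μ t)] (hL : 0 < L) (t : ℕ) :
    Integrable (isQuery L t) (drawLaw L μ) := by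
  have := isProbabilityMeasure_uniformOn_Iio hL
  refine integrable_of_measurable_of_bound (b := 1) ?_ fun ω => ?_
  · exact Measurable.ite (measurableSet_isQuery L t) measurable_const measurable_const
  · unfold isQuery; split_ifs <;> simp

/-- Each round is a query round with probability `1 / L`. -/
theorem integral_isQuery [∀ t, IsProbabilityMeasure (μ t)] (hL : 0 < L) (t : ℕ) :
    ∫ ω, isQuery L t ω ∂drawLaw L μ = (L : ℝ)⁻¹ := by
  have hU := isProbabilityMeasure_uniformOn_Iio hL
  have hm : Measurable (isQuery (E := E) L t) :=
    Measurable.ite (measurableSet_isQuery L t) measurable_const measurable_const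
  have hb : ∀ ω : (ℕ → ℝ × ℕ) × (ℕ → E), |isQuery L t ω| ≤ 1 := fun ω => by
    unfold isQuery; split_ifs <;> simp
  rw [integral_resample (measurePreserving_update_block μ (t / L)) hm hb]
  have h1 : ∀ ω : (ℕ → ℝ × ℕ) × (ℕ → E), ∫ a, isQuery L t (Function.update ω.1 (t / L) a, ω.2)
      ∂(zLaw.prod (ProbabilityTheory.uniformOn (Set.Iio L))) = (L : ℝ)⁻¹ := fun ω => by
    have h2 : ∀ a : ℝ × ℕ, isQuery L t (Function.update ω.1 (t / L) a, ω.2)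
        = (fun j => if t = t / L * L + j then (1 : ℝ) else 0) a.2 := fun a => by
      simp only [isQuery, Function.update_self]
    rw [integral_congr_ae (Filter.Eventually.of_forall h2),
      integral_fun_snd (fun j : ℕ => if t = t / L * L + j then (1 : ℝ) else 0),
      integral_uniformOn_Iio]
    have h3 : ∑ j ∈ Finset.range L, (if t = t / L * L + j then (1 : ℝ) else 0) = 1 := by
      rw [Finset.sum_eq_single (t % L)]
      · rw [if_pos (Nat.div_add_mod' t L).symm]
      · intro j _ hj
        rw [if_neg]
        have := Nat.div_add_mod' t L
        omega
      · intro h; exact absurd (Finset.mem_range.2 (Nat.mod_lt t hL)) h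
    rw [h3]; simp
  simp only [h1, integral_const, probReal_univ, one_smul]

namespace IsBlockSetup

variable (H : IsBlockSetup K o s T L G x₁ μ resp)
include H

theorem blockPlay_mem {ω : (ℕ → ℝ × ℕ) × (ℕ → E)} (hω : ∀ q, (ω.1 q).1 ∈ Set.Icc (0 : ℝ) 1)
    (t : ℕ) : blockPlay K o s T L G x₁ resp ω t ∈ dom o s K := by
  rw [blockPlay_eq]
  split_ifs
  · exact H.constraint.hmap_mem_dom H.pos.ne' (hω _) (H.blockAction_mem ω _)
  · exact H.constraint.hmap_mem_dom H.pos.ne' (by simp) (H.blockAction_mem ω _)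

theorem hmap_blockAction_mem (ω : (ℕ → ℝ × ℕ) × (ℕ → E)) (q : ℕ) :
    hmap o s 1 (blockAction K o s T L G x₁ resp ω q) ∈ K :=
  H.dom_subset (H.constraint.hmap_mem_dom H.pos.ne' (by simp) (H.blockAction_mem ω q))

variable [∀ t, IsProbabilityMeasure (μ t)]

theorem aemeasurable_blockPlay {t : ℕ} (ht : t < T) :
    AEMeasurable (fun ω => blockPlay K o s T L G x₁ resp ω t) (drawLaw L μ) := by
  have hz : Measurable fun ω : (ℕ → ℝ × ℕ) × (ℕ → E) => (ω.1 (t / L)).1 := by fun_prop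
  have h1 := (measurable_hmap o s).comp (hz.prodMk (H.measurable_truncAction (t / L)))
  have h2 : Measurable fun ω : (ℕ → ℝ × ℕ) × (ℕ → E) => if t = t / L * L + (ω.1 (t / L)).2 then
      hmap o s (ω.1 (t / L)).1 (truncAction K o s T L G x₁ resp ω (t / L))
      else hmap o s 1 (truncAction K o s T L G x₁ resp ω (t / L)) :=
    Measurable.ite (measurableSet_isQuery L t) (by simpa only [Function.comp_def] using h1)
      (H.measurable_hmap_truncAction (t / L))
  refine ⟨_, h2, ?_⟩
  filter_upwards [H.ae_blockAction_eq] with ω hω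
  have h3 := hω (t / L) ((Nat.div_mul_le_self t L).trans ht.le)
  rw [blockPlay_eq, h3]

theorem integrable_hmap_blockAction {t : ℕ} (ht : t < T) (hf : IsObjective K M (f t)) :
    Integrable (fun ω => f t (hmap o s 1 (blockAction K o s T L G x₁ resp ω (t / L))))
      (drawLaw L μ) := by
  have hU := isProbabilityMeasure_uniformOn_Iio H.length_pos
  refine hf.integrable_comp H.constraint ⟨_, H.measurable_hmap_truncAction (t / L), ?_⟩
    (Filter.Eventually.of_forall fun ω => H.hmap_blockAction_mem ω _)
  filter_upwards [H.ae_blockAction_eq] with ω hω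
  rw [hω (t / L) ((Nat.div_mul_le_self t L).trans ht.le)]

/-- Playing a point `y` within distance `c` of the action of the block algorithm instead of `h(x)`
costs at most `M √d` in query rounds and `M c` in the others. -/
theorem integral_hmap_sub_integral_le {t : ℕ} (ht : t < T) (hf : IsObjective K M (f t)) {c : ℝ}
    {y : (ℕ → ℝ × ℕ) × (ℕ → E) → Vec d} (hy : AEMeasurable y (drawLaw L μ))
    (hyK : ∀ᵐ ω ∂drawLaw L μ, y ω ∈ K)
    (hyc : ∀ᵐ ω ∂drawLaw L μ, ‖blockPlay K o s T L G x₁ resp ω t - y ω‖ ≤ c) :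
    (∫ ω, f t (hmap o s 1 (blockAction K o s T L G x₁ resp ω (t / L))) ∂drawLaw L μ)
      - ∫ ω, f t (y ω) ∂drawLaw L μ ≤ M * Real.sqrt d * (L : ℝ)⁻¹ + M * c := by
  have hU := isProbabilityMeasure_uniformOn_Iio H.length_pos
  have hM := hf.M_nonneg H.constraint
  rw [← integral_sub (H.integrable_hmap_blockAction ht hf) (hf.integrable_comp H.constraint hy hyK)]
  have hi := (integrable_isQuery (μ := μ) H.length_pos t).const_mul (M * Real.sqrt d)
  calc _ ≤ ∫ ω, (M * Real.sqrt d * isQuery L t ω + M * c) ∂drawLaw L μ := by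
        refine integral_mono_ae ((H.integrable_hmap_blockAction ht hf).sub
          (hf.integrable_comp H.constraint hy hyK)) (hi.add (integrable_const _)) ?_
        filter_upwards [hyK, hyc, ae_drawLaw_mem μ (L := L)] with ω h1 h2 h3
        have h4 := H.blockPlay_mem (fun q => (h3 q).1) t
        have h5 := hf.abs_sub_le H.constraint h1 (H.dom_subset h4)
        have h6 := (le_abs_self _).trans (h5.trans (mul_le_mul_of_nonneg_left h2 hM))
        rw [isQuery]
        split_ifs with hq
        · have := hf.sub_le_of_mem H.constraint (H.dom_subset h4) (H.hmap_blockAction_mem ω (t / L))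
          linarith
        · rw [blockPlay_eq, if_neg hq] at h6
          linarith
    _ = _ := by
        rw [integral_add hi (integrable_const _), integral_const_mul, integral_isQuery H.length_pos]
        simp

/-- The bound of `sum_gap_le` in terms of the quantities that grow with `T`. -/
theorem sum_gap_le_mul (hT : 1 ≤ T) (hf : ∀ t < T, IsObjective K M (f t)) (hε : 0 ≤ ε)
    (hgap : ∀ t < T, ∀ x ∈ dom o s K, ∀ u ∈ dom o s K,
      f t u / Real.exp 1 - f t (hmap o s 1 x) ≤ (1 - Real.exp (-1)) *
        (∫ z, ∫ η, inner ℝ (bqnd o s z (resp t η) x) (u - x) ∂μ t ∂zLaw) + ε)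
    (hu : ∀ t < T, u t ∈ K) (hκ : ∀ p ∈ K, ‖p - (o + s • p)‖ ≤ κ) :
    ∑ t ∈ Finset.range T, (f t (u t) / Real.exp 1
        - ∫ ω, f t (hmap o s 1 (blockAction K o s T L G x₁ resp ω (t / L))) ∂drawLaw L μ)
      ≤ 14 * d * (L * Real.sqrt ⌈(T : ℝ) / (L : ℝ)⌉₊) * (G + M)
          * ((1 + Real.log T) * Real.sqrt (1 + pathLength T u)) + T * (ε + M * κ) := by
  refine (H.sum_gap_le hT hf hε hgap hu hκ).trans ?_
  have hK := H.constraint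
  have hM : 0 ≤ M := (hf 0 hT).M_nonneg hK
  have hG := H.bound_pos
  have hd : (1 : ℝ) ≤ d := by exact_mod_cast hK.one_le_dim
  have hsd : Real.sqrt d ≤ d := Real.sqrt_le_iff.2 ⟨by linarith, by nlinarith⟩
  have hP : 0 ≤ pathLength T u := Finset.sum_nonneg fun _ _ => norm_nonneg _
  set Pl := pathLength T u with hPl
  set n := ⌈(T : ℝ) / (L : ℝ)⌉₊ with hn
  have hL : (0 : ℝ) < L := Nat.cast_pos.2 H.length_pos
  have hn1 : (1 : ℝ) ≤ n := by
    have : 0 < n := Nat.ceil_pos.2 (div_pos (Nat.cast_pos.2 hT) hL)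
    exact_mod_cast this
  set D := Metric.diam (dom o s K) with hD
  have hD0 : 0 ≤ D := Metric.diam_nonneg
  have hDle : D ≤ Real.sqrt d := hK.diam_le H.dom_subset
  have hlog : 0 ≤ Real.log T := Real.log_nonneg (by exact_mod_cast hT)
  have hN := iaNum_le hT (ceil_div_le_self (T := T) H.length_pos)
  rw [← hn] at hN
  set Λ := 1 + Real.log T with hΛ
  set S := Real.sqrt (1 + Pl) with hS
  have hS1 : 1 ≤ S := Real.one_le_sqrt.2 (by linarith)
  have hN' : 2 * (iaNum n : ℝ) + 8 ≤ 14 * Λ := by linarith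
  have hn_one : 1 ≤ Real.sqrt n := Real.one_le_sqrt.2 hn1
  have hsqrt : ∀ a : ℝ, a ≤ d ^ 2 * (1 + Pl) → Real.sqrt (n * a) ≤ Real.sqrt n * (d * S) := by
    intro a ha
    have e : Real.sqrt n * (d * S) = Real.sqrt (n * (d ^ 2 * (1 + Pl))) := by
      rw [Real.sqrt_mul (by positivity), Real.sqrt_mul (by positivity), Real.sqrt_sq (by positivity)]
    rw [e]
    exact Real.sqrt_le_sqrt (mul_le_mul_of_nonneg_left ha (by positivity))
  have h1 : Real.sqrt (n * (D ^ 2 + D * Pl)) ≤ Real.sqrt n * (d * S) := by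
    refine hsqrt _ ?_
    have e1 : D ≤ d := hDle.trans hsd
    nlinarith [mul_le_mul e1 e1 hD0 (by linarith), mul_le_mul_of_nonneg_right e1 hP,
      mul_nonneg hP (mul_nonneg (by linarith) (by linarith) : (0 : ℝ) ≤ d * (d - 1))]
  have h2 : Real.sqrt (n * (Real.sqrt d * Pl)) ≤ Real.sqrt n * (d * S) := by
    refine hsqrt _ ?_
    nlinarith [mul_le_mul_of_nonneg_right hsd hP, mul_nonneg hP
      (mul_nonneg (by linarith) (by linarith) : (0 : ℝ) ≤ d * (d - 1)), sq_nonneg (d : ℝ)]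
  have h3 : (L : ℝ) * ((2 * iaNum n + 8) * (G * Real.sqrt (n * (D ^ 2 + D * Pl))))
      ≤ L * ((14 * Λ) * (G * (Real.sqrt n * (d * S)))) := by gcongr
  have h4 : (L : ℝ) * Real.sqrt (n * (Real.sqrt d * Pl)) ≤ L * (Real.sqrt n * (d * S)) := by
    gcongr
  have hSn : 1 ≤ Real.sqrt n * S := one_le_mul_of_one_le_of_one_le hn_one hS1
  have h5 : (L : ℝ) * (M * Real.sqrt d) ≤ M * (L * (Real.sqrt n * (d * S))) := by
    calc (L : ℝ) * (M * Real.sqrt d) ≤ L * (M * d) := by gcongr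
      _ ≤ L * (M * d) * (Real.sqrt n * S) := le_mul_of_one_le_right (by positivity) hSn
      _ = _ := by ring
  have hΛ1 : 1 ≤ Λ := by linarith
  have h6 : M * (L * (Real.sqrt n * (d * S))) ≤ Λ * (M * (L * (Real.sqrt n * (d * S)))) :=
    le_mul_of_one_le_left (by positivity) hΛ1
  have h7 := mul_le_mul_of_nonneg_left h4 hM
  have h8 : 0 ≤ Λ * (M * (L * (Real.sqrt n * (d * S)))) := by positivity
  calc _ ≤ L * ((14 * Λ) * (G * (Real.sqrt n * (d * S))))
        + 14 * (Λ * (M * (L * (Real.sqrt n * (d * S))))) + T * (ε + M * κ) := by linarith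
    _ = _ := by ring

end IsBlockSetup
end Play

theorem dynRegret_eq_sum {d : ℕ} {Ω : Type u} [MeasurableSpace Ω] (P : Measure Ω) (T : ℕ)
    (f : ℕ → Vec d → ℝ) (u : ℕ → Vec d) (x : Ω → ℕ → Vec d) :
    dynRegret P T f u x
      = ∑ t ∈ Finset.range T, (f t (u t) / Real.exp 1 - ∫ ω, f t (x ω t) ∂P) := by
  rw [dynRegret, Finset.sum_sub_distrib, Finset.mul_sum]
  congr 1
  exact Finset.sum_congr rfl fun t _ => by ring

/-! ### The estimators supplied by the oracles -/

section Estimators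

variable {d : ℕ} {K : Set (Vec d)} {B M r δ : ℝ} {c : Vec d} {Ξ : Type u} [MeasurableSpace Ξ]
  {f : Vec d → ℝ}

theorem IsConstraintSet.nontrivial_linSpace (hK : IsConstraintSet K) : Nontrivial (linSpace K) := by
  obtain ⟨x, hx, y, hy, hxy⟩ := hK.nontrivial
  exact ⟨⟨x, Submodule.subset_span hx⟩, ⟨y, Submodule.subset_span hy⟩,
    fun h => hxy (congrArg Subtype.val h)⟩

theorem expWeighted_smul (z : ℝ) (p : Vec d) (s : ℝ) (a : Vec d) :
    expWeighted z p (s • a) = s • expWeighted z p a := by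
  ext i; simp only [expWeighted, PiLp.smul_apply, smul_eq_mul]; ring

theorem IsConstraintSet.expWeighted_mem (hK : IsConstraintSet K) {z : ℝ} (hz : 0 ≤ z) {p a : Vec d}
    (hp : p ∈ K) (ha : a ∈ K) : expWeighted z p a ∈ K := by
  have ha0 := fun i => (hK.subset_cube ha i).1
  have hp0 := fun i => (hK.subset_cube hp i).1
  refine hK.down_closed a ha _ fun i => ?_
  simp only [expWeighted]
  exact ⟨mul_nonneg (by positivity) (ha0 i), mul_le_of_le_one_left (ha0 i)
    (Real.exp_le_one_iff.2 (by nlinarith [mul_nonneg hz (hp0 i)]))⟩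

section InnerBall

variable (hK : IsConstraintSet K) (hc : IsInnerBall K c r) (hr : 0 < r) (hδ : 0 < δ) (hδr : δ < r)
include hK hc hr hδ hδr

/-- The shrunk domain keeps the distance `δ` from the relative boundary of `K`, as
`(1 - δ/r) p + (δ/r) c + δ w` is a convex combination of `p` and `c + r w`. -/
theorem IsConstraintSet.shrunk_add_mem {p w : Vec d} (hp : p ∈ K) (hw : w ∈ linSpace K)
    (hw1 : ‖w‖ ≤ 1) : (δ / r) • c + (1 - δ / r) • p + δ • w ∈ K := by
  have h1 : δ / r < 1 := (div_lt_one hr).2 hδr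
  have h2 := hK.convex hp (hc.2 (r • w) (Submodule.smul_mem _ _ hw) (by
    rw [norm_smul, Real.norm_of_nonneg hr.le]; exact mul_le_of_le_one_right hr.le hw1))
    (by linarith : 0 ≤ 1 - δ / r) (by positivity : 0 ≤ δ / r) (by ring)
  convert h2 using 1
  rw [smul_add, smul_smul, div_mul_cancel₀ _ hr.ne']
  abel

theorem IsConstraintSet.shrunk_add_mem_unitCube {p w : Vec d} (hp : p ∈ unitCube d)
    (hw : w ∈ linSpace K) (hw1 : ‖w‖ ≤ 1) :
    (δ / r) • c + (1 - δ / r) • p + δ • w ∈ unitCube d := by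
  have h1 : δ / r < 1 := (div_lt_one hr).2 hδr
  have h2 := convex_unitCube d hp (hK.subset_cube (hc.2 (r • w) (Submodule.smul_mem _ _ hw) (by
    rw [norm_smul, Real.norm_of_nonneg hr.le]; exact mul_le_of_le_one_right hr.le hw1)))
    (by linarith : 0 ≤ 1 - δ / r) (by positivity : 0 ≤ δ / r) (by ring)
  convert h2 using 1
  rw [smul_add, smul_smul, div_mul_cancel₀ _ hr.ne']
  abel

end InnerBall

variable {ν : Measure Ξ} [IsProbabilityMeasure ν]

theorem norm_onePoint_le {k : ℕ} {v y : Vec d} {g : Vec d → ℝ} (hδ : 0 < δ) (hv : ‖v‖ = 1)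
    (hg : |g (y + δ • v)| ≤ B) : ‖onePoint k δ v y g‖ ≤ k / δ * B := by
  rw [onePoint, norm_smul, hv, mul_one, norm_mul, Real.norm_eq_abs, Real.norm_eq_abs,
    abs_of_nonneg (by positivity : (0 : ℝ) ≤ k / δ)]
  exact mul_le_mul_of_nonneg_left hg (by positivity)

theorem measurable_onePoint {O : Vec d → Ξ → ℝ} (hO : Measurable (Function.uncurry O)) (k : ℕ)
    (δ : ℝ) : Measurable fun p : (Vec d × Ξ) × Vec d =>
      onePoint k δ p.1.1 p.2 fun w => O w p.1.2 := by
  have h1 : Measurable fun p : (Vec d × Ξ) × Vec d => (p.2 + δ • p.1.1, p.1.2) := by fun_prop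
  have h2 := hO.comp h1
  have h3 : Measurable fun p : (Vec d × Ξ) × Vec d => p.1.1 := by fun_prop
  have h4 := (h2.const_mul ((k : ℝ) / δ)).smul h3
  exact h4

theorem IsValueOracle.ae_norm_onePoint_le [Nontrivial (linSpace K)] {O : Vec d → Ξ → ℝ}
    (hO : IsValueOracle K B f ν O) (hδ : 0 < δ) (k : ℕ) {y : Vec d}
    (hy : ∀ w ∈ linSpace K, ‖w‖ ≤ 1 → y + δ • w ∈ K) :
    ∀ᵐ η ∂(sphereLaw (linSpace K)).prod ν,
      ‖onePoint k δ η.1 y fun w => O w η.2‖ ≤ k / δ * B := by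
  have := isProbabilityMeasure_sphereLaw (linSpace K)
  have hm : Measurable fun η : Vec d × Ξ => onePoint k δ η.1 y fun w => O w η.2 :=
    (measurable_onePoint hO.measurable k δ).comp
      (measurable_id.prodMk measurable_const : Measurable fun η : Vec d × Ξ => (η, y))
  refine (Measure.ae_prod_iff_ae_ae (measurableSet_le hm.norm measurable_const)).2 ?_
  filter_upwards [ae_sphereLaw (linSpace K)] with v hv
  filter_upwards [hO.bounded _ (hy v hv.1 hv.2.le)] with ξ hξ
  exact norm_onePoint_le hδ hv.2 hξ

/-- The derivative of an extension of `f` beyond `K` at relatively interior points of `K`, in the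
directions of the span of `K`. -/
theorem IsObjective.lineDeriv_eq_inner_grad (hf : IsObjective K M f) (hK : IsConstraintSet K)
    {F : Vec d → ℝ} (hF : Set.EqOn f F K) (hδ : 0 < δ) {y w a : Vec d}
    (hy : ∀ w ∈ linSpace K, ‖w‖ ≤ 1 → y + δ • w ∈ K) (hw : w ∈ linSpace K) (hw1 : ‖w‖ < 1)
    (ha : a ∈ linSpace K) :
    lineDeriv ℝ F (y + δ • w) a = inner ℝ (grad f (y + δ • w)) a := by
  have hcont : Continuous fun τ : ℝ => ‖w + (τ / δ) • a‖ := by fun_prop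
  have hS : {τ : ℝ | ‖w + (τ / δ) • a‖ < 1} ∈ nhds (0 : ℝ) :=
    (isOpen_lt hcont continuous_const).mem_nhds (by simpa using hw1)
  have hmem : ∀ τ ∈ {τ : ℝ | ‖w + (τ / δ) • a‖ < 1}, y + δ • w + τ • a ∈ K := fun τ hτ => by
    have h := hy (w + (τ / δ) • a) (Submodule.add_mem _ hw (Submodule.smul_mem _ _ ha)) hτ.le
    rwa [smul_add, smul_smul, mul_div_cancel₀ _ hδ.ne', ← add_assoc] at h
  have hγ : HasDerivAt (fun τ : ℝ => y + δ • w + τ • a) a 0 := by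
    simpa using ((hasDerivAt_id (0 : ℝ)).smul_const a).const_add (y + δ • w)
  have h1 := hf.hasDerivWithinAt_comp (hγ.hasDerivWithinAt)
    (fun τ hτ => hK.subset_cube (hmem τ hτ)) (mem_of_mem_nhds hS)
  have h2 := h1.hasDerivAt hS
  have h3 : HasLineDerivAt ℝ F (inner ℝ (grad f (y + δ • w + (0 : ℝ) • a)) a) (y + δ • w) a := by
    refine h2.congr_of_eventuallyEq ?_
    filter_upwards [hS] with τ hτ
    exact (hF (hmem τ hτ)).symm
  rw [h3.lineDeriv, zero_smul, add_zero]

/-- The one-point estimator is unbiased for the average of the gradient over a ball, in the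
directions of the span of `K`. -/
theorem IsValueOracle.integral_onePoint [Nontrivial (linSpace K)] {O : Vec d → Ξ → ℝ}
    (hO : IsValueOracle K B f ν O) (hf : IsObjective K M f) (hK : IsConstraintSet K) (hδ : 0 < δ)
    {y a : Vec d} (hy : ∀ w ∈ linSpace K, ‖w‖ ≤ 1 → y + δ • w ∈ K) (ha : a ∈ linSpace K) :
    ∫ η, inner ℝ (onePoint (Module.finrank ℝ (linSpace K)) δ η.1 y fun w => O w η.2) a
      ∂(sphereLaw (linSpace K)).prod ν
      = ∫ w, inner ℝ (grad f (y + δ • w)) a ∂ballLaw (linSpace K) := by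
  have := isProbabilityMeasure_sphereLaw (linSpace K)
  set k := Module.finrank ℝ (linSpace K) with hk
  obtain ⟨F, hFl, hF⟩ := (hf.lipschitzOnWith hK).extend_real
  have hm : Measurable fun η : Vec d × Ξ => onePoint k δ η.1 y fun w => O w η.2 :=
    (measurable_onePoint hO.measurable k δ).comp
      (measurable_id.prodMk measurable_const : Measurable fun η : Vec d × Ξ => (η, y))
  have hint : Integrable (fun η : Vec d × Ξ => inner ℝ
      (onePoint k δ η.1 y fun w => O w η.2) a) ((sphereLaw (linSpace K)).prod ν) := by
    refine Integrable.of_bound (measurable_inner_real hm measurable_const).aestronglyMeasurable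
      (k / δ * B * ‖a‖) ?_
    filter_upwards [hO.ae_norm_onePoint_le hδ k hy] with η hη
    exact (norm_inner_le_norm _ _).trans (mul_le_mul_of_nonneg_right hη (norm_nonneg _))
  rw [integral_prod _ hint]
  have h1 : ∀ᵐ v ∂sphereLaw (linSpace K), ∫ ξ, inner ℝ (onePoint k δ v y fun w => O w ξ) a ∂ν
      = k / δ * F (y + δ • v) * inner ℝ v a := by
    filter_upwards [ae_sphereLaw (linSpace K)] with v hv
    have hyv := hy v hv.1 hv.2.le
    simp only [onePoint, real_inner_smul_left]
    rw [integral_mul_const, integral_const_mul, hO.unbiased _ hyv, hF hyv]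
  rw [integral_congr_ae h1, integral_sphereLaw_onePoint (linSpace K) hFl hδ y ha]
  refine integral_congr_ae ?_
  filter_upwards [ae_ballLaw (linSpace K)] with w hw
  exact hf.lineDeriv_eq_inner_grad hK hF hδ hy hw.1 hw.2 ha

/-- The linearisation inequality for a first-order oracle. -/
theorem IsGradientOracle.gap_le {O : Vec d → Ξ → Vec d} (hO : IsGradientOracle K B f ν O)
    (hf : IsObjective K M f) (hK : IsConstraintSet K) {α : Type*} [MeasurableSpace α]
    {σ : Measure α} [IsProbabilityMeasure σ] {x u : Vec d} (hx : x ∈ K) (hu : u ∈ K) :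
    f u / Real.exp 1 - f (hmap 0 1 1 x) ≤ (1 - Real.exp (-1)) *
      ∫ z, ∫ η : α × Ξ, inner ℝ (bqnd 0 1 z (fun y => O y η.2) x) (u - x) ∂σ.prod ν ∂zLaw := by
  have hx' : x = 0 + (1 : ℝ) • x := by simp
  have h := IsObjective.gap_le_integral_inner hK hf (o := 0) (s := 1) zero_le_one
    (by simp) (by simp) hx hu
  simp only [zero_add, one_smul] at h
  have h1 : hmap 0 1 1 x = oneSubExp 1 x := by
    have := hmap_add_smul (d := d) one_ne_zero 1 0 x
    simpa using this
  rw [h1]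
  refine h.trans_eq ?_
  congr 1
  refine integral_congr_ae ?_
  filter_upwards [ae_zLaw_mem] with z hz
  have h2 : ∀ η : α × Ξ, inner ℝ (bqnd 0 1 z (fun y => O y η.2) x) (u - x)
      = (fun ξ => inner ℝ (O (oneSubExp z x) ξ) (expWeighted z x (u - x))) η.2 := fun η => by
    have := inner_bqnd (d := d) one_ne_zero z (fun y => O y η.2) 0 x (u - x)
    simpa using this
  have hmem := hK.oneSubExp_mem hz hx
  have hint : Integrable (fun ξ => O (oneSubExp z x) ξ) ν :=
    Integrable.of_bound (hO.measurable.comp measurable_prodMk_left).aestronglyMeasurable B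
      (hO.bounded _ hmem)
  rw [integral_congr_ae (Filter.Eventually.of_forall h2), integral_fun_snd
    (fun ξ => inner ℝ (O (oneSubExp z x) ξ) (expWeighted z x (u - x))), probReal_univ, one_smul]
  simp_rw [real_inner_comm (expWeighted z x (u - x))]
  rw [integral_inner hint, hO.unbiased _ hmem]

/-- The linearisation inequality for the one-point estimator: averaging the inequality for `f`
over shifts by `δ w`, which move the points by at most `δ`. -/
theorem IsValueOracle.gap_le {O : Vec d → Ξ → ℝ} (hO : IsValueOracle K B f ν O)
    (hf : IsObjective K M f) (hK : IsConstraintSet K) (hc : IsInnerBall K c r) (hr : 0 < r)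
    (hδ : 0 < δ) (hδr : δ < r) {x u : Vec d} (hx : x ∈ shrunk K c r δ) (hu : u ∈ shrunk K c r δ) :
    f u / Real.exp 1 - f (hmap ((δ / r) • c) (1 - δ / r) 1 x) ≤ (1 - Real.exp (-1)) *
      (∫ z, ∫ η, inner ℝ (bqnd ((δ / r) • c) (1 - δ / r) z (fun y =>
        onePoint (Module.finrank ℝ (linSpace K)) δ η.1 y fun w => O w η.2) x) (u - x)
        ∂(sphereLaw (linSpace K)).prod ν ∂zLaw) + 2 * M * δ := by
  have hV := hK.nontrivial_linSpace
  have hM := hf.M_nonneg hK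
  obtain ⟨p, hp, rfl⟩ := hx
  obtain ⟨q, hq, rfl⟩ := hu
  simp only
  set o := (δ / r) • c with ho
  set s := 1 - δ / r with hs
  have hs0 : 0 < s := by have := (div_lt_one hr).2 hδr; rw [hs]; linarith
  have hmem : ∀ {p w : Vec d}, p ∈ K → w ∈ linSpace K → ‖w‖ ≤ 1 → o + s • p + δ • w ∈ K :=
    fun hp hw hw1 => hK.shrunk_add_mem hc hr hδ hδr hp hw hw1
  have hmem' : ∀ {p w : Vec d}, p ∈ unitCube d → w ∈ linSpace K → ‖w‖ ≤ 1 →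
      o + s • p + δ • w ∈ unitCube d :=
    fun hp hw hw1 => hK.shrunk_add_mem_unitCube hc hr hδ hδr hp hw hw1
  have hmem0 : ∀ {p : Vec d}, p ∈ K → o + s • p ∈ K := fun hp => by
    simpa using hmem hp (Submodule.zero_mem _) (by simp)
  rw [hmap_add_smul hs0.ne']
  have hp0 := fun i => (hK.subset_cube hp i).1
  set J : ℝ → Vec d → ℝ := fun z w => inner ℝ ((unitCube d).indicator (grad f)
    (o + s • oneSubExp z p + δ • w)) (s • expWeighted z p (q - p)) with hJ
  have hsub : o + s • q - (o + s • p) = s • (q - p) := by rw [smul_sub]; abel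
  -- The query algorithm at `o + s p` estimates `⟨∇f(h_z + δ w), s (q - p) ⊙ exp (-z p)⟩`, averaged
  -- over `w` in the unit ball; the vector on the right is in the span of `K`, as `K` is down-closed.
  have hest : ∫ z, ∫ η, inner ℝ (bqnd o s z (fun y =>
        onePoint (Module.finrank ℝ (linSpace K)) δ η.1 y fun w => O w η.2) (o + s • p))
        (o + s • q - (o + s • p)) ∂(sphereLaw (linSpace K)).prod ν ∂zLaw
      = ∫ z, ∫ w, J z w ∂ballLaw (linSpace K) ∂zLaw := by
    refine integral_congr_ae ?_
    filter_upwards [ae_zLaw_mem] with z hz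
    have hyK := hK.oneSubExp_mem hz hp
    have ha : s • expWeighted z p (q - p) ∈ linSpace K := by
      rw [expWeighted_sub]
      exact Submodule.smul_mem _ _ (Submodule.sub_mem _
        (Submodule.subset_span (hK.expWeighted_mem hz.1 hp hq))
        (Submodule.subset_span (hK.expWeighted_mem hz.1 hp hp)))
    simp only [inner_bqnd hs0.ne', hsub, expWeighted_smul]
    rw [hO.integral_onePoint hf hK hδ (fun w hw hw1 => hmem hyK hw hw1) ha]
    refine integral_congr_ae ?_
    filter_upwards [ae_ballLaw (linSpace K)] with w hw
    simp only [hJ]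
    rw [Set.indicator_of_mem (hK.subset_cube (hmem hyK hw.1 hw.2.le))]
  rw [hest]
  have hmeas : Measurable fun a : ℝ × Vec d => J a.1 a.2 := by
    refine measurable_inner_grad hf ?_ ?_
    · have h1 : Measurable fun a : ℝ × Vec d => oneSubExp a.1 p :=
        (continuous_oneSubExp.comp (continuous_fst.prodMk continuous_const)).measurable
      exact ((h1.const_smul s).const_add o).add (measurable_snd.const_smul δ)
    · have h1 : Measurable fun a : ℝ × Vec d => expWeighted a.1 p (q - p) :=
        (continuous_expWeighted.comp
          (continuous_fst.prodMk (continuous_const.prodMk continuous_const))).measurable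
      exact h1.const_smul s
  have hint : Integrable (fun a : ℝ × Vec d => J a.1 a.2) (zLaw.prod (ballLaw (linSpace K))) := by
    refine Integrable.of_bound hmeas.aestronglyMeasurable (M * (s * ‖q - p‖)) ?_
    refine (Measure.ae_prod_iff_ae_ae (measurableSet_le hmeas.norm measurable_const)).2 ?_
    filter_upwards [ae_zLaw_mem] with z hz
    filter_upwards [ae_ballLaw (linSpace K)] with w hw
    have hyK := hmem (hK.oneSubExp_mem hz hp) hw.1 hw.2.le
    simp only [hJ]
    rw [Set.indicator_of_mem (hK.subset_cube hyK)]
    refine (norm_inner_le_norm _ _).trans (mul_le_mul (hf.norm_grad_le _ hyK) ?_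
      (norm_nonneg _) hM)
    rw [norm_smul, Real.norm_of_nonneg hs0.le]
    exact mul_le_mul_of_nonneg_left (norm_expWeighted_le hz.1 hp0 _) hs0.le
  rw [integral_integral_swap hint]
  -- The inequality on the domain shifted by `δ w`; shifting back costs `M δ` for each value of `f`.
  have hexp : 1 / Real.exp 1 ≤ 1 := by
    rw [div_le_one (Real.exp_pos _)]; exact Real.one_le_exp zero_le_one
  have hshift : ∀ᵐ w ∂ballLaw (linSpace K),
      f (o + s • q) / Real.exp 1 - f (o + s • oneSubExp 1 p) - 2 * M * δ
        ≤ (1 - Real.exp (-1)) * ∫ z, J z w ∂zLaw := by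
    filter_upwards [ae_ballLaw (linSpace K)] with w hw
    have hcomm : ∀ v : Vec d, o + δ • w + s • v = o + s • v + δ • w := fun v => by abel
    have h1 := IsObjective.gap_le_integral_inner hK hf (o := o + δ • w) hs0.le
      (fun v hv => by rw [hcomm]; exact hmem' hv hw.1 hw.2.le)
      (fun v hv => by rw [hcomm]; exact hmem hv hw.1 hw.2.le) hp hq
    simp only [hcomm] at h1
    have h2 : ∫ z, J z w ∂zLaw = ∫ z, inner ℝ (grad f (o + s • oneSubExp z p + δ • w))
        (s • expWeighted z p (q - p)) ∂zLaw := by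
      refine integral_congr_ae ?_
      filter_upwards [ae_zLaw_mem] with z hz
      simp only [hJ]
      rw [Set.indicator_of_mem (hK.subset_cube (hmem (hK.oneSubExp_mem hz hp) hw.1 hw.2.le))]
    rw [h2]
    have hnorm : ∀ v : Vec d, ‖v + δ • w - v‖ ≤ δ := fun v => by
      rw [add_sub_cancel_left, norm_smul, Real.norm_of_nonneg hδ.le]
      exact mul_le_of_le_one_right hδ.le hw.2.le
    have h1K := hK.oneSubExp_mem (z := 1) (by simp) hp
    have h3 := abs_le.1 ((hf.abs_sub_le hK (hmem0 hq) (hmem hq hw.1 hw.2.le)).trans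
      (mul_le_mul_of_nonneg_left (hnorm _) hM))
    have h4 := abs_le.1 ((hf.abs_sub_le hK (hmem0 h1K) (hmem h1K hw.1 hw.2.le)).trans
      (mul_le_mul_of_nonneg_left (hnorm _) hM))
    have h5 : f (o + s • q) / Real.exp 1 - f (o + s • q + δ • w) / Real.exp 1 ≤ M * δ := by
      rw [← sub_div, div_eq_mul_one_div]
      have h6 : f (o + s • q) - f (o + s • q + δ • w) ≤ M * δ := by linarith [h3.1]
      calc _ ≤ M * δ * (1 / Real.exp 1) := mul_le_mul_of_nonneg_right h6 (by positivity)
        _ ≤ M * δ := mul_le_of_le_one_right (by positivity) hexp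
    linarith [h4.2]
  have hint2 : Integrable (fun w => ∫ z, J z w ∂zLaw) (ballLaw (linSpace K)) :=
    hint.integral_prod_right
  have h7 := integral_mono_ae (integrable_const _) (hint2.const_mul (1 - Real.exp (-1))) hshift
  rw [integral_const, probReal_univ, one_smul, integral_const_mul] at h7
  linarith

theorem IsBlockSetup.of_gradientOracle {T L : ℕ} {x₁ : ℕ → Vec d} {f : ℕ → Vec d → ℝ}
    {ν : ℕ → Measure Ξ} [∀ t, IsProbabilityMeasure (ν t)] {O : ℕ → Vec d → Ξ → Vec d}
    (hK : IsConstraintSet K) (hL : 0 < L) (hB : 0 < B) (hx₁ : ∀ i, x₁ i ∈ K)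
    (hO : ∀ t < T, IsGradientOracle K B (f t) (ν t) (O t)) :
    IsBlockSetup K 0 1 T L B x₁ (fun t => (sphereLaw (linSpace K)).prod (ν t))
      (fun t (η : Vec d × Ξ) y => O t y η.2) where
  constraint := hK
  pos := one_pos
  le_one := le_rfl
  subset p hp := by simpa using hp
  length_pos := hL
  bound_pos := hB
  init_mem i := ⟨x₁ i, hx₁ i, by simp⟩
  measurable t ht := by
    have h1 : Measurable fun p : (Vec d × Ξ) × Vec d => (p.2, p.1.2) := by fun_prop
    exact (hO t ht).measurable.comp h1
  bounded t ht y hy := by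
    obtain ⟨p, hp, rfl⟩ := hy
    have := hK.nontrivial_linSpace
    have := isProbabilityMeasure_sphereLaw (linSpace K)
    exact Measure.quasiMeasurePreserving_snd.ae ((hO t ht).bounded _ (by simpa using hp))

theorem IsBlockSetup.of_valueOracle {T L : ℕ} {x₁ : ℕ → Vec d} {f : ℕ → Vec d → ℝ}
    {ν : ℕ → Measure Ξ} [∀ t, IsProbabilityMeasure (ν t)] {O : ℕ → Vec d → Ξ → ℝ}
    (hK : IsConstraintSet K) (hc : IsInnerBall K c r) (hr : 0 < r) (hδ : 0 < δ) (hδr : δ < r)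
    (hL : 0 < L) (hB : 0 < B) (hx₁ : ∀ i, x₁ i ∈ shrunk K c r δ)
    (hO : ∀ t < T, IsValueOracle K B (f t) (ν t) (O t)) :
    IsBlockSetup K ((δ / r) • c) (1 - δ / r) T L ((Module.finrank ℝ (linSpace K) : ℝ) / δ * B) x₁
      (fun t => (sphereLaw (linSpace K)).prod (ν t))
      (fun t (η : Vec d × Ξ) y =>
        onePoint (Module.finrank ℝ (linSpace K)) δ η.1 y fun w => O t w η.2) where
  constraint := hK
  pos := by have := (div_lt_one hr).2 hδr; linarith
  le_one := by have : 0 < δ / r := by positivity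
               linarith
  subset p hp := by
    simpa using hK.shrunk_add_mem hc hr hδ hδr hp (Submodule.zero_mem _) (by simp)
  length_pos := hL
  bound_pos := by
    have := hK.nontrivial_linSpace
    have : (0 : ℝ) < Module.finrank ℝ (linSpace K) := Nat.cast_pos.2 Module.finrank_pos
    positivity
  init_mem := hx₁
  measurable t ht := measurable_onePoint (hO t ht).measurable _ _
  bounded t ht y hy := by
    obtain ⟨p, hp, rfl⟩ := hy
    have := hK.nontrivial_linSpace
    exact (hO t ht).ae_norm_onePoint_le hδ _ fun w hw hw1 =>
      hK.shrunk_add_mem hc hr hδ hδr hp hw hw1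

end Estimators

/-! ### Regret bounds -/

section Regret

variable {d : ℕ} {K : Set (Vec d)} {o : Vec d} {s : ℝ} {T L : ℕ} {G M ε κ r δ : ℝ} {c : Vec d}

theorem ae_drawLaw_of_ae_round {E : Type*} [MeasurableSpace E] (μ : ℕ → Measure E)
    [∀ t, IsProbabilityMeasure (μ t)] (hL : 0 < L) (t : ℕ) {p : E → Prop} (h : ∀ᵐ e ∂μ t, p e) :
    ∀ᵐ ω ∂drawLaw L μ, p (ω.2 t) := by
  have := isProbabilityMeasure_uniformOn_Iio hL
  exact ((measurePreserving_eval_infinitePi μ t).quasiMeasurePreserving.comp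
    Measure.quasiMeasurePreserving_snd).ae h

/-- The regret of playing points `y` that cost at most `ρ` per round more than `h(x)`. -/
theorem IsBlockSetup.dynRegret_le {E : Type u} [MeasurableSpace E] {μ : ℕ → Measure E}
    [∀ t, IsProbabilityMeasure (μ t)] {x₁ : ℕ → Vec d} {resp : ℕ → E → Vec d → Vec d}
    {f : ℕ → Vec d → ℝ} {u : ℕ → Vec d} (H : IsBlockSetup K o s T L G x₁ μ resp)
    (hT : 1 ≤ T) (hf : ∀ t < T, IsObjective K M (f t)) (hε : 0 ≤ ε)
    (hgap : ∀ t < T, ∀ x ∈ dom o s K, ∀ u ∈ dom o s K,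
      f t u / Real.exp 1 - f t (hmap o s 1 x) ≤ (1 - Real.exp (-1)) *
        (∫ z, ∫ η, inner ℝ (bqnd o s z (resp t η) x) (u - x) ∂μ t ∂zLaw) + ε)
    (hu : ∀ t < T, u t ∈ K) (hκ : ∀ p ∈ K, ‖p - (o + s • p)‖ ≤ κ) {ρ : ℝ}
    {y : (ℕ → ℝ × ℕ) × (ℕ → E) → ℕ → Vec d}
    (hρ : ∀ t < T, (∫ ω, f t (hmap o s 1 (blockAction K o s T L G x₁ resp ω (t / L)))
      ∂drawLaw L μ) - ∫ ω, f t (y ω t) ∂drawLaw L μ ≤ ρ) :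
    dynRegret (drawLaw L μ) T f u y ≤ 14 * d * (L * Real.sqrt ⌈(T : ℝ) / (L : ℝ)⌉₊) * (G + M)
      * ((1 + Real.log T) * Real.sqrt (1 + pathLength T u)) + T * (ε + M * κ) + T * ρ := by
  have h1 := H.sum_gap_le_mul hT hf hε hgap hu hκ
  have h2 := Finset.sum_le_sum fun t ht => hρ t (Finset.mem_range.1 ht)
  rw [Finset.sum_const, Finset.card_range, nsmul_eq_mul] at h2
  rw [dynRegret_eq_sum]
  refine le_trans (le_of_eq ?_) (add_le_add h1 h2)
  rw [← Finset.sum_add_distrib]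
  exact Finset.sum_congr rfl fun t _ => by ring

theorem le_blockLength (T : ℕ) : (T : ℝ) ^ (1 / 3 : ℝ) ≤ blockLength T := Nat.le_ceil _

theorem blockLength_pos (hT : 1 ≤ T) : 0 < blockLength T :=
  Nat.ceil_pos.2 (Real.rpow_pos_of_pos (by exact_mod_cast hT) _)

theorem mul_inv_blockLength_le (hT : 1 ≤ T) :
    (T : ℝ) * (blockLength T : ℝ)⁻¹ ≤ (T : ℝ) ^ (2 / 3 : ℝ) := by
  have hT0 : (0 : ℝ) < T := by exact_mod_cast hT
  rw [← div_eq_mul_inv, div_le_iff₀ (Nat.cast_pos.2 (blockLength_pos hT))]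
  calc (T : ℝ) = (T : ℝ) ^ (2 / 3 : ℝ) * (T : ℝ) ^ (1 / 3 : ℝ) := by
        rw [← Real.rpow_add hT0]; norm_num
    _ ≤ _ := mul_le_mul_of_nonneg_left (le_blockLength T) (by positivity)

theorem blockLength_mul_sqrt_le (hT : 1 ≤ T) :
    (blockLength T : ℝ) * Real.sqrt ⌈(T : ℝ) / (blockLength T : ℝ)⌉₊ ≤ 4 * (T : ℝ) ^ (2 / 3 : ℝ) := by
  have hT0 : (0 : ℝ) < T := by exact_mod_cast hT
  have hT1 : (1 : ℝ) ≤ T := by exact_mod_cast hT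
  set a := (T : ℝ) ^ (1 / 3 : ℝ) with ha
  have ha1 : 1 ≤ a := Real.one_le_rpow hT1 (by norm_num)
  have ha2 : (T : ℝ) ^ (2 / 3 : ℝ) = a ^ 2 := by
    rw [ha, ← Real.rpow_natCast, ← Real.rpow_mul hT0.le]; norm_num
  have h1 : (blockLength T : ℝ) ≤ 2 * a := by
    have := (Nat.ceil_lt_add_one (by positivity : 0 ≤ a)).le
    have h : (blockLength T : ℝ) ≤ a + 1 := this
    linarith
  have h2 : (⌈(T : ℝ) / (blockLength T : ℝ)⌉₊ : ℝ) ≤ (2 * a) ^ 2 := by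
    have h3 := (Nat.ceil_lt_add_one (by positivity : 0 ≤ (T : ℝ) / (blockLength T : ℝ))).le
    have h4 := mul_inv_blockLength_le hT
    rw [← div_eq_mul_inv, ha2] at h4
    nlinarith
  calc _ ≤ 2 * a * (2 * a) :=
        mul_le_mul h1 ((Real.sqrt_le_left (by positivity)).2 h2) (Real.sqrt_nonneg _)
          (by positivity)
    _ = _ := by rw [ha2]; ring

theorem one_le_log_mul_sqrt (hT : 1 ≤ T) (u : ℕ → Vec d) :
    1 ≤ (1 + Real.log T) * Real.sqrt (1 + pathLength T u) := by
  have hlog : 0 ≤ Real.log T := Real.log_nonneg (by exact_mod_cast hT)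
  have hP : 0 ≤ pathLength T u := Finset.sum_nonneg fun _ _ => norm_nonneg _
  exact one_le_mul_of_one_le_of_one_le (by linarith) (Real.one_le_sqrt.2 (by linarith))

theorem IsConstraintSet.norm_sub_shrunk_le (hK : IsConstraintSet K) (hc : c ∈ K) (hr : 0 < r)
    (hδ : 0 < δ) {p : Vec d} (hp : p ∈ K) :
    ‖p - ((δ / r) • c + (1 - δ / r) • p)‖ ≤ δ / r * Real.sqrt d := by
  have h : p - ((δ / r) • c + (1 - δ / r) • p) = (δ / r) • (p - c) := by
    rw [sub_smul, one_smul, smul_sub]; abel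
  rw [h, norm_smul, Real.norm_of_nonneg (by positivity)]
  exact mul_le_mul_of_nonneg_left
    (norm_sub_le_of_mem_unitCube (hK.subset_cube hp) (hK.subset_cube hc)) (by positivity)

theorem finrank_linSpace_le (K : Set (Vec d)) : Module.finrank ℝ (linSpace K) ≤ d := by
  simpa using Submodule.finrank_le (linSpace K)

variable {B : ℝ} {Ξ : Type u} [MeasurableSpace Ξ] {ν : ℕ → Measure Ξ}
  [∀ t, IsProbabilityMeasure (ν t)] {f : ℕ → Vec d → ℝ} {x₁ u : ℕ → Vec d}

theorem dynRegret_semiBanditPlay_le (hK : IsConstraintSet K) (hB : 0 < B)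
    {O : ℕ → Vec d → Ξ → Vec d} (hT : 1 ≤ T) (hf : ∀ t < T, IsObjective K M (f t))
    (hO : ∀ t < T, IsGradientOracle K B (f t) (ν t) (O t)) (hx₁ : ∀ i, x₁ i ∈ K)
    (hu : IsOptimalSequence K T f u) :
    dynRegret (outcomeLaw (linSpace K) (blockLength T) ν) T f u (semiBanditPlay K B T x₁ O)
      ≤ (56 * d * (B + M) + M * Real.sqrt d) *
        ((T : ℝ) ^ (2 / 3 : ℝ) * ((1 + Real.log T) * Real.sqrt (1 + pathLength T u))) := by
  have := hK.nontrivial_linSpace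
  have := isProbabilityMeasure_sphereLaw (linSpace K)
  have hM := (hf 0 hT).M_nonneg hK
  have hL := blockLength_pos hT
  have hU := isProbabilityMeasure_uniformOn_Iio hL
  have H := IsBlockSetup.of_gradientOracle (x₁ := x₁) (f := f) hK hL hB hx₁ hO
  have h := H.dynRegret_le (ε := 0) (κ := 0) (y := semiBanditPlay K B T x₁ O)
    (ρ := M * Real.sqrt d * (blockLength T : ℝ)⁻¹ + M * 0) hT hf le_rfl
    (fun t ht x hx u hu => by
      obtain ⟨x, hx, rfl⟩ := hx
      obtain ⟨u, hu, rfl⟩ := hu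
      simp only [zero_add, one_smul, add_zero]
      exact (hO t ht).gap_le (hf t ht) hK hx hu)
    (fun t ht => (hu t ht).1) (by simp)
    (fun t ht => H.integral_hmap_sub_integral_le ht (hf t ht) (H.aemeasurable_blockPlay ht) (by
      filter_upwards [ae_drawLaw_mem _ (L := blockLength T)] with ω hω
      exact H.dom_subset (H.blockPlay_mem (fun q => (hω q).1) t))
      (Filter.Eventually.of_forall fun ω => by simp [blockPlay, semiBanditPlay]))
  refine h.trans ?_
  have h1 := blockLength_mul_sqrt_le hT
  have h2 := mul_inv_blockLength_le hT
  have h3 := one_le_log_mul_sqrt hT u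
  set A := (T : ℝ) ^ (2 / 3 : ℝ) with hA
  set S := (1 + Real.log T) * Real.sqrt (1 + pathLength T u) with hS
  have hA0 : 0 ≤ A := by positivity
  calc _ ≤ 14 * d * (4 * A) * (B + M) * S + T * (0 + M * 0)
        + M * Real.sqrt d * (T * (blockLength T : ℝ)⁻¹) := by
        rw [add_assoc, add_assoc]
        refine add_le_add (by gcongr) (le_of_eq (by ring))
    _ ≤ 14 * d * (4 * A) * (B + M) * S + T * (0 + M * 0) + M * Real.sqrt d * (A * S) := by
        refine add_le_add le_rfl (mul_le_mul_of_nonneg_left ?_ (by positivity))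
        exact h2.trans (le_mul_of_one_le_right hA0 h3)
    _ = _ := by ring

theorem dynRegret_zerothOrderPlay_le (hK : IsConstraintSet K) (hc : IsInnerBall K c r)
    (hB : 0 < B) (hr : 0 < r) {O : ℕ → Vec d → Ξ → ℝ} (hT : 1 ≤ T)
    (hδT : δ = (T : ℝ) ^ (-(1 / 4) : ℝ)) (hδr : δ < r) (hf : ∀ t < T, IsObjective K M (f t))
    (hO : ∀ t < T, IsValueOracle K B (f t) (ν t) (O t)) (hx₁ : ∀ i, x₁ i ∈ shrunk K c r δ)
    (hu : IsOptimalSequence K T f u) :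
    dynRegret (outcomeLaw (linSpace K) 1 ν) T f u (zerothOrderPlay K c r B δ T x₁ O)
      ≤ (14 * d * (d * B + M) + (2 * M + M * (Real.sqrt d / r))) *
        ((T : ℝ) ^ (3 / 4 : ℝ) * ((1 + Real.log T) * Real.sqrt (1 + pathLength T u))) := by
  have := hK.nontrivial_linSpace
  have := isProbabilityMeasure_sphereLaw (linSpace K)
  have hM := (hf 0 hT).M_nonneg hK
  have hU := isProbabilityMeasure_uniformOn_Iio one_pos
  have hT0 : (0 : ℝ) < T := by exact_mod_cast hT
  have hδ : 0 < δ := hδT ▸ Real.rpow_pos_of_pos hT0 _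
  have H := IsBlockSetup.of_valueOracle (x₁ := x₁) (f := f) hK hc hr hδ hδr one_pos hB hx₁ hO
  have h := H.dynRegret_le (ε := 2 * M * δ) (κ := δ / r * Real.sqrt d)
    (y := zerothOrderPlay K c r B δ T x₁ O) (ρ := 0) hT hf (by positivity)
    (fun t ht x hx u hu => (hO t ht).gap_le (hf t ht) hK hc hr hδ hδr hx hu)
    (fun t ht => (hu t ht).1) (fun p hp => hK.norm_sub_shrunk_le hc.1 hr hδ hp)
    (fun t ht => by
      refine (sub_eq_zero.2 (integral_congr_ae ?_)).le
      filter_upwards [ae_drawLaw_mem _ (L := 1)] with ω hω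
      -- In a block of one round the position of the query is `0`.
      have hj : ∀ q, (ω.1 q).2 = 0 := fun q => Nat.lt_one_iff.1 (hω q).2
      have hfb : ∀ resp : ℕ → Vec d × Ξ → Vec d → Vec d,
          blockFeedback ((δ / r) • c) (1 - δ / r) 1 resp ω
            = fun m => bqnd ((δ / r) • c) (1 - δ / r) (ω.1 m).1 (resp m (ω.2 m)) := fun resp => by
        funext m; simp only [blockFeedback, hj, mul_one, add_zero]
      simp only [zerothOrderPlay, fullInfoPlay, blockAction, hfb, Nat.div_one, Nat.cast_one,
        div_one, Nat.ceil_natCast])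
  refine h.trans ?_
  have h3 := one_le_log_mul_sqrt hT u
  set S := (1 + Real.log T) * Real.sqrt (1 + pathLength T u) with hS
  set b := (T : ℝ) ^ (1 / 4 : ℝ) with hb
  have hb1 : 1 ≤ b := Real.one_le_rpow (by exact_mod_cast hT) (by norm_num)
  have hbT : (T : ℝ) = b ^ 4 := by
    rw [hb, ← Real.rpow_natCast, ← Real.rpow_mul hT0.le]; norm_num
  have hb3 : (T : ℝ) ^ (3 / 4 : ℝ) = b ^ 3 := by
    rw [hb, ← Real.rpow_natCast, ← Real.rpow_mul hT0.le]; norm_num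
  have hδb : δ = b⁻¹ := by rw [hδT, Real.rpow_neg hT0.le]
  have hsqrt : Real.sqrt T = b ^ 2 := by
    rw [hbT, show b ^ 4 = (b ^ 2) ^ 2 by ring, Real.sqrt_sq (by positivity)]
  have hk : (Module.finrank ℝ (linSpace K) : ℝ) ≤ d := by exact_mod_cast finrank_linSpace_le K
  have hG : (Module.finrank ℝ (linSpace K) : ℝ) / δ * B + M ≤ b * (d * B + M) := by
    rw [hδb, div_inv_eq_mul]
    have h4 := mul_le_mul_of_nonneg_right hk (by positivity : 0 ≤ b * B)
    have h5 := le_mul_of_one_le_left hM hb1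
    linarith
  have hTδ : (T : ℝ) * δ = b ^ 3 := by
    rw [hbT, hδb]; field_simp
  rw [hb3]
  simp only [Nat.cast_one, div_one, Nat.ceil_natCast, one_mul, hsqrt, mul_zero, add_zero]
  calc _ ≤ 14 * d * b ^ 2 * (b * (d * B + M)) * S
        + (2 * M + M * (Real.sqrt d / r)) * (T * δ) := by
        refine add_le_add (by gcongr) (le_of_eq (by ring))
    _ ≤ 14 * d * b ^ 2 * (b * (d * B + M)) * S
        + (2 * M + M * (Real.sqrt d / r)) * (b ^ 3 * S) := by
        rw [hTδ]
        gcongr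
        exact le_mul_of_one_le_right (by positivity) h3
    _ = _ := by ring

theorem dynRegret_banditPlay_le (hK : IsConstraintSet K) (hc : IsInnerBall K c r)
    (hB : 0 < B) (hr : 0 < r) {O : ℕ → Vec d → Ξ → ℝ} (hT : 1 ≤ T)
    (hδT : δ = (T : ℝ) ^ (-(1 / 6) : ℝ)) (hδr : δ < r) (hf : ∀ t < T, IsObjective K M (f t))
    (hO : ∀ t < T, IsValueOracle K B (f t) (ν t) (O t)) (hx₁ : ∀ i, x₁ i ∈ shrunk K c r δ)
    (hu : IsOptimalSequence K T f u) :
    dynRegret (outcomeLaw (linSpace K) (blockLength T) ν) T f u (banditPlay K c r B δ T x₁ O)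
      ≤ (56 * d * (d * B + M) + (3 * M + M * (Real.sqrt d / r) + M * Real.sqrt d)) *
        ((T : ℝ) ^ (5 / 6 : ℝ) * ((1 + Real.log T) * Real.sqrt (1 + pathLength T u))) := by
  have := hK.nontrivial_linSpace
  have := isProbabilityMeasure_sphereLaw (linSpace K)
  have hM := (hf 0 hT).M_nonneg hK
  have hL := blockLength_pos hT
  have hU := isProbabilityMeasure_uniformOn_Iio hL
  have hT0 : (0 : ℝ) < T := by exact_mod_cast hT
  have hδ : 0 < δ := hδT ▸ Real.rpow_pos_of_pos hT0 _
  have H := IsBlockSetup.of_valueOracle (x₁ := x₁) (f := f) hK hc hr hδ hδr hL hB hx₁ hO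
  have hv : ∀ t, ∀ᵐ ω ∂outcomeLaw (linSpace K) (blockLength T) ν,
      (ω.2 t).1 ∈ linSpace K ∧ ‖(ω.2 t).1‖ = 1 := fun t =>
    ae_drawLaw_of_ae_round (fun t => (sphereLaw (linSpace K)).prod (ν t)) hL t
      (Measure.quasiMeasurePreserving_fst.ae (ae_sphereLaw (linSpace K)))
  have h := H.dynRegret_le (ε := 2 * M * δ) (κ := δ / r * Real.sqrt d)
    (y := banditPlay K c r B δ T x₁ O)
    (ρ := M * Real.sqrt d * (blockLength T : ℝ)⁻¹ + M * δ) hT hf (by positivity)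
    (fun t ht x hx u hu => (hO t ht).gap_le (hf t ht) hK hc hr hδ hδr hx hu)
    (fun t ht => (hu t ht).1) (fun p hp => hK.norm_sub_shrunk_le hc.1 hr hδ hp)
    (fun t ht => by
      refine H.integral_hmap_sub_integral_le ht (hf t ht) ?_ ?_ ?_
      · have hm : Measurable fun ω : Outcome d Ξ => δ • (ω.2 t).1 := by fun_prop
        exact (H.aemeasurable_blockPlay ht).add hm.aemeasurable
      · filter_upwards [ae_drawLaw_mem _ (L := blockLength T), hv t] with ω hω hvω
        obtain ⟨p, hp, hpe⟩ := H.blockPlay_mem (fun q => (hω q).1) t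
        have h1 := hK.shrunk_add_mem hc hr hδ hδr hp hvω.1 hvω.2.le
        simp only at hpe
        rw [hpe] at h1
        exact h1
      · filter_upwards [hv t] with ω hvω
        have h1 : ∀ x : Vec d, ‖x - (x + δ • (ω.2 t).1)‖ ≤ δ := fun x => by
          rw [sub_add_cancel_left, norm_neg, norm_smul, hvω.2, Real.norm_of_nonneg hδ.le, mul_one]
        exact h1 _)
  refine h.trans ?_
  have h1 := blockLength_mul_sqrt_le hT
  have h2 := mul_inv_blockLength_le hT
  have h3 := one_le_log_mul_sqrt hT u
  set S := (1 + Real.log T) * Real.sqrt (1 + pathLength T u) with hS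
  set b := (T : ℝ) ^ (1 / 6 : ℝ) with hb
  have hb1 : 1 ≤ b := Real.one_le_rpow (by exact_mod_cast hT) (by norm_num)
  have hbT : (T : ℝ) = b ^ 6 := by
    rw [hb, ← Real.rpow_natCast, ← Real.rpow_mul hT0.le]; norm_num
  have hb4 : (T : ℝ) ^ (2 / 3 : ℝ) = b ^ 4 := by
    rw [hb, ← Real.rpow_natCast, ← Real.rpow_mul hT0.le]; norm_num
  have hb5 : (T : ℝ) ^ (5 / 6 : ℝ) = b ^ 5 := by
    rw [hb, ← Real.rpow_natCast, ← Real.rpow_mul hT0.le]; norm_num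
  have hδb : δ = b⁻¹ := by rw [hδT, Real.rpow_neg hT0.le]
  have hk : (Module.finrank ℝ (linSpace K) : ℝ) ≤ d := by exact_mod_cast finrank_linSpace_le K
  have hG : (Module.finrank ℝ (linSpace K) : ℝ) / δ * B + M ≤ b * (d * B + M) := by
    rw [hδb, div_inv_eq_mul]
    have h4 := mul_le_mul_of_nonneg_right hk (by positivity : 0 ≤ b * B)
    have h5 := le_mul_of_one_le_left hM hb1
    linarith
  have hTδ : (T : ℝ) * δ = b ^ 5 := by
    rw [hbT, hδb]; field_simp
  have hb45 : b ^ 4 ≤ b ^ 5 := pow_le_pow_right₀ hb1 (by norm_num)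
  rw [hb4] at h1 h2
  rw [hb5]
  calc _ ≤ 14 * d * (4 * b ^ 4) * (b * (d * B + M)) * S
        + ((3 * M + M * (Real.sqrt d / r)) * (T * δ)
          + M * Real.sqrt d * (T * (blockLength T : ℝ)⁻¹)) := by
        rw [add_assoc]
        refine add_le_add (by gcongr) (le_of_eq (by ring))
    _ ≤ 14 * d * (4 * b ^ 4) * (b * (d * B + M)) * S
        + ((3 * M + M * (Real.sqrt d / r)) * (b ^ 5 * S) + M * Real.sqrt d * (b ^ 5 * S)) := by
        have h6 : b ^ 5 ≤ b ^ 5 * S := le_mul_of_one_le_right (by positivity) h3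
        rw [hTδ]
        exact add_le_add le_rfl (add_le_add (mul_le_mul_of_nonneg_left h6 (by positivity))
          (mul_le_mul_of_nonneg_left (h2.trans (hb45.trans h6)) (by positivity)))
    _ = _ := by ring

end Regret
end DRSub

theorem proposition7 (d : ℕ) (M B r : ℝ) (hB : 0 < B) (hr : 0 < r) :
    -- semi-bandit feedback
    (∃ (C : ℝ) (p : ℕ), ∀ (K : Set (Vec d)), IsConstraintSet K →
      ∀ (Ξ : Type u) [MeasurableSpace Ξ] (ν : ℕ → Measure Ξ) [∀ t, IsProbabilityMeasure (ν t)]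
        (T : ℕ) (f : ℕ → Vec d → ℝ) (O : ℕ → Vec d → Ξ → Vec d) (x₁ u : ℕ → Vec d),
      1 ≤ T →
      (∀ t < T, IsObjective K M (f t)) →
      (∀ t < T, IsGradientOracle K B (f t) (ν t) (O t)) →
      (∀ i, x₁ i ∈ K) →
      IsOptimalSequence K T f u →
      dynRegret (outcomeLaw (linSpace K) (blockLength T) ν) T f u (semiBanditPlay K B T x₁ O)
        ≤ C * (1 + Real.log T) ^ p * ((T : ℝ) ^ (2 / 3 : ℝ) * Real.sqrt (1 + pathLength T u))) ∧
    -- zeroth-order full-information feedback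
    (∃ (C : ℝ) (p : ℕ), ∀ (K : Set (Vec d)), IsConstraintSet K →
      ∀ (c : Vec d), IsInnerBall K c r →
      ∀ (Ξ : Type u) [MeasurableSpace Ξ] (ν : ℕ → Measure Ξ) [∀ t, IsProbabilityMeasure (ν t)]
        (T : ℕ) (δ : ℝ) (f : ℕ → Vec d → ℝ) (O : ℕ → Vec d → Ξ → ℝ) (x₁ u : ℕ → Vec d),
      1 ≤ T →
      δ = (T : ℝ) ^ (-(1 / 4) : ℝ) →
      δ < r →
      (∀ t < T, IsObjective K M (f t)) →
      (∀ t < T, IsValueOracle K B (f t) (ν t) (O t)) →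
      (∀ i, x₁ i ∈ shrunk K c r δ) →
      IsOptimalSequence K T f u →
      dynRegret (outcomeLaw (linSpace K) 1 ν) T f u (zerothOrderPlay K c r B δ T x₁ O)
        ≤ C * (1 + Real.log T) ^ p * ((T : ℝ) ^ (3 / 4 : ℝ) * Real.sqrt (1 + pathLength T u))) ∧
    -- bandit feedback
    (∃ (C : ℝ) (p : ℕ), ∀ (K : Set (Vec d)), IsConstraintSet K →
      ∀ (c : Vec d), IsInnerBall K c r →
      ∀ (Ξ : Type u) [MeasurableSpace Ξ] (ν : ℕ → Measure Ξ) [∀ t, IsProbabilityMeasure (ν t)]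
        (T : ℕ) (δ : ℝ) (f : ℕ → Vec d → ℝ) (O : ℕ → Vec d → Ξ → ℝ) (x₁ u : ℕ → Vec d),
      1 ≤ T →
      δ = (T : ℝ) ^ (-(1 / 6) : ℝ) →
      δ < r →
      (∀ t < T, IsObjective K M (f t)) →
      (∀ t < T, IsValueOracle K B (f t) (ν t) (O t)) →
      (∀ i, x₁ i ∈ shrunk K c r δ) →
      IsOptimalSequence K T f u →
      dynRegret (outcomeLaw (linSpace K) (blockLength T) ν) T f u (banditPlay K c r B δ T x₁ O)
        ≤ C * (1 + Real.log T) ^ p * ((T : ℝ) ^ (5 / 6 : ℝ) * Real.sqrt (1 + pathLength T u))) := by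
  refine ⟨⟨56 * d * (B + M) + M * Real.sqrt d, 1, ?_⟩,
    ⟨14 * d * (d * B + M) + (2 * M + M * (Real.sqrt d / r)), 1, ?_⟩,
    ⟨56 * d * (d * B + M) + (3 * M + M * (Real.sqrt d / r) + M * Real.sqrt d), 1, ?_⟩⟩
  · intro K hK Ξ _ ν _ T f O x₁ u hT hf hO hx₁ hu
    exact (dynRegret_semiBanditPlay_le hK hB hT hf hO hx₁ hu).trans_eq (by ring)
  · intro K hK c hc Ξ _ ν _ T δ f O x₁ u hT hδ hδr hf hO hx₁ hu
    exact (dynRegret_zerothOrderPlay_le hK hc hB hr hT hδ hδr hf hO hx₁ hu).trans_eq (by ring)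
  · intro K hK c hc Ξ _ ν _ T δ f O x₁ u hT hδ hδr hf hO hx₁ hu
    exact (dynRegret_banditPlay_le hK hc hB hr hT hδ hδr hf hO hx₁ hu).trans_eq (by ring)
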